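/- Let $\varepsilon\in(0,\tfrac13)$. There is $\lambda_0\in(0,1)$, depending only on $\varepsilon$, such that the following holds for every $\lambda\in(0,\lambda_0)$. **The market.** On a complete probability space $(\Omega,\mathcal F,P)$ let $\xi,\eta,\theta$ be independent random variables with $P[\xi=3]=\frac56$, $P[\xi=\frac12]=\frac16$, $P[\eta=2]=1-\varepsilon$, $P[\eta=\frac1n]=\varepsilon2^{-n}$ for $n\ge1$, and $\theta$ exponentially distributed with mean $1$. Put $\sigma=(\theta+\frac12)\wedge1$, $a_t=\frac13-\frac13(t-\frac12)$ and let the ask price be $$S_t=\big(1+(\xi-1)1_{\{\frac12\le t\}}\big)\big(1+a_\sigma(\eta-1)1_{\{\sigma\le t\}}\big),\qquad t\in[0,1],$$ so that a.s. $S_0=1$, $S_{1/2}=S_{\sigma-}=\xi$. The filtration $(\mathcal F_t)_{0\le t\le1}$ is the one generated by $S$ and $1_{\{\sigma\le t\}}$, completed and made right continuous. A $\lambda$-consistent price system is a pair $(Z^0,Z^1)$ where $Z^0$ is the density process of a probability measure $Q\sim P$, $Z^1=Z^0\widetilde S$, and $\widetilde S$ is a $Q$-local martingale with values in $[(1-\lambda)S,S]$.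 **The dual optimiser.** Let $\widehat\varphi_{1/2}=\frac{19-\lambda}{12(1+\lambda)}$ (the maximiser of $\ell\mapsto\frac16\log(1+\ell(\frac{1-\lambda}2-1))+\frac56\log(1+2\ell)$), and let $W_{1/2}=1+\widehat\varphi_{1/2}(\xi-1)$ on $\{\xi=3\}$ and $W_{1/2}=1+\widehat\varphi_{1/2}((1-\lambda)\xi-1)$ on $\{\xi=\frac12\}$. Let $\widehat\varphi_{1/2+}=\frac{W_{1/2}}{\xi}\frac{1}{\lambda+(1-\lambda)a_{1/2}}$ on $\{\xi=3\}$ and $\widehat\varphi_{1/2+}=\frac{W_{1/2}}{(1-\lambda)\xi}\frac1{a_{1/2}}$ on $\{\xi=\frac12\}$, let $W_{1/2+}=W_{1/2}+\lambda\xi\,\widehat\varphi_{1/2+}1_{\{\xi=1/2\}}$ and $$\widehat\varphi_\sigma=\widehat\varphi_{1/2+}+\int_{1/2}^{\sigma}\frac{W_{1/2+}}{\xi}\,\frac{1-\lambda}{(\lambda+(1-\lambda)a_r)^2}\,\frac13\,dr .$$ Define $$(\widehat S_t,\widehat W_t)=\begin{cases}(1,1)&0\le t<\frac12,\\ (\xi1_{\{\xi=3\}}+(1-\lambda)\xi1_{\{\xi=1/2\}},\,W_{1/2})&t=\frac12,\\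 (\xi,\,W_{1/2+})&\frac12<t<\sigma,\\ \big((1-\lambda)S_\sigma,\ W_{1/2+}+\widehat\varphi_\sigma((1-\lambda)S_\sigma-\xi)\big)&\sigma\le t\le1,\end{cases}$$ and $\widehat Y^0=1/\widehat W$, $\widehat Y^1=\widehat S/\widehat W$. **The approximating processes.** Let $(\widetilde\eta^n)$ be strictly positive $\sigma(\eta)$-measurable random variables with $E[\widetilde\eta^n]=1$ and $b_n:=E[\widetilde\eta^n(\eta-1)]\searrow-1$. Put $$\widetilde Z^n_t=\widehat Y^0_{\frac12\wedge t}\exp\big(-(n-1)(\sigma\wedge t-\tfrac12)^+\big)\big(1+(n\widetilde\eta^n-1)1_{\{\sigma\le t\}}\big),$$ $$\widetilde A^n_t=(1-\lambda)\xi\,e^{n(t-\frac12)}\int_{1/2}^t n a_rb_n e^{-n(r-\frac12)}dr,$$ i.e. the solution of $\widetilde A^n_t=\int_{1/2}^t((1-\lambda)\xi a_rb_n+\widetilde A^n_r)\,n\,dr$, and let $\widetilde M^n_t=\widehat S_t$ for $t\le\frac12$, $\widetilde M^n_t=(1-\lambda)\xi-\widetilde A^n_t$ for $\frac12<t<\sigma$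 and $\widetilde M^n_t=(1-\lambda)S_\sigma$ for $\sigma\le t\le1$. Let $\widetilde\sigma_n=\inf\{t\in(\frac12,\sigma):\widetilde M^n_t>\xi\}$ (with $\inf\emptyset=1$) on $\{\xi=\frac12\}$ and $\widetilde\sigma_n=\frac12$ on $\{\xi=3\}$. Let $\eta^n=\eta\vee\frac1n$, let $\widehat\ell^n_t$ be the maximiser over $\ell\in\mathbb R$ of $E[\log(1+\ell((1-\lambda)(1+a_t(\eta^n-1))-1))]$ (with $\log y=-\infty$ for $y\le0$), and $$\widehat\eta^n_t=\frac1{1+\widehat\ell^n_t\big((1-\lambda)(1+a_t(\eta^n-1))-1\big)}.$$ Finally let $(Z^{0,n}_t,Z^{1,n}_t)=(\widehat Y^0_t,\widehat Y^1_t)$ for $0\le t\le\frac12$, $(Z^{0,n}_t,Z^{1,n}_t)=(\widetilde Z^n_t,\widetilde Z^n_t\widetilde M^n_t)$ for $\frac12<t\le\widetilde\sigma_n$, and, for $\widetilde\sigma_n<t\le1$, $$Z^{0,n}_t=\widetilde Z^n_{\widetilde\sigma_n}\big(1+(\widehat\eta^n_\sigma-1)1_{\{\sigma\le t\}}\big),\qquad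 Z^{1,n}_t=\widetilde Z^n_{\widetilde\sigma_n}\Big(1+\big(\widehat\eta^n_\sigma(1-\lambda)(1+a_\sigma(\eta^n-1))-1\big)1_{\{\sigma\le t\}}\Big)\xi .$$ **Claim.** 1. For all sufficiently large $n$, $Z^{0,n}$ and $Z^{1,n}$ are càdlàg martingales and $(Z^{0,n},Z^{1,n})$ is a $\lambda$-consistent price system for $S$. 2. For every $[0,1]$-valued stopping time $\tau$, $(Z^{0,n}_\tau,Z^{1,n}_\tau)\to(\widehat Y^0_\tau,\widehat Y^1_\tau)$ in probability as $n\to\infty$. 3. The limit $(\widehat Y^0,\widehat Y^1)$ has làdlàg paths a.s., and on $\{\xi=\frac12\}$ (an event of probability $\frac16$) it has, a.s., the strictly negative right jumps at time $\frac12$ $$\widehat Y^0_{\frac12+}-\widehat Y^0_{\frac12}=-\widehat Y^0_{\frac12}\frac{\lambda}{\lambda+(1-\lambda)a_{1/2}},\qquad \widehat Y^1_{\frac12+}-\widehat Y^1_{\frac12}=-\widehat Y^1_{\frac12}\frac{\lambda(1-a_{1/2})}{\lambda+(1-\lambda)a_{1/2}}.$$ -/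

import Mathlib

open MeasureTheory ProbabilityTheory Filter Topology Set

noncomputable section

namespace LadlagExample

/-! ### Path properties and consistent price systems, time horizon `[0,1]` -/

/-- Right continuous with left limits, on `[0,1]`. -/
def IsCadlagPath (f : unitInterval → ℝ) : Prop :=
  ∀ t, ContinuousWithinAt f (Ici t) t ∧ ∃ l, Tendsto f (𝓝[<] t) (𝓝 l)

/-- With left and right limits, on `[0,1]`. -/
def IsLadlagPath (f : unitInterval → ℝ) : Prop :=
  ∀ t, (∃ l, Tendsto f (𝓝[<] t) (𝓝 l)) ∧ ∃ r, Tendsto f (𝓝[>] t) (𝓝 r)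

/-- A martingale on `[0,1]` with (almost surely) càdlàg paths. -/
def IsCadlagMartingale {Ω : Type*} {m : MeasurableSpace Ω} (X : unitInterval → Ω → ℝ)
    (𝓕 : Filtration unitInterval m) (P : Measure Ω) : Prop :=
  Martingale X 𝓕 P ∧ ∀ᵐ ω ∂P, IsCadlagPath (fun t => X t ω)

/-- A local martingale on `[0,1]`. -/
def IsLocalMartingale {Ω : Type*} {m : MeasurableSpace Ω} (X : unitInterval → Ω → ℝ)
    (𝓕 : Filtration unitInterval m) (P : Measure Ω) : Prop :=
  Locally (fun Y => IsCadlagMartingale Y 𝓕 P) 𝓕 X P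

/-- `Z` is the (càdlàg) density process of `Q` with respect to `P`. -/
structure IsDensityProcess {Ω : Type*} {m : MeasurableSpace Ω} (Z : unitInterval → Ω → ℝ)
    (𝓕 : Filtration unitInterval m) (Q P : Measure Ω) : Prop where
  adapted : StronglyAdapted 𝓕 Z
  cadlag : ∀ᵐ ω ∂P, IsCadlagPath (fun t => Z t ω)
  integrable : ∀ t, Integrable (Z t) P
  density : ∀ t, ∀ A, MeasurableSet[𝓕 t] A → Q.real A = ∫ ω in A, Z t ω ∂P

/-- `(Z⁰, Z¹)` is a `lam`-consistent price system for the ask price `S`: `Z⁰` is the density process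
of a measure `Q` equivalent to `P` under which some process `T` with values in the bid-ask spread
`[(1 - lam) S, S]` is a local martingale, and `Z¹ = Z⁰ T`. -/
def IsConsistentPriceSystem {Ω : Type*} {m : MeasurableSpace Ω} (P : Measure Ω)
    (𝓕 : Filtration unitInterval m) (lam : ℝ) (S Z0 Z1 : unitInterval → Ω → ℝ) : Prop :=
  ∃ (Q : Measure Ω) (T : unitInterval → Ω → ℝ),
    IsProbabilityMeasure Q ∧ Q ≪ P ∧ P ≪ Q ∧
    IsDensityProcess Z0 𝓕 Q P ∧
    IsLocalMartingale T 𝓕 Q ∧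
    (∀ᵐ ω ∂P, ∀ t, T t ω ∈ Icc ((1 - lam) * S t ω) (S t ω)) ∧
    ∀ᵐ ω ∂P, ∀ t, Z1 t ω = Z0 t ω * T t ω

/-! ### The market

Below, `x`, `e`, `s` stand for the values `ξ(ω)`, `η(ω)`, `σ(ω)` and `t` for time.
Almost surely `σ > 1/2`, so that `S_{1/2-} = 1` and `S_{1/2} = S_{σ-} = ξ`. -/

/-- `a_t = 1/3 - (t - 1/2)/3`. -/
def coefA (t : ℝ) : ℝ := 1 / 3 - 1 / 3 * (t - 1 / 2)

/-- `σ = (θ + 1/2) ∧ 1`. -/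
def jumpTime (u : ℝ) : ℝ := min (u + 1 / 2) 1

/-- The ask price `S_t = (1 + (ξ - 1) 1_{t ≥ 1/2}) (1 + a_σ (η - 1) 1_{t ≥ σ})`. -/
def ask (x e s t : ℝ) : ℝ :=
  (1 + (x - 1) * (if 1 / 2 ≤ t then 1 else 0)) *
    (1 + coefA s * (e - 1) * (if s ≤ t then 1 else 0))

/-- The probabilistic assumptions on `ξ`, `η` and the exponential variable `θ`. -/
structure IsModel {Ω : Type*} [MeasurableSpace Ω] (P : Measure Ω) (ε : ℝ) (ξ η θ : Ω → ℝ) :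
    Prop where
  measurable_xi : Measurable ξ
  measurable_eta : Measurable η
  measurable_theta : Measurable θ
  xi_up : P.real {ω | ξ ω = 3} = 5 / 6
  xi_down : P.real {ω | ξ ω = 1 / 2} = 1 / 6
  eta_up : P.real {ω | η ω = 2} = 1 - ε
  eta_down : ∀ n : ℕ, 1 ≤ n → P.real {ω | η ω = 1 / (n : ℝ)} = ε * (1 / 2) ^ n
  theta_exp : P.map θ = expMeasure 1
  indep : iIndepFun ![ξ, η, θ] P

/-- The ask price as a process on `[0,1]`. -/
def askProcess {Ω : Type*} (ξ η θ : Ω → ℝ) (t : unitInterval) (ω : Ω) : ℝ :=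
  ask (ξ ω) (η ω) (jumpTime (θ ω)) t

/-- The observed process `(S_t, 1_{σ ≤ t})`. -/
def observed {Ω : Type*} (ξ η θ : Ω → ℝ) (t : unitInterval) (ω : Ω) : ℝ × ℝ :=
  (askProcess ξ η θ t ω, if jumpTime (θ ω) ≤ t then 1 else 0)

lemma measurable_jumpTime : Measurable jumpTime := by
  unfold jumpTime; fun_prop

lemma measurable_observed {Ω : Type*} [MeasurableSpace Ω] {ξ η θ : Ω → ℝ}
    (hξ : Measurable ξ) (hη : Measurable η) (hθ : Measurable θ) (t : unitInterval) :
    Measurable (observed ξ η θ t) := by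
  have hs : MeasurableSet {ω | jumpTime (θ ω) ≤ (t : ℝ)} :=
    measurableSet_le (measurable_jumpTime.comp hθ) measurable_const
  have hi : Measurable (fun ω => if jumpTime (θ ω) ≤ (t : ℝ) then (1 : ℝ) else 0) :=
    Measurable.ite hs measurable_const measurable_const
  have ha : Measurable (fun ω => coefA (jumpTime (θ ω))) := by
    have := measurable_jumpTime.comp hθ
    unfold coefA
    exact measurable_const.sub (measurable_const.mul (this.sub measurable_const))
  refine Measurable.prodMk ?_ hi
  unfold askProcess ask
  exact (measurable_const.add ((hξ.sub measurable_const).mul measurable_const)).mul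
    (measurable_const.add ((ha.mul (hη.sub measurable_const)).mul hi))

/-- The σ-algebra generated by the `P`-null sets. -/
abbrev nullSigma {Ω : Type*} [MeasurableSpace Ω] (P : Measure Ω) : MeasurableSpace Ω :=
  MeasurableSpace.generateFrom {A | P A = 0}

lemma nullSigma_le {Ω : Type*} [m : MeasurableSpace Ω] (P : Measure Ω) [P.IsComplete] :
    nullSigma P ≤ m :=
  MeasurableSpace.generateFrom_le fun A hA => Measure.IsComplete.out' A hA

/-- The filtration generated by `S` and `1_{⟦σ,1⟧}`, completed and made right continuous.
The indicator is needed for `σ` to be a stopping time: on `{η = 1}` the price does not jump at `σ`. -/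
def marketFiltration {Ω : Type*} [m : MeasurableSpace Ω] (P : Measure Ω) [P.IsComplete]
    {ε : ℝ} {ξ η θ : Ω → ℝ} (h : IsModel P ε ξ η θ) : Filtration unitInterval m :=
  (Filtration.natural (observed ξ η θ) (fun t =>
      (measurable_observed h.measurable_xi h.measurable_eta h.measurable_theta
        t).stronglyMeasurable) ⊔
    Filtration.const unitInterval (nullSigma P) (nullSigma_le P)).rightCont

/-! ### The dual optimiser -/

/-- The optimal stock holdings on `(0,1/2]`: the maximiser of
`ℓ ↦ (1/6) log (1 + ℓ ((1 - lam)/2 - 1)) + (5/6) log (1 + 2 ℓ)`. -/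
def holdHalf (lam : ℝ) : ℝ := (19 - lam) / (12 * (1 + lam))

/-- The optimal wealth, evaluated at the shadow price, at time `1/2`. -/
def wealthHalf (lam x : ℝ) : ℝ :=
  if 1 < x then 1 + holdHalf lam * (x - 1) else 1 + holdHalf lam * ((1 - lam) * x - 1)

/-- The optimal stock holdings immediately after time `1/2`. -/
def holdPlus (lam x : ℝ) : ℝ :=
  if 1 < x then wealthHalf lam x / x * (1 / (lam + (1 - lam) * coefA (1 / 2)))
  else wealthHalf lam x / ((1 - lam) * x) * (1 / coefA (1 / 2))

/-- The optimal wealth, evaluated at the shadow price, immediately after time `1/2`. -/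
def wealthPlus (lam x : ℝ) : ℝ :=
  wealthHalf lam x + (if 1 < x then 0 else holdPlus lam x * (x - (1 - lam) * x))

/-- The optimal stock holdings. -/
def hold (lam x s t : ℝ) : ℝ :=
  if t ≤ 0 then 0
  else if t ≤ 1 / 2 then holdHalf lam
  else holdPlus lam x + ∫ r in (1 / 2 : ℝ)..(min s t),
    wealthPlus lam x / x * ((1 - lam) / (lam + (1 - lam) * coefA r) ^ 2) * (1 / 3)

/-- The candidate shadow price. -/
def shadow (lam x e s t : ℝ) : ℝ :=
  if t < 1 / 2 then 1
  else if t = 1 / 2 then (if 1 < x then x else (1 - lam) * x)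
  else if t < s then x
  else (1 - lam) * ask x e s s

/-- The optimal wealth, evaluated at the shadow price. -/
def wealth (lam x e s t : ℝ) : ℝ :=
  if t < 1 / 2 then 1
  else if t = 1 / 2 then wealthHalf lam x
  else if t < s then wealthPlus lam x
  else wealthPlus lam x + hold lam x s s * ((1 - lam) * ask x e s s - x)

/-- First component of the dual optimiser. -/
def dualY0 (lam x e s t : ℝ) : ℝ := 1 / wealth lam x e s t

/-- Second component of the dual optimiser. -/
def dualY1 (lam x e s t : ℝ) : ℝ := shadow lam x e s t / wealth lam x e s t

/-! ### The approximating processes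

`g` stands for the value of the density `η̃ⁿ`, and `b` for `bₙ = E[η̃ⁿ (η - 1)]`. -/

/-- Strictly positive `σ(η)`-measurable densities `η̃ⁿ` with `E[η̃ⁿ (η - 1)]` decreasing to `-1`. -/
structure IsTilting {Ω : Type*} [MeasurableSpace Ω] (P : Measure Ω) (η : Ω → ℝ)
    (etaT : ℕ → Ω → ℝ) : Prop where
  pos : ∀ n ω, 0 < etaT n ω
  measurable : ∀ n, Measurable[MeasurableSpace.comap η inferInstance] (etaT n)
  mean : ∀ n, ∫ ω, etaT n ω ∂P = 1
  antitone : Antitone fun n => ∫ ω, etaT n ω * (η ω - 1) ∂P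
  tendsto : Tendsto (fun n => ∫ ω, etaT n ω * (η ω - 1) ∂P) atTop (𝓝 (-1))

/-- The process `Z̃ⁿ`. -/
def tildeZ (lam x e s : ℝ) (n : ℕ) (g t : ℝ) : ℝ :=
  dualY0 lam x e s (min (1 / 2) t) * Real.exp (-((n : ℝ) - 1) * max (min s t - 1 / 2) 0) *
    (1 + (n * g - 1) * (if s ≤ t then 1 else 0))

/-- The compensator `Ãⁿ` before time `σ`: the solution, null at `1/2`, of
`dÃ_t = ((1 - lam) S_{1/2} a_t bₙ + Ã_t) n dt`. -/
def tildeA (lam x : ℝ) (n : ℕ) (b t : ℝ) : ℝ :=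
  (1 - lam) * x * Real.exp (n * (t - 1 / 2)) *
    ∫ r in (1 / 2 : ℝ)..t, n * coefA r * b * Real.exp (-(n * (r - 1 / 2)))

/-- The process `M̃ⁿ`. -/
def tildeM (lam x e s : ℝ) (n : ℕ) (b t : ℝ) : ℝ :=
  if t ≤ 1 / 2 then shadow lam x e s t
  else if t < s then (1 - lam) * x - tildeA lam x n b t
  else (1 - lam) * ask x e s s

/-- The time `σ̃ₙ`: on `{ΔS_{1/2} < 0}` the first time after `1/2` and before the jump at `σ` at
which `M̃ⁿ` exceeds `S_{1/2}` (and `1` if there is none), and `1/2` on `{ΔS_{1/2} > 0}`. -/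
def tildeSigma (lam x e s : ℝ) (n : ℕ) (b : ℝ) : ℝ :=
  if x < 1 then sInf ({t | 1 / 2 < t ∧ t < s ∧ x < tildeM lam x e s n b t} ∪ {1}) else 1 / 2

/-- `ηⁿ = η ∨ (1/n)`. -/
def truncEta (n : ℕ) (e : ℝ) : ℝ := max e (1 / (n : ℝ))

/-- One-period return `(1 - lam) (1 + a_t (e - 1)) - 1`. -/
def oneReturn (lam t e : ℝ) : ℝ := (1 - lam) * (1 + coefA t * (e - 1)) - 1

/-- `ℓ` maximises `E[log (1 + ℓ ((1 - lam) (1 + a_t (ηⁿ - 1)) - 1))]`, where `log y = -∞` for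
`y ≤ 0`. -/
def IsLogOptimal {Ω : Type*} [MeasurableSpace Ω] (P : Measure Ω) (η : Ω → ℝ) (lam : ℝ) (n : ℕ)
    (t ℓ : ℝ) : Prop :=
  (∀ᵐ ω ∂P, 0 < 1 + ℓ * oneReturn lam t (truncEta n (η ω))) ∧
  ∀ k : ℝ, (∀ᵐ ω ∂P, 0 < 1 + k * oneReturn lam t (truncEta n (η ω))) →
    ∫ ω, Real.log (1 + k * oneReturn lam t (truncEta n (η ω))) ∂P ≤
      ∫ ω, Real.log (1 + ℓ * oneReturn lam t (truncEta n (η ω))) ∂P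

/-- The one-period log-optimiser `ℓ̂ⁿ_t`. -/
def logOpt {Ω : Type*} [MeasurableSpace Ω] (P : Measure Ω) (η : Ω → ℝ) (lam : ℝ) (n : ℕ)
    (t : ℝ) : ℝ :=
  Classical.epsilon (IsLogOptimal P η lam n t)

/-- `η̂ⁿ_t = 1 / (1 + ℓ̂ⁿ_t ((1 - lam) (1 + a_t (ηⁿ - 1)) - 1))`. -/
def hatEta {Ω : Type*} [MeasurableSpace Ω] (P : Measure Ω) (η : Ω → ℝ) (lam : ℝ) (n : ℕ)
    (t : ℝ) (ω : Ω) : ℝ :=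
  1 / (1 + logOpt P η lam n t * oneReturn lam t (truncEta n (η ω)))

/-- First component `Ŷ⁰` of the dual optimiser as a process on `[0,1]`. -/
def Y0 {Ω : Type*} (lam : ℝ) (ξ η θ : Ω → ℝ) (t : unitInterval) (ω : Ω) : ℝ :=
  dualY0 lam (ξ ω) (η ω) (jumpTime (θ ω)) t

/-- Second component `Ŷ¹` of the dual optimiser as a process on `[0,1]`. -/
def Y1 {Ω : Type*} (lam : ℝ) (ξ η θ : Ω → ℝ) (t : unitInterval) (ω : Ω) : ℝ :=
  dualY1 lam (ξ ω) (η ω) (jumpTime (θ ω)) t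

/-- The process `Z^{0,n}`. -/
def Z0 {Ω : Type*} [MeasurableSpace Ω] (P : Measure Ω) (lam : ℝ) (ξ η θ : Ω → ℝ)
    (etaT : ℕ → Ω → ℝ) (n : ℕ) (t : unitInterval) (ω : Ω) : ℝ :=
  let x := ξ ω
  let e := η ω
  let s := jumpTime (θ ω)
  let g := etaT n ω
  let b := ∫ ω', etaT n ω' * (η ω' - 1) ∂P
  let r := tildeSigma lam x e s n b
  if (t : ℝ) ≤ 1 / 2 then dualY0 lam x e s t
  else if (t : ℝ) ≤ r then tildeZ lam x e s n g t
  else tildeZ lam x e s n g r *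
    (1 + (hatEta P η lam n s ω - 1) * (if s ≤ t then 1 else 0))

/-- The process `Z^{1,n}`. -/
def Z1 {Ω : Type*} [MeasurableSpace Ω] (P : Measure Ω) (lam : ℝ) (ξ η θ : Ω → ℝ)
    (etaT : ℕ → Ω → ℝ) (n : ℕ) (t : unitInterval) (ω : Ω) : ℝ :=
  let x := ξ ω
  let e := η ω
  let s := jumpTime (θ ω)
  let g := etaT n ω
  let b := ∫ ω', etaT n ω' * (η ω' - 1) ∂P
  let r := tildeSigma lam x e s n b
  if (t : ℝ) ≤ 1 / 2 then dualY1 lam x e s t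
  else if (t : ℝ) ≤ r then tildeZ lam x e s n g t * tildeM lam x e s n b t
  else tildeZ lam x e s n g r *
    (1 + (hatEta P η lam n s ω * ((1 - lam) * (1 + coefA s * (truncEta n e - 1))) - 1) *
      (if s ≤ t then 1 else 0)) * x

/-- The time `1/2` in `[0,1]`. -/
def halfTime : unitInterval := ⟨1 / 2, by norm_num, by norm_num⟩

end LadlagExample

end

/-!
Before `σ` both members of the pair are deterministic given `ξ`, so every martingale property
reduces to integrating over the exponential time `θ` and over `η` separately. The tilted density
makes `σ` arrive at rate `n` instead of `1`, with mean return close to that of the worst case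
`η = 0`; hence on `{ξ = 1/2}` the candidate `M̃ⁿ` climbs from the bid to the ask price during a time
of order `1/n`, and the right jump of the limit is what remains of this climb. From `σ̃ₙ` on, the
first-order condition of the one-period log-optimal problem makes both `η̂ⁿ` and its product with
the return martingale multipliers. The truncation level of `ηⁿ` tends to `0`, where the
one-period optimum is constrained by the worst case `η = 0`, and this limit optimiser is
the one of the dual problem.
-/

namespace LadlagExample

/-! ### The laws of `ξ`, `η` and `σ` -/

section CountableLaw

variable {ι β : Type*} [Countable ι] [MeasurableSpace β] [MeasurableSingletonClass β]
  {μ : Measure β} {a : ι → β}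

lemma ae_mem_range_of_tsum_eq_one [IsProbabilityMeasure μ] (ha : Function.Injective a)
    (hsum : ∑' i, μ {a i} = 1) : ∀ᵐ x ∂μ, x ∈ range a := by
  have hrange : μ (range a) = ∑' i, μ {a i} := by
    rw [← tsum_range (fun x => μ {x}) ha]
    exact (tsum_measure_preimage_singleton (f := id) (countable_range a)
      fun y _ => measurableSet_singleton y).symm
  exact (mem_ae_iff_prob_eq_one (countable_range a).measurableSet).2 (hrange.trans hsum)

lemma lintegral_eq_tsum_of_ae_mem_range (ha : Function.Injective a)
    (hμ : ∀ᵐ x ∂μ, x ∈ range a) (f : β → ENNReal) :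
    ∫⁻ x, f x ∂μ = ∑' i, f (a i) * μ {a i} := by
  have huniv : range a =ᵐ[μ] univ := eventuallyEq_univ.2 hμ
  rw [← setLIntegral_univ, ← setLIntegral_congr huniv,
    lintegral_countable _ (countable_range a), tsum_range (fun x => f x * μ {x}) ha]

end CountableLaw

/-- The atoms `2, 1, 1/2, 1/3, …` of the law of `η`. -/
noncomputable def etaAtom (k : ℕ) : ℝ := if k = 0 then 2 else 1 / (k : ℝ)

/-- The weight of `etaAtom k` under the law of `η`. -/
noncomputable def etaWeight (ε : ℝ) (k : ℕ) : ℝ := if k = 0 then 1 - ε else ε * (1 / 2) ^ k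

lemma etaAtom_pos (k : ℕ) : 0 < etaAtom k := by
  unfold etaAtom
  split_ifs with hk
  · norm_num
  · have : (0 : ℝ) < k := by exact_mod_cast Nat.pos_of_ne_zero hk
    positivity

lemma etaAtom_le_one {k : ℕ} (hk : k ≠ 0) : etaAtom k ≤ 1 := by
  simpa only [etaAtom, hk, if_false, one_div] using Nat.cast_inv_le_one k

lemma etaAtom_le_two (k : ℕ) : etaAtom k ≤ 2 := by
  by_cases hk : k = 0
  · simp [etaAtom, hk]
  · linarith [etaAtom_le_one hk]

lemma etaAtom_injective : Function.Injective etaAtom := by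
  have h0 : etaAtom 0 = 2 := by simp [etaAtom]
  intro j k hjk
  by_cases hj : j = 0 <;> by_cases hk : k = 0
  · rw [hj, hk]
  · subst hj; linarith [etaAtom_le_one hk]
  · subst hk; linarith [etaAtom_le_one hj]
  · simpa [etaAtom, hj, hk] using hjk

lemma hasSum_etaWeight (ε : ℝ) : HasSum (etaWeight ε) 1 := by
  convert! (hasSum_geometric_two.mul_left ε).add (hasSum_ite_eq (0 : ℕ) (1 - 2 * ε)) using 1
  · ext k
    by_cases hk : k = 0
    · simp only [etaWeight, hk, if_true, pow_zero]; ring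
    · simp [etaWeight, hk]
  · ring

lemma hasSum_etaWeight_div_etaAtom (ε : ℝ) :
    HasSum (fun k => etaWeight ε k / etaAtom k) ((1 + 3 * ε) / 2) := by
  have harith := hasSum_coe_mul_geometric_of_norm_lt_one (r := (1 / 2 : ℝ)) (by norm_num)
  convert! (harith.mul_left ε).add (hasSum_ite_eq (0 : ℕ) ((1 - ε) / 2)) using 1
  · ext k
    by_cases hk : k = 0
    · simp [etaWeight, etaAtom, hk]
    · simp only [etaWeight, etaAtom, hk, if_false]; field_simp; ring
  · norm_num; ring

lemma jumpTime_le_one (u : ℝ) : jumpTime u ≤ 1 := min_le_right _ _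

lemma lt_jumpTime_iff {u s : ℝ} (hs : s < 1) : s < jumpTime u ↔ s - 1 / 2 < u := by
  simp only [jumpTime, lt_min_iff, hs, and_true, sub_lt_iff_lt_add]

lemma setIntegral_Ioc_expMeasure {r a b : ℝ} (hr : 0 < r) (ha : 0 ≤ a) (hab : a ≤ b) (f : ℝ → ℝ) :
    ∫ y in Ioc a b, f y ∂expMeasure r = ∫ y in a..b, f y * (r * Real.exp (-(r * y))) := by
  change ∫ y in Ioc a b, f y ∂(volume.withDensity fun x => ENNReal.ofReal (gammaPDFReal 1 r x)) = _
  rw [setIntegral_withDensity_eq_setIntegral_toReal_smul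
      (measurable_gammaPDFReal 1 r).ennreal_ofReal (ae_of_all _ fun _ => ENNReal.ofReal_lt_top) _
      measurableSet_Ioc,
    intervalIntegral.integral_of_le hab]
  refine setIntegral_congr_fun measurableSet_Ioc fun y hy => ?_
  have hpdf : gammaPDFReal 1 r y = r * Real.exp (-(r * y)) := by
    simp [gammaPDFReal, ha.trans hy.1.le]
  simp only [hpdf, smul_eq_mul, ENNReal.toReal_ofReal (by positivity : 0 ≤ r * Real.exp (-(r * y)))]
  ring

namespace IsModel

variable {Ω : Type*} [MeasurableSpace Ω] {P : Measure Ω} {ε : ℝ} {ξ η θ : Ω → ℝ}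

lemma indepFun_xi (h : IsModel P ε ξ η θ) : IndepFun ξ (fun ω => (η ω, θ ω)) P := by
  refine (h.indep.indepFun_prodMk (fun i => ?_) 1 2 0 (by decide) (by decide)).symm
  fin_cases i
  exacts [h.measurable_xi, h.measurable_eta, h.measurable_theta]

lemma indepFun_eta_theta (h : IsModel P ε ξ η θ) : IndepFun η θ P :=
  h.indep.indepFun (i := 1) (j := 2) (by decide)

lemma measureReal_theta_le (h : IsModel P ε ξ η θ) (u : ℝ) :
    P.real {ω | θ ω ≤ u} = if 0 ≤ u then 1 - Real.exp (-u) else 0 := by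
  have := isProbabilityMeasure_expMeasure (r := 1) one_pos
  have hcdf := cdf_expMeasure_eq (r := 1) one_pos u
  rwa [cdf_eq_real, ← h.theta_exp, map_measureReal_apply h.measurable_theta measurableSet_Iic,
    one_mul] at hcdf

lemma setIntegral_jumpTime (h : IsModel P ε ξ η θ) {s r : ℝ} (hs : 1 / 2 ≤ s) (hsr : s ≤ r)
    (hr : r < 1) {f : ℝ → ℝ} (hf : Measurable f) :
    ∫ ω in {ω | s < jumpTime (θ ω) ∧ jumpTime (θ ω) ≤ r}, f (jumpTime (θ ω)) ∂P =
      ∫ u in s..r, f u * Real.exp (-(u - 1 / 2)) := by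
  have hset : {ω | s < jumpTime (θ ω) ∧ jumpTime (θ ω) ≤ r} =
      θ ⁻¹' Ioc (s - 1 / 2) (r - 1 / 2) := by
    ext ω
    rw [mem_ofPred_eq, mem_preimage, mem_Ioc, lt_jumpTime_iff (hsr.trans_lt hr), ← not_lt,
      lt_jumpTime_iff hr, not_lt]
  have hjump : EqOn (fun ω => f (jumpTime (θ ω))) (fun ω => f (θ ω + 1 / 2))
      (θ ⁻¹' Ioc (s - 1 / 2) (r - 1 / 2)) := fun ω hω => by
    simp only [jumpTime, min_eq_left (show θ ω + 1 / 2 ≤ 1 by linarith [hω.2])]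
  rw [hset, setIntegral_congr_fun (h.measurable_theta measurableSet_Ioc) hjump,
    ← setIntegral_map (f := fun y => f (y + 1 / 2)) measurableSet_Ioc
      (hf.comp (measurable_id.add_const _)).aestronglyMeasurable h.measurable_theta.aemeasurable,
    h.theta_exp, setIntegral_Ioc_expMeasure one_pos (by linarith) (by linarith),
    ← intervalIntegral.integral_comp_sub_right (fun y => f (y + 1 / 2) * _)]
  simp only [sub_add_cancel, one_mul]

lemma etaWeight_nonneg (h : IsModel P ε ξ η θ) (k : ℕ) : 0 ≤ etaWeight ε k := by
  unfold etaWeight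
  split_ifs with hk
  · exact h.eta_up ▸ measureReal_nonneg
  · exact h.eta_down k (Nat.pos_of_ne_zero hk) ▸ measureReal_nonneg

variable [IsProbabilityMeasure P]

lemma ae_xi (h : IsModel P ε ξ η θ) : ∀ᵐ ω ∂P, ξ ω = 3 ∨ ξ ω = 1 / 2 := by
  have := Measure.isProbabilityMeasure_map (μ := P) h.measurable_xi.aemeasurable
  have hmass : P.map ξ {3} + P.map ξ {1 / 2} = 1 := by
    simp only [Measure.map_apply h.measurable_xi (measurableSet_singleton _)]
    rw [← ENNReal.toReal_eq_one_iff, ENNReal.toReal_add (measure_ne_top _ _) (measure_ne_top _ _)]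
    exact (congrArg₂ (· + ·) h.xi_up h.xi_down).trans (by norm_num)
  have hmem := ae_mem_range_of_tsum_eq_one (μ := P.map ξ) (a := ![3, 1 / 2])
    (fun i j => by fin_cases i <;> fin_cases j <;> norm_num) (by simpa using hmass)
  filter_upwards [ae_of_ae_map h.measurable_xi.aemeasurable hmem] with ω hω
  simpa [eq_comm, or_comm] using hω

lemma map_eta_singleton (h : IsModel P ε ξ η θ) (k : ℕ) :
    P.map η {etaAtom k} = ENNReal.ofReal (etaWeight ε k) := by
  have hreal : P.real (η ⁻¹' {etaAtom k}) = etaWeight ε k := by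
    unfold etaAtom etaWeight
    split_ifs with hk
    · exact h.eta_up
    · exact h.eta_down k (Nat.pos_of_ne_zero hk)
  rw [Measure.map_apply h.measurable_eta (measurableSet_singleton _), ← hreal, ofReal_measureReal]

lemma ae_map_eta (h : IsModel P ε ξ η θ) : ∀ᵐ e ∂P.map η, e ∈ range etaAtom := by
  have := Measure.isProbabilityMeasure_map (μ := P) h.measurable_eta.aemeasurable
  refine ae_mem_range_of_tsum_eq_one etaAtom_injective ?_
  simp_rw [h.map_eta_singleton]
  rw [← ENNReal.ofReal_tsum_of_nonneg h.etaWeight_nonneg (hasSum_etaWeight ε).summable,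
    (hasSum_etaWeight ε).tsum_eq, ENNReal.ofReal_one]

lemma ae_eta_mem (h : IsModel P ε ξ η θ) : ∀ᵐ ω ∂P, η ω ∈ Ioc 0 2 := by
  filter_upwards [ae_of_ae_map h.measurable_eta.aemeasurable h.ae_map_eta] with ω ⟨k, hk⟩
  exact hk ▸ ⟨etaAtom_pos k, etaAtom_le_two k⟩

lemma lintegral_inv_eta (h : IsModel P ε ξ η θ) :
    ∫⁻ ω, ENNReal.ofReal (1 / η ω) ∂P = ENNReal.ofReal ((1 + 3 * ε) / 2) := by
  rw [← lintegral_map (f := fun e => ENNReal.ofReal (1 / e)) (by fun_prop) h.measurable_eta,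
    lintegral_eq_tsum_of_ae_mem_range etaAtom_injective h.ae_map_eta,
    ← (hasSum_etaWeight_div_etaAtom ε).tsum_eq, ENNReal.ofReal_tsum_of_nonneg
      (fun k => div_nonneg (h.etaWeight_nonneg k) (etaAtom_pos k).le)
      (hasSum_etaWeight_div_etaAtom ε).summable]
  refine tsum_congr fun k => ?_
  rw [h.map_eta_singleton, ← ENNReal.ofReal_mul (one_div_pos.2 (etaAtom_pos k)).le]
  ring_nf

lemma integral_inv_truncEta_le (hε : 0 ≤ ε) (h : IsModel P ε ξ η θ) (n : ℕ) :
    ∫ ω, 1 / truncEta n (η ω) ∂P ≤ (1 + 3 * ε) / 2 := by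
  have hη := h.measurable_eta
  have hmeas : Measurable fun ω => 1 / truncEta n (η ω) := by unfold truncEta; fun_prop
  rw [integral_eq_lintegral_of_nonneg_ae _ hmeas.aestronglyMeasurable]
  · refine ENNReal.toReal_le_of_le_ofReal (by positivity) ?_
    rw [← h.lintegral_inv_eta]
    refine lintegral_mono_ae ?_
    filter_upwards [h.ae_eta_mem] with ω hω
    exact ENNReal.ofReal_le_ofReal (one_div_le_one_div_of_le hω.1 (le_max_left _ _))
  · filter_upwards [h.ae_eta_mem] with ω hω
    exact one_div_nonneg.2 (hω.1.le.trans (le_max_left _ _))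

lemma ae_half_lt_jumpTime (h : IsModel P ε ξ η θ) : ∀ᵐ ω ∂P, 1 / 2 < jumpTime (θ ω) := by
  have hpos : ∀ᵐ ω ∂P, 0 < θ ω := by
    have h0 := h.measureReal_theta_le 0
    rw [if_pos le_rfl, neg_zero, Real.exp_zero, sub_self, measureReal_eq_zero_iff] at h0
    simpa only [ae_iff, not_lt] using h0
  filter_upwards [hpos] with ω hω
  exact (lt_jumpTime_iff (by norm_num)).2 (by linarith)

lemma measureReal_lt_jumpTime (h : IsModel P ε ξ η θ) {s : ℝ} (hs : 1 / 2 ≤ s) (hs1 : s < 1) :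
    P.real {ω | s < jumpTime (θ ω)} = Real.exp (-(s - 1 / 2)) := by
  have hset : {ω | s < jumpTime (θ ω)} = {ω | θ ω ≤ s - 1 / 2}ᶜ := by
    ext ω; simp [lt_jumpTime_iff hs1]
  rw [hset, probReal_compl_eq_one_sub (measurableSet_le h.measurable_theta measurable_const),
    h.measureReal_theta_le, if_pos (by linarith)]
  ring

end IsModel

/-! ### One-period logarithmic utility maximisation -/

lemma integral_lt_integral_of_frequently_lt {α : Type*} {m : MeasurableSpace α} {μ : Measure α}
    {f g : α → ℝ} (hf : Integrable f μ) (hg : Integrable g μ) (hle : f ≤ᵐ[μ] g)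
    (hlt : ∃ᵐ x ∂μ, f x < g x) : ∫ x, f x ∂μ < ∫ x, g x ∂μ := by
  refine lt_of_le_of_ne (integral_mono_ae hf hg hle) fun heq => ?_
  have hae := (integral_eq_iff_of_ae_le hf hg hle).1 heq
  obtain ⟨x, hx, hx'⟩ := (hlt.and_eventually hae).exists
  exact hx.ne hx'

/-- The derivative `l ↦ E[R / (1 + l R)]` of the expected logarithmic utility
`l ↦ E[log (1 + l R)]` of investing `l` in an asset with one-period return `R`. -/
noncomputable def score {Ω : Type*} [MeasurableSpace Ω] (P : Measure Ω) (R : Ω → ℝ) (l : ℝ) : ℝ :=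
  ∫ ω, R ω / (1 + l * R ω) ∂P

/-- `R` is a bounded one-period return whose worst value is a loss `d > 0` of positive
probability. -/
structure IsReturn {Ω : Type*} [MeasurableSpace Ω] (P : Measure Ω) (R : Ω → ℝ) (d M : ℝ) :
    Prop where
  measurable : Measurable R
  loss_pos : 0 < d
  mem : ∀ᵐ ω ∂P, R ω ∈ Icc (-d) M
  frequently_eq : ∃ᵐ ω ∂P, R ω = -d

namespace IsReturn

variable {Ω : Type*} [MeasurableSpace Ω] {P : Measure Ω} {R : Ω → ℝ} {d M l q x : ℝ}

lemma mul_loss_lt_one (h : IsReturn P R d M) (hl : l ∈ Ico 0 d⁻¹) : l * d < 1 := by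
  simpa [inv_mul_cancel₀ h.loss_pos.ne'] using mul_lt_mul_of_pos_right hl.2 h.loss_pos

lemma ae_le_one_add_mul (h : IsReturn P R d M) (hl : 0 ≤ l) :
    ∀ᵐ ω ∂P, 1 - l * d ≤ 1 + l * R ω := by
  filter_upwards [h.mem] with ω hω
  linarith [mul_le_mul_of_nonneg_left hω.1 hl]

lemma ae_one_add_mul_pos (h : IsReturn P R d M) (hl : l ∈ Ico 0 d⁻¹) :
    ∀ᵐ ω ∂P, 0 < 1 + l * R ω := by
  filter_upwards [h.ae_le_one_add_mul hl.1] with ω hω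
  linarith [h.mul_loss_lt_one hl]

lemma ae_norm_div_le (h : IsReturn P R d M) (hq : q ∈ Ico 0 d⁻¹) (hl : l ∈ Icc 0 q) :
    ∀ᵐ ω ∂P, ‖R ω / (1 + l * R ω)‖ ≤ max d M / (1 - q * d) := by
  have hpos : 0 < 1 - q * d := sub_pos.2 (h.mul_loss_lt_one hq)
  filter_upwards [h.mem, h.ae_le_one_add_mul hl.1] with ω hω hle
  have hlq : 1 - q * d ≤ 1 + l * R ω := by
    linarith [mul_le_mul_of_nonneg_right hl.2 h.loss_pos.le]
  rw [Real.norm_eq_abs, abs_div, abs_of_pos (hpos.trans_le hlq)]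
  refine div_le_div₀ (le_max_of_le_left h.loss_pos.le) ?_ hpos hlq
  rw [abs_le']
  exact ⟨le_max_of_le_right hω.2, le_max_of_le_left (by linarith [hω.1])⟩

variable [IsProbabilityMeasure P]

lemma integrable_div (h : IsReturn P R d M) (hl : l ∈ Ico 0 d⁻¹) :
    Integrable (fun ω => R ω / (1 + l * R ω)) P := by
  have hR := h.measurable
  have hmeas : Measurable fun ω => R ω / (1 + l * R ω) := by fun_prop
  exact .of_bound hmeas.aestronglyMeasurable _ (h.ae_norm_div_le hl ⟨hl.1, le_rfl⟩)

lemma strictAntiOn_score (h : IsReturn P R d M) : StrictAntiOn (score P R) (Ico 0 d⁻¹) := by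
  intro q hq l hl hql
  have hdiff : ∀ y, 0 < 1 + q * y → 0 < 1 + l * y →
      y / (1 + q * y) - y / (1 + l * y) = (l - q) * y ^ 2 / ((1 + q * y) * (1 + l * y)) := by
    intro y hy hy'
    rw [div_sub_div _ _ hy.ne' hy'.ne']
    ring
  refine integral_lt_integral_of_frequently_lt (h.integrable_div hl) (h.integrable_div hq) ?_ ?_
  · filter_upwards [h.ae_one_add_mul_pos hq, h.ae_one_add_mul_pos hl] with ω hqω hlω
    have : 0 ≤ (l - q) * R ω ^ 2 / ((1 + q * R ω) * (1 + l * R ω)) :=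
      div_nonneg (mul_nonneg (sub_pos.2 hql).le (sq_nonneg _)) (mul_pos hqω hlω).le
    linarith [hdiff _ hqω hlω]
  · refine (h.frequently_eq.and_eventually
      ((h.ae_one_add_mul_pos hq).and (h.ae_one_add_mul_pos hl))).mono ?_
    rintro ω ⟨hω, hqω, hlω⟩
    have hne : R ω ≠ 0 := by rw [hω]; exact (neg_neg_of_pos h.loss_pos).ne
    have : 0 < (l - q) * R ω ^ 2 / ((1 + q * R ω) * (1 + l * R ω)) :=
      div_pos (mul_pos (sub_pos.2 hql) (sq_pos_of_ne_zero hne)) (mul_pos hqω hlω)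
    linarith [hdiff _ hqω hlω]

lemma continuousOn_score (h : IsReturn P R d M) (hq : q ∈ Ico 0 d⁻¹) :
    ContinuousOn (score P R) (Icc 0 q) := by
  have hR := h.measurable
  refine continuousOn_of_dominated (bound := fun _ => max d M / (1 - q * d))
    (fun l _ => Measurable.aestronglyMeasurable (by fun_prop)) (fun l hl => h.ae_norm_div_le hq hl)
    (integrable_const _) ?_
  filter_upwards [h.mem] with ω hω
  refine continuousOn_const.div (by fun_prop) fun l hl => ?_
  have hle := mul_le_mul_of_nonneg_left hω.1 hl.1
  have hld := mul_le_mul_of_nonneg_right hl.2 h.loss_pos.le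
  linarith [h.mul_loss_lt_one hq]

lemma score_le (h : IsReturn P R d M) (hl : l ∈ Ico 0 d⁻¹) :
    score P R l ≤ max M 0 - P.real {ω | R ω = -d} * (d / (1 - l * d)) := by
  have hset : MeasurableSet {ω | R ω = -d} := h.measurable (measurableSet_singleton _)
  have hloss : Integrable ({ω | R ω = -d}.indicator fun _ => d / (1 - l * d)) P :=
    (integrable_const _).indicator hset
  calc score P R l ≤ ∫ ω, (max M 0 - {ω | R ω = -d}.indicator (fun _ => d / (1 - l * d)) ω) ∂P := by
        refine integral_mono_ae (h.integrable_div hl) ((integrable_const _).sub hloss) ?_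
        filter_upwards [h.mem, h.ae_one_add_mul_pos hl] with ω hω hposω
        by_cases hd : R ω = -d
        · rw [indicator_of_mem (by exact hd), hd, mul_neg, ← sub_eq_add_neg, neg_div]
          linarith [le_max_right M 0]
        · rw [indicator_of_notMem (by exact hd), sub_zero, div_le_iff₀ hposω]
          have hR : R ω ≤ max M 0 := hω.2.trans (le_max_left _ _)
          nlinarith [mul_nonneg hl.1 (sq_nonneg (R ω)), le_max_right M 0,
            mul_le_mul_of_nonneg_right hR hl.1]
    _ = max M 0 - P.real {ω | R ω = -d} * (d / (1 - l * d)) := by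
        rw [integral_sub (integrable_const _) hloss, integral_indicator_const _ hset]
        simp

lemma exists_score_nonpos (h : IsReturn P R d M) (hq : q ∈ Ico 0 d⁻¹) :
    ∃ l ∈ Ico q d⁻¹, score P R l ≤ 0 := by
  set p := P.real {ω | R ω = -d}
  have hp : 0 < p := measureReal_nonneg.lt_of_ne' <|
    (measureReal_ne_zero_iff).2 (frequently_ae_iff.1 h.frequently_eq)
  have hM : 0 < max M 0 + 1 := by positivity
  have hmem : max q (d⁻¹ - p / (max M 0 + 1)) ∈ Ico q d⁻¹ :=
    ⟨le_max_left _ _, max_lt hq.2 (sub_lt_self _ (div_pos hp hM))⟩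
  have hmem' : max q (d⁻¹ - p / (max M 0 + 1)) ∈ Ico 0 d⁻¹ := ⟨hq.1.trans hmem.1, hmem.2⟩
  refine ⟨_, hmem, (h.score_le hmem').trans ?_⟩
  have hpos := sub_pos.2 (h.mul_loss_lt_one hmem')
  have hle := mul_le_mul_of_nonneg_right (le_max_right q (d⁻¹ - p / (max M 0 + 1))) h.loss_pos.le
  rw [sub_mul, inv_mul_cancel₀ h.loss_pos.ne', div_mul_eq_mul_div] at hle
  have hclose : 1 - max q (d⁻¹ - p / (max M 0 + 1)) * d ≤ p * d / (max M 0 + 1) := by linarith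
  rw [← mul_div_assoc, sub_nonpos, le_div_iff₀ hpos]
  calc max M 0 * (1 - max q (d⁻¹ - p / (max M 0 + 1)) * d)
      ≤ (max M 0 + 1) * (p * d / (max M 0 + 1)) := by gcongr; linarith
    _ = p * d := by field_simp

lemma exists_score_eq_zero (h : IsReturn P R d M) (hq : q ∈ Ico 0 d⁻¹) (hscore : 0 ≤ score P R q) :
    ∃ l ∈ Ico q d⁻¹, score P R l = 0 := by
  obtain ⟨u, hu, hneg⟩ := h.exists_score_nonpos hq
  obtain ⟨l, hl, hzero⟩ := intermediate_value_Icc' hu.1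
    ((h.continuousOn_score ⟨hq.1.trans hu.1, hu.2⟩).mono (Icc_subset_Icc_left hq.1)) ⟨hneg, hscore⟩
  exact ⟨l, ⟨hl.1, hl.2.trans_lt hu.2⟩, hzero⟩

lemma integrable_log (h : IsReturn P R d M) (hl : l ∈ Ico 0 d⁻¹) :
    Integrable (fun ω => Real.log (1 + l * R ω)) P := by
  have hR := h.measurable
  have hpos := sub_pos.2 (h.mul_loss_lt_one hl)
  have hmeas : Measurable fun ω => Real.log (1 + l * R ω) := by fun_prop
  refine .of_bound hmeas.aestronglyMeasurable
    (max |Real.log (1 - l * d)| |Real.log (1 + l * M)|) ?_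
  filter_upwards [h.mem, h.ae_le_one_add_mul hl.1] with ω hω hle
  refine abs_le_max_abs_abs (Real.log_le_log hpos hle) (Real.log_le_log (hpos.trans_le hle) ?_)
  linarith [mul_le_mul_of_nonneg_left hω.2 hl.1]

private lemma integral_log_lt_of_integrable (h : IsReturn P R d M) (hl : l ∈ Ico 0 d⁻¹)
    (hscore : score P R l = 0) (hq : ∀ᵐ ω ∂P, 0 < 1 + q * R ω) (hne : q ≠ l)
    (hint : Integrable (fun ω => Real.log (1 + q * R ω)) P) :
    ∫ ω, Real.log (1 + q * R ω) ∂P < ∫ ω, Real.log (1 + l * R ω) ∂P := by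
  have htangent : ∫ ω, (Real.log (1 + l * R ω) + (q - l) * (R ω / (1 + l * R ω))) ∂P =
      ∫ ω, Real.log (1 + l * R ω) ∂P := by
    rw [integral_add (h.integrable_log hl) ((h.integrable_div hl).const_mul _),
      integral_const_mul, ← score, hscore, mul_zero, add_zero]
  have hratio : ∀ y, 0 < 1 + l * y →
      (1 + q * y) / (1 + l * y) - 1 = (q - l) * (y / (1 + l * y)) := by
    intro y hy
    rw [div_sub_one hy.ne', mul_div_assoc']
    ring
  rw [← htangent]
  refine integral_lt_integral_of_frequently_lt hint
    ((h.integrable_log hl).add ((h.integrable_div hl).const_mul _)) ?_ ?_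
  · filter_upwards [h.ae_one_add_mul_pos hl, hq] with ω hlω hqω
    have hlog := Real.log_le_sub_one_of_pos (div_pos hqω hlω)
    rw [Real.log_div hqω.ne' hlω.ne', hratio _ hlω] at hlog
    linarith
  · refine (h.frequently_eq.and_eventually ((h.ae_one_add_mul_pos hl).and hq)).mono ?_
    rintro ω ⟨hω, hlω, hqω⟩
    have hone : (1 + q * R ω) / (1 + l * R ω) ≠ 1 := by
      rw [Ne, div_eq_one_iff_eq hlω.ne', add_right_inj, hω]
      exact fun hmul => hne (mul_right_cancel₀ (neg_neg_of_pos h.loss_pos).ne hmul)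
    have hlog := Real.log_lt_sub_one_of_pos (div_pos hqω hlω) hone
    rw [Real.log_div hqω.ne' hlω.ne', hratio _ hlω] at hlog
    linarith

lemma integral_log_lt (h : IsReturn P R d M) (hl : l ∈ Ioo 0 d⁻¹) (hscore : score P R l = 0)
    (hq : ∀ᵐ ω ∂P, 0 < 1 + q * R ω) (hne : q ≠ l) :
    ∫ ω, Real.log (1 + q * R ω) ∂P < ∫ ω, Real.log (1 + l * R ω) ∂P := by
  have hl' := Ioo_subset_Ico_self hl
  by_cases hint : Integrable (fun ω => Real.log (1 + q * R ω)) P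
  · exact h.integral_log_lt_of_integrable hl' hscore hq hne hint
  · -- A non-integrable logarithm has Bochner integral `0`, the expected utility of `q = 0`.
    rw [integral_undef hint]
    simpa using h.integral_log_lt_of_integrable hl' hscore (q := 0) (by simp) hl.1.ne (by simp)

lemma integral_inv_one_add_mul (h : IsReturn P R d M) (hl : l ∈ Ico 0 d⁻¹)
    (hscore : score P R l = 0) : ∫ ω, 1 / (1 + l * R ω) ∂P = 1 := by
  have hsplit : (fun ω => 1 / (1 + l * R ω)) =ᵐ[P] fun ω => 1 - l * (R ω / (1 + l * R ω)) := by
    filter_upwards [h.ae_one_add_mul_pos hl] with ω hω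
    field_simp
    ring
  rw [integral_congr_ae hsplit, integral_sub (integrable_const _)
    ((h.integrable_div hl).const_mul _), integral_const_mul, ← score, hscore]
  simp

lemma measurable_of_score_eq_zero {T : Type*} [MeasurableSpace T] {R : T → Ω → ℝ} {d M l : T → ℝ}
    (h : ∀ t, IsReturn P (R t) (d t) (M t)) (hR : Measurable fun z : T × Ω => R z.1 z.2)
    (hd : Measurable d) (hl : ∀ t, l t ∈ Ico 0 (d t)⁻¹) (hscore : ∀ t, score P (R t) (l t) = 0) :
    Measurable l := by
  refine measurable_of_Ioi fun q => ?_
  rcases lt_or_ge q 0 with hq | hq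
  · convert! MeasurableSet.univ
    exact eq_univ_of_forall fun t => hq.trans_le (hl t).1
  have hscore_meas : Measurable fun t => score P (R t) q := by
    refine (StronglyMeasurable.integral_prod_right' (ν := P)
      (f := fun z : T × Ω => R z.1 z.2 / (1 + q * R z.1 z.2)) ?_).measurable
    exact Measurable.stronglyMeasurable (by fun_prop)
  have hset : l ⁻¹' Ioi q = {t | q < (d t)⁻¹} ∩ {t | 0 < score P (R t) q} := by
    ext t
    simp only [mem_preimage, mem_Ioi, mem_inter_iff, mem_ofPred_eq]
    refine ⟨fun hlt => ?_, fun ⟨hqd, hpos⟩ => ?_⟩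
    · have hqd := hlt.trans (hl t).2
      exact ⟨hqd, hscore t ▸ (h t).strictAntiOn_score ⟨hq, hqd⟩ (hl t) hlt⟩
    · exact ((h t).strictAntiOn_score.lt_iff_gt (hl t) ⟨hq, hqd⟩).1 (by rwa [hscore t])
  rw [hset]
  exact (measurableSet_lt measurable_const hd.inv).inter
    (measurableSet_lt measurable_const hscore_meas)

end IsReturn

/-! ### The one-period problem at the jump time -/

lemma coefA_mem {t : ℝ} (ht : t ∈ Icc (1 / 2) 1) : coefA t ∈ Icc (1 / 6 : ℝ) (1 / 3) := by
  unfold coefA; constructor <;> linarith [ht.1, ht.2]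

lemma continuous_coefA : Continuous coefA := by unfold coefA; fun_prop

lemma oneReturn_eq (lam t e : ℝ) :
    oneReturn lam t e = (1 - lam) * coefA t * e - (lam + (1 - lam) * coefA t) := by
  unfold oneReturn; ring

lemma one_add_oneReturn (lam t e : ℝ) :
    (1 - lam) * (1 + coefA t * (e - 1)) = 1 + oneReturn lam t e := by
  unfold oneReturn; ring

lemma truncEta_pos {n : ℕ} (hn : n ≠ 0) (e : ℝ) : 0 < truncEta n e :=
  lt_max_of_lt_right (by positivity)

lemma eventually_truncEta_eq {e : ℝ} (he : 0 < e) : ∀ᶠ n in atTop, truncEta n e = e := by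
  filter_upwards [tendsto_one_div_atTop_nhds_zero_nat.eventually_le_const he] with n hn
  exact max_eq_left hn

/-- An upper bound for the admissible transaction costs. With `k = (1 - lam) a_t`, the one-period
score at `1 / (lam + k)` is nonnegative as soon as `(lam + k) E[1/η] ≤ k`, where
`E[1/η] = (1 + 3 ε) / 2` and `k ≥ 13 / 84`. -/
noncomputable def costBound (ε : ℝ) : ℝ := (1 - 3 * ε) / 14

/-- The worst one-period loss, incurred on `{η ≤ 1/n}`. -/
noncomputable def worstLoss (lam : ℝ) (n : ℕ) (t : ℝ) : ℝ := -oneReturn lam t (1 / n)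

/-- The value of `η̂ⁿ_t` on `{η = e}`. -/
noncomputable def jumpDensity {Ω : Type*} [MeasurableSpace Ω] (P : Measure Ω) (η : Ω → ℝ)
    (lam : ℝ) (n : ℕ) (t e : ℝ) : ℝ :=
  1 / (1 + logOpt P η lam n t * oneReturn lam t (truncEta n e))

/-- The value of `η̂ⁿ_t (1 - lam) (1 + a_t (ηⁿ - 1))` on `{η = e}`. -/
noncomputable def jumpPrice {Ω : Type*} [MeasurableSpace Ω] (P : Measure Ω) (η : Ω → ℝ)
    (lam : ℝ) (n : ℕ) (t e : ℝ) : ℝ :=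
  jumpDensity P η lam n t e * ((1 - lam) * (1 + coefA t * (truncEta n e - 1)))

/-- The projection of a time to `[1/2, 1]`, where the one-period problem is solvable. -/
noncomputable def clampTime (t : ℝ) : ℝ := max (1 / 2) (min t 1)

lemma clampTime_mem (t : ℝ) : clampTime t ∈ Icc (1 / 2) 1 :=
  ⟨le_max_left _ _, max_le (by norm_num) (min_le_right _ _)⟩

lemma clampTime_of_mem {t : ℝ} (ht : t ∈ Icc (1 / 2) 1) : clampTime t = t := by
  rw [clampTime, min_eq_left ht.2, max_eq_right ht.1]

lemma measurable_clampTime : Measurable clampTime := by unfold clampTime; fun_prop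

lemma mul_coefA_pos {lam t : ℝ} (hl : lam < 1) (ht : t ∈ Icc (1 / 2) 1) :
    0 < (1 - lam) * coefA t :=
  mul_pos (sub_pos.2 hl) (by linarith [(coefA_mem ht).1])

lemma le_mul_coefA {lam t : ℝ} (hl : lam < 1 / 14) (ht : t ∈ Icc (1 / 2) 1) :
    13 / 84 ≤ (1 - lam) * coefA t := by
  nlinarith [(coefA_mem ht).1]

lemma oneReturn_mono {lam t : ℝ} (hl : lam < 1) (ht : t ∈ Icc (1 / 2) 1) :
    Monotone (oneReturn lam t) := fun e e' he => by
  simp only [oneReturn_eq]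
  linarith [mul_le_mul_of_nonneg_left he (mul_coefA_pos hl ht).le]

section Optimiser

variable {Ω : Type*} [MeasurableSpace Ω] {P : Measure Ω}
  {ε lam : ℝ} {ξ η θ : Ω → ℝ} {n : ℕ} {t : ℝ}

/-- The market model together with a transaction cost `lam` for which the one-period problem has
its optimum beyond `1 / (lam + (1 - lam) a_t)`. -/
structure IsCostlyModel {Ω : Type*} [MeasurableSpace Ω] (P : Measure Ω) (ε lam : ℝ)
    (ξ η θ : Ω → ℝ) : Prop extends IsModel P ε ξ η θ where
  eps_pos : 0 < ε
  lam_pos : 0 < lam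
  lam_lt_costBound : lam < costBound ε

namespace IsCostlyModel

lemma lam_lt (h : IsCostlyModel P ε lam ξ η θ) : lam < 1 / 14 := by
  have hlt := h.lam_lt_costBound
  unfold costBound at hlt
  linarith [h.eps_pos]

lemma lam_lt_one (h : IsCostlyModel P ε lam ξ η θ) : lam < 1 := by linarith [h.lam_lt]

lemma mul_coefA_pos (h : IsCostlyModel P ε lam ξ η θ) (ht : t ∈ Icc (1 / 2) 1) :
    0 < (1 - lam) * coefA t :=
  LadlagExample.mul_coefA_pos h.lam_lt_one ht

end IsCostlyModel

variable [IsProbabilityMeasure P]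

lemma IsModel.isReturn (hε : 0 < ε) (hl : lam ∈ Ioo 0 1) (h : IsModel P ε ξ η θ) (hn : n ≠ 0)
    (ht : t ∈ Icc (1 / 2) 1) :
    IsReturn P (fun ω => oneReturn lam t (truncEta n (η ω))) (worstLoss lam n t)
      (oneReturn lam t 2) where
  measurable := by
    have hη := h.measurable_eta
    unfold oneReturn truncEta
    fun_prop
  loss_pos := by
    have hn1 : 1 / (n : ℝ) ≤ 1 := one_div (n : ℝ) ▸ Nat.cast_inv_le_one n
    rw [worstLoss, oneReturn_eq]
    nlinarith [mul_coefA_pos hl.2 ht, hl.1]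
  mem := by
    have hn1 : 1 / (n : ℝ) ≤ 1 := one_div (n : ℝ) ▸ Nat.cast_inv_le_one n
    filter_upwards [h.ae_eta_mem] with ω hω
    rw [worstLoss, neg_neg]
    exact ⟨oneReturn_mono hl.2 ht (le_max_right _ _),
      oneReturn_mono hl.2 ht (max_le hω.2 (by linarith))⟩
  frequently_eq := by
    have hatom : ∃ᵐ ω ∂P, η ω = etaAtom n := by
      have hpos := h.map_eta_singleton n
      rw [Measure.map_apply h.measurable_eta (measurableSet_singleton _), etaWeight,
        if_neg hn] at hpos
      exact frequently_ae_iff.2 (hpos.trans_ne (ENNReal.ofReal_pos.2 (by positivity)).ne')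
    refine hatom.mono fun ω hω => ?_
    rw [worstLoss, neg_neg, hω, etaAtom, if_neg hn, truncEta, max_self]

namespace IsCostlyModel

lemma isReturn (h : IsCostlyModel P ε lam ξ η θ) (hn : n ≠ 0) (ht : t ∈ Icc (1 / 2) 1) :
    IsReturn P (fun ω => oneReturn lam t (truncEta n (η ω))) (worstLoss lam n t)
      (oneReturn lam t 2) :=
  h.toIsModel.isReturn h.eps_pos ⟨h.lam_pos, h.lam_lt_one⟩ hn ht

lemma mul_integral_inv_truncEta_le (h : IsCostlyModel P ε lam ξ η θ) (ht : t ∈ Icc (1 / 2) 1)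
    (n : ℕ) :
    (lam + (1 - lam) * coefA t) * ∫ ω, 1 / truncEta n (η ω) ∂P ≤ (1 - lam) * coefA t := by
  have hk := le_mul_coefA h.lam_lt ht
  have hcost : lam < (1 - 3 * ε) / 14 := h.lam_lt_costBound
  have hmean := mul_le_mul_of_nonneg_left (h.integral_inv_truncEta_le h.eps_pos.le n)
    (by linarith [h.lam_pos] : 0 ≤ lam + (1 - lam) * coefA t)
  nlinarith [h.lam_pos]

lemma score_inv_nonneg (h : IsCostlyModel P ε lam ξ η θ) (hn : n ≠ 0) (ht : t ∈ Icc (1 / 2) 1) :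
    0 ≤ score P (fun ω => oneReturn lam t (truncEta n (η ω)))
      (1 / (lam + (1 - lam) * coefA t)) := by
  have hk := h.mul_coefA_pos ht
  have hmean := h.mul_integral_inv_truncEta_le ht n
  simp only [score, oneReturn_eq]
  set k := (1 - lam) * coefA t
  have hc : 0 < lam + k := add_pos h.lam_pos hk
  have hratio : ∀ x, 0 < x → (k * x - (lam + k)) / (1 + 1 / (lam + k) * (k * x - (lam + k))) =
      (lam + k) - (lam + k) ^ 2 / k * (1 / x) := by
    intro x hx
    have hden : 1 + 1 / (lam + k) * (k * x - (lam + k)) = k * x / (lam + k) := by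
      field_simp
      ring
    rw [hden]
    field_simp
  simp_rw [hratio _ (truncEta_pos hn _)]
  have hint : Integrable (fun ω => 1 / truncEta n (η ω)) P := by
    have hη := h.measurable_eta
    have hmeas : Measurable fun ω => 1 / truncEta n (η ω) := by unfold truncEta; fun_prop
    refine .of_bound hmeas.aestronglyMeasurable n (ae_of_all _ fun ω => ?_)
    rw [Real.norm_of_nonneg (one_div_pos.2 (truncEta_pos hn _)).le,
      one_div_le (truncEta_pos hn _) (by positivity)]
    exact le_max_right _ _
  rw [integral_sub (integrable_const _) (hint.const_mul _), integral_const_mul]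
  simp only [integral_const, probReal_univ, one_smul, sub_nonneg]
  calc (lam + k) ^ 2 / k * ∫ ω, 1 / truncEta n (η ω) ∂P
      = (lam + k) / k * ((lam + k) * ∫ ω, 1 / truncEta n (η ω) ∂P) := by ring
    _ ≤ (lam + k) / k * k := by gcongr
    _ = lam + k := div_mul_cancel₀ _ hk.ne'

lemma logOpt_spec (h : IsCostlyModel P ε lam ξ η θ) (hn : n ≠ 0) (ht : t ∈ Icc (1 / 2) 1) :
    logOpt P η lam n t ∈ Ico (1 / (lam + (1 - lam) * coefA t)) (worstLoss lam n t)⁻¹ ∧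
      score P (fun ω => oneReturn lam t (truncEta n (η ω))) (logOpt P η lam n t) = 0 := by
  have hk := h.mul_coefA_pos ht
  have hc : 0 < 1 / (lam + (1 - lam) * coefA t) := one_div_pos.2 (add_pos h.lam_pos hk)
  have hR := h.isReturn hn ht
  have hcd : 1 / (lam + (1 - lam) * coefA t) < (worstLoss lam n t)⁻¹ := by
    rw [one_div]
    refine inv_strictAnti₀ hR.loss_pos ?_
    rw [worstLoss, oneReturn_eq, neg_sub, sub_lt_self_iff]
    positivity
  obtain ⟨l, hmem, hscore⟩ := hR.exists_score_eq_zero ⟨hc.le, hcd⟩ (h.score_inv_nonneg hn ht)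
  have hmem' := Ico_subset_Ico_left hc.le hmem
  have hlt := fun q hq => hR.integral_log_lt (q := q) ⟨hc.trans_le hmem.1, hmem.2⟩ hscore hq
  have hopt : IsLogOptimal P η lam n t l := by
    refine ⟨hR.ae_one_add_mul_pos hmem', fun q hq => ?_⟩
    obtain rfl | hne := eq_or_ne q l
    exacts [le_rfl, (hlt q hq hne).le]
  have hspec : IsLogOptimal P η lam n t (logOpt P η lam n t) := Classical.epsilon_spec ⟨l, hopt⟩
  have heq : logOpt P η lam n t = l := by
    by_contra hne
    exact (hlt _ hspec.1 hne).not_ge (hspec.2 l hopt.1)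
  exact heq ▸ ⟨hmem, hscore⟩

lemma logOpt_mem (h : IsCostlyModel P ε lam ξ η θ) (hn : n ≠ 0) (ht : t ∈ Icc (1 / 2) 1) :
    logOpt P η lam n t ∈ Ico 0 (worstLoss lam n t)⁻¹ :=
  Ico_subset_Ico_left (one_div_pos.2 (add_pos h.lam_pos (h.mul_coefA_pos ht))).le
    (h.logOpt_spec hn ht).1

lemma jumpDensity_pos (h : IsCostlyModel P ε lam ξ η θ) (hn : n ≠ 0) (ht : t ∈ Icc (1 / 2) 1)
    (e : ℝ) : 0 < jumpDensity P η lam n t e := by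
  have hl := h.logOpt_mem hn ht
  have hworst : -worstLoss lam n t ≤ oneReturn lam t (truncEta n e) := by
    rw [worstLoss, neg_neg]
    exact oneReturn_mono h.lam_lt_one ht (le_max_right _ _)
  refine one_div_pos.2 ?_
  nlinarith [(h.isReturn hn ht).mul_loss_lt_one hl, mul_le_mul_of_nonneg_left hworst hl.1]

lemma integral_jumpDensity (h : IsCostlyModel P ε lam ξ η θ) (hn : n ≠ 0)
    (ht : t ∈ Icc (1 / 2) 1) : ∫ ω, jumpDensity P η lam n t (η ω) ∂P = 1 :=
  (h.isReturn hn ht).integral_inv_one_add_mul (h.logOpt_mem hn ht) (h.logOpt_spec hn ht).2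

lemma integrable_jumpDensity (h : IsCostlyModel P ε lam ξ η θ) (hn : n ≠ 0)
    (ht : t ∈ Icc (1 / 2) 1) : Integrable (fun ω => jumpDensity P η lam n t (η ω)) P :=
  .of_integral_ne_zero (h.integral_jumpDensity hn ht ▸ one_ne_zero)

lemma integral_jumpPrice (h : IsCostlyModel P ε lam ξ η θ) (hn : n ≠ 0)
    (ht : t ∈ Icc (1 / 2) 1) : ∫ ω, jumpPrice P η lam n t (η ω) ∂P = 1 := by
  have hsplit : ∀ ω, jumpPrice P η lam n t (η ω) = jumpDensity P η lam n t (η ω) +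
      oneReturn lam t (truncEta n (η ω)) /
        (1 + logOpt P η lam n t * oneReturn lam t (truncEta n (η ω))) := by
    intro ω
    rw [jumpPrice, jumpDensity, one_add_oneReturn]
    ring
  simp_rw [hsplit]
  rw [integral_add (h.integrable_jumpDensity hn ht)
    ((h.isReturn hn ht).integrable_div (h.logOpt_mem hn ht)), h.integral_jumpDensity hn ht,
    ← score, (h.logOpt_spec hn ht).2, add_zero]

lemma integrable_jumpPrice (h : IsCostlyModel P ε lam ξ η θ) (hn : n ≠ 0)
    (ht : t ∈ Icc (1 / 2) 1) : Integrable (fun ω => jumpPrice P η lam n t (η ω)) P :=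
  .of_integral_ne_zero (h.integral_jumpPrice hn ht ▸ one_ne_zero)

lemma jumpPrice_pos (h : IsCostlyModel P ε lam ξ η θ) (hn : n ≠ 0) (ht : t ∈ Icc (1 / 2) 1)
    (e : ℝ) : 0 < jumpPrice P η lam n t e := by
  obtain ⟨ha, ha'⟩ := coefA_mem ht
  have hfactor : 0 < 1 + coefA t * (truncEta n e - 1) := by nlinarith [truncEta_pos hn e]
  exact mul_pos (h.jumpDensity_pos hn ht e) (mul_pos (sub_pos.2 h.lam_lt_one) hfactor)

lemma measurable_logOpt (h : IsCostlyModel P ε lam ξ η θ) (hn : n ≠ 0) :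
    Measurable fun t => logOpt P η lam n (clampTime t) := by
  have hη := h.measurable_eta
  refine IsReturn.measurable_of_score_eq_zero (fun t => h.isReturn hn (clampTime_mem t)) ?_ ?_
    (fun t => h.logOpt_mem hn (clampTime_mem t)) (fun t => (h.logOpt_spec hn (clampTime_mem t)).2)
  all_goals
    simp only [worstLoss, oneReturn, truncEta, coefA, clampTime]
    fun_prop

lemma measurable_jumpDensity (h : IsCostlyModel P ε lam ξ η θ) (hn : n ≠ 0) :
    Measurable fun z : ℝ × ℝ => jumpDensity P η lam n (clampTime z.2) z.1 := by
  have hopt : Measurable fun z : ℝ × ℝ => logOpt P η lam n (clampTime z.2) :=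
    (h.measurable_logOpt hn).comp measurable_snd
  simp only [jumpDensity, oneReturn, truncEta, coefA]
  have hclamp := measurable_clampTime
  fun_prop

lemma measurable_jumpPrice (h : IsCostlyModel P ε lam ξ η θ) (hn : n ≠ 0) :
    Measurable fun z : ℝ × ℝ => jumpPrice P η lam n (clampTime z.2) z.1 := by
  have hdensity := h.measurable_jumpDensity hn
  simp only [jumpPrice, truncEta, coefA]
  have hclamp := measurable_clampTime
  fun_prop

lemma tendsto_logOpt (h : IsCostlyModel P ε lam ξ η θ) (ht : t ∈ Icc (1 / 2) 1) :
    Tendsto (fun n => logOpt P η lam n t) atTop (𝓝 (1 / (lam + (1 - lam) * coefA t))) := by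
  have hc : 0 < lam + (1 - lam) * coefA t := add_pos h.lam_pos (h.mul_coefA_pos ht)
  have hloss : Tendsto (fun n => worstLoss lam n t) atTop (𝓝 (lam + (1 - lam) * coefA t)) := by
    simp only [worstLoss, oneReturn_eq, neg_sub]
    simpa only [mul_zero, sub_zero] using
      (tendsto_one_div_atTop_nhds_zero_nat.const_mul ((1 - lam) * coefA t)).const_sub
        (lam + (1 - lam) * coefA t)
  have hbounds : ∀ᶠ n in atTop, logOpt P η lam n t ∈
      Ico (1 / (lam + (1 - lam) * coefA t)) (worstLoss lam n t)⁻¹ := by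
    filter_upwards [eventually_ne_atTop 0] with n hn using (h.logOpt_spec hn ht).1
  refine tendsto_of_tendsto_of_tendsto_of_le_of_le' tendsto_const_nhds ?_
    (hbounds.mono fun n hn => hn.1) (hbounds.mono fun n hn => hn.2.le)
  rw [one_div]
  exact hloss.inv₀ hc.ne'

lemma tendsto_jumpDensity (h : IsCostlyModel P ε lam ξ η θ) (ht : t ∈ Icc (1 / 2) 1)
    {e : ℝ} (he : 0 < e) :
    Tendsto (fun n => jumpDensity P η lam n t e) atTop
      (𝓝 (1 / (1 + 1 / (lam + (1 - lam) * coefA t) * oneReturn lam t e))) := by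
  have hk := h.mul_coefA_pos ht
  have hc := add_pos h.lam_pos hk
  have hden : 1 + 1 / (lam + (1 - lam) * coefA t) * oneReturn lam t e
      = (1 - lam) * coefA t * e / (lam + (1 - lam) * coefA t) := by
    rw [oneReturn_eq]
    field_simp
    ring
  have hne : 1 + 1 / (lam + (1 - lam) * coefA t) * oneReturn lam t e ≠ 0 :=
    hden ▸ (div_pos (mul_pos hk he) hc).ne'
  refine (tendsto_const_nhds.div (((h.tendsto_logOpt ht).mul_const _).const_add _) hne).congr' ?_
  filter_upwards [eventually_truncEta_eq he] with n hn
  rw [jumpDensity, hn, Pi.div_apply]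

end IsCostlyModel

end Optimiser

/-! ### Atoms of the market filtration -/

/-- The σ-algebra of the sets that contain or avoid `D` up to a null set: its members are the sets
for which `D` behaves as an atom. -/
@[reducible]
def atomSigma {Ω : Type*} [MeasurableSpace Ω] (P : Measure Ω) (D : Set Ω) : MeasurableSpace Ω where
  MeasurableSet' A := P (D ∩ A) = 0 ∨ P (D \ A) = 0
  measurableSet_empty := by simp
  measurableSet_compl A hA := by
    rw [← sdiff_eq, sdiff_compl]
    exact hA.symm
  measurableSet_iUnion A hA := by
    by_cases hex : ∃ i, P (D \ A i) = 0
    · obtain ⟨i, hi⟩ := hex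
      exact Or.inr (measure_mono_null (sdiff_subset_sdiff_right (subset_iUnion A i)) hi)
    · push Not at hex
      rw [inter_iUnion]
      exact Or.inl (measure_iUnion_null fun i => (hA i).resolve_right (hex i))

/-- The event that `ξ = v` and that the second jump occurs after time `s`. -/
def preJump {Ω : Type*} (ξ θ : Ω → ℝ) (s v : ℝ) : Set Ω := {ω | s < jumpTime (θ ω) ∧ ξ ω = v}

lemma preJump_eq_iUnion {Ω : Type*} {ξ θ : Ω → ℝ} {s : ℝ} {u : ℕ → ℝ} (hu : ∀ k, s < u k)
    (hlim : Tendsto u atTop (𝓝 s)) (v : ℝ) : preJump ξ θ s v = ⋃ k, preJump ξ θ (u k) v := by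
  ext ω
  simp only [preJump, mem_ofPred_eq, mem_iUnion, exists_and_right]
  refine and_congr_left fun _ => ⟨fun hs => (hlim.eventually_lt_const hs).exists, ?_⟩
  exact fun ⟨k, hk⟩ => (hu k).trans hk

section Filtration

variable {Ω : Type*} [m : MeasurableSpace Ω] {P : Measure Ω} {ε : ℝ} {ξ η θ : Ω → ℝ}

lemma comap_le_atomSigma {β : Type*} [MeasurableSpace β] {D : Set Ω} {f : Ω → β} {c : β}
    (hf : ∀ᵐ ω ∂P, ω ∈ D → f ω = c) : MeasurableSpace.comap f inferInstance ≤ atomSigma P D := by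
  rintro _ ⟨B, _, rfl⟩
  have hnull := ae_iff.1 hf
  by_cases hc : c ∈ B
  · refine Or.inr (measure_mono_null (t := {ω | ¬(ω ∈ D → f ω = c)}) ?_ hnull)
    exact fun ω hω himp => hω.2 (by rwa [mem_preimage, himp hω.1])
  · refine Or.inl (measure_mono_null (t := {ω | ¬(ω ∈ D → f ω = c)}) ?_ hnull)
    exact fun ω hω himp => hc (himp hω.1 ▸ hω.2)

lemma nullSigma_le_atomSigma (D : Set Ω) : nullSigma P ≤ atomSigma P D :=
  MeasurableSpace.generateFrom_le fun _ hA => Or.inl (measure_mono_null inter_subset_right hA)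

lemma measurableSet_atomSigma_iUnion {D : ℕ → Set Ω} (hD : Monotone D) {A : Set Ω}
    (hA : ∀ k, MeasurableSet[atomSigma P (D k)] A) : MeasurableSet[atomSigma P (⋃ k, D k)] A := by
  by_cases hall : ∀ k, P (D k ∩ A) = 0
  · refine Or.inl ?_
    rw [iUnion_inter]
    exact measure_iUnion_null hall
  push Not at hall
  obtain ⟨j, hj⟩ := hall
  refine Or.inr ?_
  rw [iUnion_sdiff]
  refine measure_iUnion_null fun k => ?_
  have hmeet : P (D (max k j) ∩ A) ≠ 0 := fun hz =>
    hj (measure_mono_null (inter_subset_inter_left _ (hD (le_max_right k j))) hz)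
  exact measure_mono_null (sdiff_subset_sdiff_left (hD (le_max_left k j)))
    ((hA _).resolve_left hmeet)

variable [P.IsComplete]

/-- The market filtration before it is made right continuous. -/
noncomputable def rawFiltration (h : IsModel P ε ξ η θ) : Filtration unitInterval m :=
  Filtration.natural (observed ξ η θ) (fun t =>
      (measurable_observed h.measurable_xi h.measurable_eta h.measurable_theta
        t).stronglyMeasurable) ⊔
    Filtration.const unitInterval (nullSigma P) (nullSigma_le P)

lemma rawFiltration_le_marketFiltration (h : IsModel P ε ξ η θ) (u : unitInterval) :
    rawFiltration h u ≤ marketFiltration P h u :=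
  (rawFiltration h).le_rightCont u

lemma marketFiltration_le_rawFiltration (h : IsModel P ε ξ η θ) {s u : unitInterval}
    (hsu : s < u) : marketFiltration P h s ≤ rawFiltration h u := by
  rw [show marketFiltration P h = (rawFiltration h).rightCont from rfl,
    Filtration.rightCont_eq_of_not_isMax _ (not_isMax_iff.2 ⟨u, hsu⟩)]
  exact iInf₂_le u hsu

lemma rawFiltration_le_atomSigma (h : IsModel P ε ξ η θ) {u : unitInterval} {D : Set Ω}
    (hD : ∀ j ≤ u, ∃ c, ∀ᵐ ω ∂P, ω ∈ D → observed ξ η θ j ω = c) :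
    rawFiltration h u ≤ atomSigma P D := by
  refine sup_le (iSup₂_le fun j hj => ?_) (nullSigma_le_atomSigma D)
  obtain ⟨c, hc⟩ := hD j hj
  exact comap_le_atomSigma hc

lemma measurable_observed_market (h : IsModel P ε ξ η θ) {j u : unitInterval} (hj : j ≤ u) :
    Measurable[marketFiltration P h u] (observed ξ η θ j) := by
  refine Measurable.mono ?_ (rawFiltration_le_marketFiltration h u) le_rfl
  rw [measurable_iff_comap_le]
  exact le_sup_of_le_left (le_iSup₂_of_le j hj le_rfl)

lemma measurableSet_market_of_null (h : IsModel P ε ξ η θ) (u : unitInterval) {A : Set Ω}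
    (hA : P A = 0) : MeasurableSet[marketFiltration P h u] A := by
  refine rawFiltration_le_marketFiltration h u _ ?_
  exact (le_sup_right : nullSigma P ≤ _) _ (MeasurableSpace.measurableSet_generateFrom hA)

lemma measurable_market_of_ae_eq (h : IsModel P ε ξ η θ) (u : unitInterval) {f g : Ω → ℝ}
    (hg : Measurable[marketFiltration P h u] g) (hfg : f =ᵐ[P] g) :
    Measurable[marketFiltration P h u] f := by
  intro B hB
  have hdiff : P (symmDiff (f ⁻¹' B) (g ⁻¹' B)) = 0 :=
    measure_symmDiff_eq_zero_iff.2 (hfg.preimage B)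
  rw [← symmDiff_symmDiff_cancel_right (g ⁻¹' B) (f ⁻¹' B)]
  exact (measurableSet_market_of_null h u hdiff).symmDiff (hg hB)

lemma measure_eq_zero_or_compl_of_lt_half [IsProbabilityMeasure P] (h : IsModel P ε ξ η θ)
    {s : unitInterval} (hs : (s : ℝ) < 1 / 2) {A : Set Ω}
    (hA : MeasurableSet[marketFiltration P h s] A) : P A = 0 ∨ P Aᶜ = 0 := by
  obtain ⟨r, hsr, hr⟩ := exists_between hs
  set u : unitInterval := ⟨r, s.2.1.trans hsr.le, by linarith⟩
  have hle : rawFiltration h u ≤ atomSigma P univ := by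
    refine rawFiltration_le_atomSigma h fun j hj => ⟨(1, 0), ?_⟩
    have hj2 : (j : ℝ) < 1 / 2 := lt_of_le_of_lt (b := r) hj hr
    filter_upwards [h.ae_half_lt_jumpTime] with ω hω _
    simp only [observed, askProcess, ask, if_neg (hj2.trans hω).not_ge, if_neg hj2.not_ge]
    norm_num
  have hatom := hle _ (marketFiltration_le_rawFiltration h (show s < u from hsr) _ hA)
  rw [compl_eq_univ_sdiff]
  simpa only [univ_inter] using (show P (univ ∩ A) = 0 ∨ P (univ \ A) = 0 from hatom)

lemma preJump_atom (h : IsModel P ε ξ η θ) {s : unitInterval} (v : ℝ) {A : Set Ω}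
    (hA : MeasurableSet[marketFiltration P h s] A) :
    P (preJump ξ θ s v ∩ A) = 0 ∨ P (preJump ξ θ s v \ A) = 0 := by
  have hraw : ∀ u : unitInterval, s < u → MeasurableSet[atomSigma P (preJump ξ θ u v)] A := by
    intro u hu
    refine rawFiltration_le_atomSigma h (fun j hj => ?_) _
      (marketFiltration_le_rawFiltration h hu _ hA)
    refine ⟨(1 + (v - 1) * (if (1 : ℝ) / 2 ≤ j then 1 else 0), 0), ?_⟩
    refine ae_of_all _ fun ω ⟨hω, hv⟩ => ?_
    simp [observed, askProcess, ask, (lt_of_le_of_lt (show (j : ℝ) ≤ u from hj) hω).not_ge, hv]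
  rcases le_or_gt 1 s with hs | hs
  · have hempty : preJump ξ θ s v = ∅ := by
      refine eq_empty_of_forall_notMem fun ω hω => ?_
      exact (hω.1.trans_le (jumpTime_le_one _)).not_ge hs
    simp [hempty]
  obtain ⟨u, hanti, hmem, hlim⟩ := exists_seq_strictAnti_tendsto' hs
  have hmono : Monotone fun k => preJump ξ θ (u k) v := fun j k hjk ω hω =>
    ⟨lt_of_le_of_lt (hanti.antitone hjk) hω.1, hω.2⟩
  rw [preJump_eq_iUnion (u := fun k => u k) (fun k => (hmem k).1)
    ((continuous_subtype_val.tendsto s).comp hlim)]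
  exact measurableSet_atomSigma_iUnion hmono fun k => hraw _ (hmem k).1

variable [IsProbabilityMeasure P]

lemma measurable_min_jumpTime (h : IsModel P ε ξ η θ) (t : unitInterval) :
    Measurable[marketFiltration P h t] fun ω => min (jumpTime (θ ω)) t := by
  refine measurable_of_Iic fun r => ?_
  rcases le_or_gt (t : ℝ) r with hr | hr
  · convert! MeasurableSet.univ
    exact eq_univ_of_forall fun ω => min_le_of_right_le hr
  have hpre : (fun ω => min (jumpTime (θ ω)) (t : ℝ)) ⁻¹' Iic r = {ω | jumpTime (θ ω) ≤ r} := by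
    ext ω
    simp [hr]
  rw [hpre]
  rcases lt_or_ge r 0 with hr0 | hr0
  · refine measurableSet_market_of_null h t ?_
    refine measure_mono_null (fun ω (hω : _ ≤ r) => not_lt.2 ?_) (ae_iff.1 h.ae_half_lt_jumpTime)
    linarith
  · have hobs := measurable_observed_market h (j := ⟨r, hr0, hr.le.trans t.2.2⟩) (u := t) hr.le
    convert! hobs (measurable_snd (measurableSet_singleton (1 : ℝ)))
    ext ω
    simp [observed]

end Filtration

/-! ### Paths with jumps at times `1/2` and `σ` only -/

lemma isCadlagPath_of_continuous {f : ℝ → ℝ} (hf : Continuous f) :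
    IsCadlagPath fun t => f t := fun t =>
  ⟨(hf.comp continuous_subtype_val).continuousWithinAt, f t,
    ((hf.comp continuous_subtype_val).tendsto t).mono_left nhdsWithin_le_nhds⟩

lemma IsCadlagPath.ite_lt {f g : unitInterval → ℝ} (hf : IsCadlagPath f) (hg : IsCadlagPath g)
    (a : ℝ) : IsCadlagPath fun t => if (t : ℝ) < a then f t else g t := by
  have hval : Continuous fun u : unitInterval => (u : ℝ) := continuous_subtype_val
  refine fun t => ⟨?_, ?_⟩
  · rcases lt_or_ge (t : ℝ) a with ht | ht
    · refine (hf t).1.congr_of_eventuallyEq (nhdsWithin_le_nhds ?_) (if_pos ht)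
      filter_upwards [(hval.tendsto t).eventually_lt_const ht] with u hu using if_pos hu
    · exact (hg t).1.congr (fun u hu => if_neg (ht.trans hu).not_gt) (if_neg ht.not_gt)
  · rcases le_or_gt (t : ℝ) a with ht | ht
    · obtain ⟨l, hl⟩ := (hf t).2
      refine ⟨l, hl.congr' ?_⟩
      filter_upwards [self_mem_nhdsWithin] with u hu
      exact (if_pos (lt_of_lt_of_le (show (u : ℝ) < t from hu) ht)).symm
    · obtain ⟨l, hl⟩ := (hg t).2
      refine ⟨l, hl.congr' (nhdsWithin_le_nhds ?_)⟩
      filter_upwards [(hval.tendsto t).eventually_const_lt ht] with u hu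
        using (if_neg hu.not_gt).symm

/-- The path of a process which equals `c₀` before time `1/2`, `K x t` from then on and before
time `s`, and `J x e s` from time `s` on. -/
noncomputable def jumpPath (c₀ : ℝ) (K : ℝ → ℝ → ℝ) (J : ℝ → ℝ → ℝ → ℝ) (x e s t : ℝ) : ℝ :=
  if t < 1 / 2 then c₀ else if t < s then K x t else J x e s

section Path

variable {c₀ : ℝ} {K : ℝ → ℝ → ℝ} {J : ℝ → ℝ → ℝ → ℝ} {x e s t : ℝ}

lemma jumpPath_early (ht : t < 1 / 2) : jumpPath c₀ K J x e s t = c₀ := if_pos ht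

lemma jumpPath_mid (ht : 1 / 2 ≤ t) (hts : t < s) : jumpPath c₀ K J x e s t = K x t := by
  rw [jumpPath, if_neg ht.not_gt, if_pos hts]

lemma jumpPath_late (ht : 1 / 2 ≤ t) (hst : s ≤ t) : jumpPath c₀ K J x e s t = J x e s := by
  rw [jumpPath, if_neg ht.not_gt, if_neg hst.not_gt]

lemma isCadlagPath_jumpPath (hK : Continuous (K x)) :
    IsCadlagPath fun t => jumpPath c₀ K J x e s t :=
  (isCadlagPath_of_continuous continuous_const).ite_lt
    ((isCadlagPath_of_continuous hK).ite_lt (isCadlagPath_of_continuous continuous_const) s) _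

lemma ask_mid (ht : 1 / 2 ≤ t) (hts : t < s) : ask x e s t = x := by
  rw [ask, if_pos ht, if_neg hts.not_ge]
  ring

lemma ask_late (ht : 1 / 2 ≤ t) (hst : s ≤ t) : ask x e s t = x * (1 + coefA s * (e - 1)) := by
  rw [ask, if_pos ht, if_pos hst]
  ring

end Path

/-! ### Martingales with jumps at times `1/2` and `σ` only -/

lemma martingale_of_setIntegral_eq_top {Ω ι : Type*} {m : MeasurableSpace Ω} {P : Measure Ω}
    [IsFiniteMeasure P] [Preorder ι] [OrderTop ι] {𝓕 : Filtration ι m} {X : ι → Ω → ℝ}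
    (hadapted : StronglyAdapted 𝓕 X) (hint : ∀ i, Integrable (X i) P)
    (hX : ∀ i A, MeasurableSet[𝓕 i] A → ∫ ω in A, X i ω ∂P = ∫ ω in A, X ⊤ ω ∂P) :
    Martingale X 𝓕 P := by
  have hcond : ∀ i, X i =ᵐ[P] P[X ⊤ | 𝓕 i] := fun i =>
    ae_eq_condExp_of_forall_setIntegral_eq (𝓕.le i) (hint ⊤) (fun A _ _ => (hint i).integrableOn)
      (fun A hA _ => hX i A hA) (hadapted i).aestronglyMeasurable
  refine ⟨hadapted, fun i j hij => ?_⟩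
  calc P[X j | 𝓕 i] =ᵐ[P] P[P[X ⊤ | 𝓕 j] | 𝓕 i] := condExp_congr_ae (hcond j)
    _ =ᵐ[P] P[X ⊤ | 𝓕 i] := (martingale_condExp (X ⊤) 𝓕 P).2 i j hij
    _ =ᵐ[P] X i := (hcond i).symm

/-- Almost all paths of `X` are those of `jumpPath c₀ K J` driven by `ξ`, `η` and `σ`. -/
def HasJumpPaths {Ω : Type*} [MeasurableSpace Ω] (P : Measure Ω) (ξ η θ : Ω → ℝ) (c₀ : ℝ)
    (K : ℝ → ℝ → ℝ) (J : ℝ → ℝ → ℝ → ℝ) (X : unitInterval → Ω → ℝ) : Prop :=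
  ∀ᵐ ω ∂P, ∀ t : unitInterval, X t ω = jumpPath c₀ K J (ξ ω) (η ω) (jumpTime (θ ω)) t

/-- The conditions on `c₀`, `K` and `J` under which a process with paths `jumpPath c₀ K J` is a
martingale: `J` averages to `K` over the jump at `σ`, and `K` to `c₀` over the jump at `1/2`. -/
structure IsMartingaleData {Ω : Type*} [MeasurableSpace Ω] (P : Measure Ω) (η θ : Ω → ℝ) (c₀ : ℝ)
    (K : ℝ → ℝ → ℝ) (J : ℝ → ℝ → ℝ → ℝ) : Prop where
  measurable_K : Measurable fun z : ℝ × ℝ => K z.1 z.2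
  measurable_J : Measurable fun z : ℝ × ℝ × ℝ => J z.1 z.2.1 z.2.2
  continuous : ∀ v, v = 3 ∨ v = 1 / 2 → Continuous (K v)
  integrable : ∀ v, v = 3 ∨ v = 1 / 2 → Integrable (fun ω => J v (η ω) (jumpTime (θ ω))) P
  integral : ∀ v, v = 3 ∨ v = 1 / 2 → ∀ s : ℝ, 1 / 2 ≤ s → s < 1 →
    ∫ ω in {ω | s < jumpTime (θ ω)}, J v (η ω) (jumpTime (θ ω)) ∂P =
      Real.exp (-(s - 1 / 2)) * K v s
  mean : 5 / 6 * K 3 (1 / 2) + 1 / 6 * K (1 / 2) (1 / 2) = c₀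

section Martingale

variable {Ω : Type*} [MeasurableSpace Ω] {P : Measure Ω} {ε : ℝ} {ξ η θ : Ω → ℝ} {c₀ : ℝ}
  {K : ℝ → ℝ → ℝ} {J : ℝ → ℝ → ℝ → ℝ} {X : unitInterval → Ω → ℝ}

lemma measurableSet_lt_jumpTime (hθ : Measurable θ) (s : ℝ) :
    MeasurableSet {ω | s < jumpTime (θ ω)} :=
  measurableSet_lt measurable_const (measurable_jumpTime.comp hθ)

lemma measurableSet_preJump (h : IsModel P ε ξ η θ) (s v : ℝ) :
    MeasurableSet (preJump ξ θ s v) :=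
  (measurableSet_lt_jumpTime h.measurable_theta s).inter
    (h.measurable_xi (measurableSet_singleton v))

lemma IsModel.setIntegral_preJump (h : IsModel P ε ξ η θ) {F : ℝ × ℝ → ℝ} (hF : Measurable F)
    (s v : ℝ) : ∫ ω in preJump ξ θ s v, F (η ω, θ ω) ∂P =
      P.real {ω | ξ ω = v} * ∫ ω in {ω | s < jumpTime (θ ω)}, F (η ω, θ ω) ∂P := by
  have hv : MeasurableSet[MeasurableSpace.comap ξ inferInstance] {ω | ξ ω = v} :=
    ⟨{v}, measurableSet_singleton v, rfl⟩
  have hB : MeasurableSet {z : ℝ × ℝ | s < jumpTime z.2} :=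
    measurableSet_lt_jumpTime measurable_snd s
  have hindep := Indep.setIntegral_eq_mul h.measurable_xi.comap_le
    (f := {z : ℝ × ℝ | s < jumpTime z.2}.indicator F) h.indepFun_xi
    (h.measurable_eta.prodMk h.measurable_theta).aemeasurable hv
    (hF.indicator hB).aestronglyMeasurable
  have hcomp : ∀ ω, {z : ℝ × ℝ | s < jumpTime z.2}.indicator F (η ω, θ ω) =
      {ω | s < jumpTime (θ ω)}.indicator (fun ω => F (η ω, θ ω)) ω := fun _ => rfl
  simp_rw [hcomp] at hindep
  rw [setIntegral_indicator (measurableSet_lt_jumpTime h.measurable_theta s),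
    integral_indicator (measurableSet_lt_jumpTime h.measurable_theta s)] at hindep
  rw [← hindep]
  congr 2
  ext ω
  exact and_comm

variable [IsProbabilityMeasure P]

lemma ae_eq_add_indicator_xi (h : IsModel P ε ξ η θ) (F : ℝ → Ω → ℝ) :
    (fun ω => F (ξ ω) ω) =ᵐ[P] {ω | ξ ω = 3}.indicator (F 3) +
      {ω | ξ ω = 1 / 2}.indicator (F (1 / 2)) := by
  filter_upwards [h.ae_xi] with ω hω
  rcases hω with hω | hω <;> simp only [Pi.add_apply, indicator, mem_ofPred_eq, hω] <;> norm_num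

lemma IsMartingaleData.integrable_jump (h : IsModel P ε ξ η θ)
    (hd : IsMartingaleData P η θ c₀ K J) :
    Integrable (fun ω => J (ξ ω) (η ω) (jumpTime (θ ω))) P := by
  have hξ := fun v => h.measurable_xi (measurableSet_singleton v)
  exact (((hd.integrable 3 (Or.inl rfl)).indicator (hξ _)).add
    ((hd.integrable (1 / 2) (Or.inr rfl)).indicator (hξ _))).congr
    (ae_eq_add_indicator_xi h fun v ω => J v (η ω) (jumpTime (θ ω))).symm

lemma IsMartingaleData.setIntegral_preJump_sub_eq_zero (h : IsModel P ε ξ η θ)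
    (hd : IsMartingaleData P η θ c₀ K J) {v s : ℝ} (hv : v = 3 ∨ v = 1 / 2) (hs : 1 / 2 ≤ s) :
    ∫ ω in preJump ξ θ s v, (J v (η ω) (jumpTime (θ ω)) - K v s) ∂P = 0 := by
  have hF : Measurable fun z : ℝ × ℝ => J v z.1 (jumpTime z.2) - K v s :=
    (hd.measurable_J.comp (measurable_const.prodMk
      (measurable_fst.prodMk (measurable_jumpTime.comp measurable_snd)))).sub_const _
  rw [h.setIntegral_preJump hF s v]
  rcases lt_or_ge s 1 with hs1 | hs1
  · rw [integral_sub (hd.integrable v hv).integrableOn (integrable_const _),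
      hd.integral v hv s hs hs1, setIntegral_const, h.measureReal_lt_jumpTime hs hs1, smul_eq_mul,
      sub_self, mul_zero]
  · have hempty : {ω | s < jumpTime (θ ω)} = ∅ :=
      eq_empty_of_forall_notMem fun ω hω => (hω.trans_le (jumpTime_le_one _)).not_ge hs1
    rw [hempty, Measure.restrict_empty, integral_zero_measure, mul_zero]

variable [P.IsComplete]

lemma IsMartingaleData.setIntegral_indicator_preJump_eq_zero (h : IsModel P ε ξ η θ)
    (hd : IsMartingaleData P η θ c₀ K J) {s : unitInterval} {A : Set Ω}
    (hA : MeasurableSet[marketFiltration P h s] A) (hs : 1 / 2 ≤ (s : ℝ)) {v : ℝ}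
    (hv : v = 3 ∨ v = 1 / 2) :
    ∫ ω in A, (preJump ξ θ s v).indicator
      (fun ω => J v (η ω) (jumpTime (θ ω)) - K v s) ω ∂P = 0 := by
  rw [setIntegral_indicator (measurableSet_preJump h s v), inter_comm]
  rcases preJump_atom h v hA with h0 | h0
  · exact setIntegral_measure_zero _ h0
  · have hae : (preJump ξ θ s v ∩ A : Set Ω) =ᵐ[P] preJump ξ θ s v :=
      inter_eventuallyEq_left.2 (ae_le_set.2 h0)
    rw [setIntegral_congr_set hae]
    exact hd.setIntegral_preJump_sub_eq_zero h hv hs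

lemma exists_measurable_eq_eta (h : IsModel P ε ξ η θ) {t : unitInterval}
    (ht : 1 / 2 ≤ (t : ℝ)) :
    ∃ x e : Ω → ℝ, Measurable[marketFiltration P h t] x ∧ Measurable[marketFiltration P h t] e ∧
      ∀ᵐ ω ∂P, x ω = ξ ω ∧ (jumpTime (θ ω) ≤ t → e ω = η ω) := by
  have hx := measurable_fst.comp (measurable_observed_market h (j := halfTime) (u := t) ht)
  have hS := measurable_fst.comp (measurable_observed_market h (le_refl t))
  have ha := continuous_coefA.measurable.comp (measurable_min_jumpTime h t)
  refine ⟨_, _, hx, (((hS.div hx).sub_const 1).div ha).const_add 1, ?_⟩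
  filter_upwards [h.ae_half_lt_jumpTime, h.ae_xi] with ω hσ hξ
  have hhalf : (observed ξ η θ halfTime ω).1 = ξ ω := ask_mid le_rfl hσ
  refine ⟨hhalf, fun hσt => ?_⟩
  have hnow : (observed ξ η θ t ω).1 = ξ ω * (1 + coefA (jumpTime (θ ω)) * (η ω - 1)) :=
    ask_late ht hσt
  have hξ0 : ξ ω ≠ 0 := by rcases hξ with hξ | hξ <;> norm_num [hξ]
  have ha0 := (coefA_mem ⟨hσ.le, jumpTime_le_one (θ ω)⟩).1
  simp only [Function.comp_apply, Pi.div_apply, hhalf, hnow, min_eq_left hσt]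
  rw [mul_div_cancel_left₀ _ hξ0, add_sub_cancel_left, mul_div_cancel_left₀ _ (by linarith),
    add_sub_cancel]

namespace HasJumpPaths

lemma measurable (h : IsModel P ε ξ η θ) (hd : IsMartingaleData P η θ c₀ K J)
    (hX : HasJumpPaths P ξ η θ c₀ K J X) (t : unitInterval) :
    Measurable[marketFiltration P h t] (X t) := by
  rcases lt_or_ge (t : ℝ) (1 / 2) with ht | ht
  · refine measurable_market_of_ae_eq h t (measurable_const (a := c₀)) ?_
    filter_upwards [hX] with ω hω
    rw [hω t, jumpPath_early ht]
  obtain ⟨x, e, hx, he, heq⟩ := exists_measurable_eq_eta h ht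
  have hi := measurable_snd.comp (measurable_observed_market h (le_refl t))
  have hpath : Measurable[marketFiltration P h t] fun ω => if (observed ξ η θ t ω).2 = 1
      then J (x ω) (e ω) (min (jumpTime (θ ω)) t) else K (x ω) t :=
    Measurable.ite (hi (measurableSet_singleton 1))
      (hd.measurable_J.comp (hx.prodMk (he.prodMk (measurable_min_jumpTime h t))))
      (hd.measurable_K.comp (hx.prodMk (measurable_const (a := (t : ℝ)))))
  refine measurable_market_of_ae_eq h t hpath ?_
  filter_upwards [hX, heq] with ω hω hxe
  rw [hω t]
  rcases lt_or_ge (t : ℝ) (jumpTime (θ ω)) with hts | hts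
  · simp [jumpPath_mid ht hts, observed, hts.not_ge, hxe.1]
  · simp [jumpPath_late ht hts, observed, hts, hxe.1, hxe.2 hts]

lemma integrable (h : IsModel P ε ξ η θ) (hd : IsMartingaleData P η θ c₀ K J)
    (hX : HasJumpPaths P ξ η θ c₀ K J X) (t : unitInterval) : Integrable (X t) P := by
  refine ((hd.integrable_jump h).norm.add
    (integrable_const (|c₀| + (|K 3 t| + |K (1 / 2) t|)))).mono'
    ((hX.measurable h hd t).mono ((marketFiltration P h).le t) le_rfl).aestronglyMeasurable ?_
  filter_upwards [hX, h.ae_xi] with ω hω hξ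
  have hc := abs_nonneg c₀
  have hK3 := abs_nonneg (K 3 t)
  have hK2 := abs_nonneg (K (1 / 2) t)
  have hJ := norm_nonneg (J (ξ ω) (η ω) (jumpTime (θ ω)))
  simp only [hω t, jumpPath, Pi.add_apply]
  split_ifs
  · rw [Real.norm_eq_abs]
    linarith
  · rcases hξ with hξ | hξ <;> rw [hξ] at hJ ⊢ <;> rw [Real.norm_eq_abs (K _ _)] <;> linarith
  · linarith

lemma setIntegral_eq_of_half_le (h : IsModel P ε ξ η θ) (hd : IsMartingaleData P η θ c₀ K J)
    (hX : HasJumpPaths P ξ η θ c₀ K J X) {s : unitInterval} (hs : 1 / 2 ≤ (s : ℝ)) {A : Set Ω}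
    (hA : MeasurableSet[marketFiltration P h s] A) :
    ∫ ω in A, X s ω ∂P = ∫ ω in A, X 1 ω ∂P := by
  set D : ℝ → Ω → ℝ := fun v =>
    (preJump ξ θ s v).indicator fun ω => J v (η ω) (jumpTime (θ ω)) - K v s
  have hdiff : ∀ᵐ ω ∂P, X 1 ω - X s ω = D 3 ω + D (1 / 2) ω := by
    filter_upwards [hX, h.ae_xi] with ω hω hξ
    have hone : X 1 ω = J (ξ ω) (η ω) (jumpTime (θ ω)) := by
      rw [hω 1]
      exact jumpPath_late (by norm_num) (jumpTime_le_one _)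
    rw [hone, hω s]
    rcases lt_or_ge (s : ℝ) (jumpTime (θ ω)) with hsσ | hsσ
    · rw [jumpPath_mid hs hsσ]
      rcases hξ with hξ | hξ <;> simp only [D, indicator, preJump, mem_ofPred_eq, hsσ, hξ] <;>
        norm_num
    · rw [jumpPath_late hs hsσ]
      simp [D, preJump, hsσ.not_gt]
  have hD : ∀ v, v = 3 ∨ v = 1 / 2 → Integrable (D v) P := fun v hv =>
    ((hd.integrable v hv).sub (integrable_const _)).indicator (measurableSet_preJump h s v)
  have hzero : ∫ ω in A, (X 1 ω - X s ω) ∂P = 0 := by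
    rw [integral_congr_ae (ae_restrict_of_ae hdiff),
      integral_add (hD 3 (Or.inl rfl)).integrableOn (hD _ (Or.inr rfl)).integrableOn,
      hd.setIntegral_indicator_preJump_eq_zero h hA hs (Or.inl rfl),
      hd.setIntegral_indicator_preJump_eq_zero h hA hs (Or.inr rfl), add_zero]
  rw [integral_sub (hX.integrable h hd 1).integrableOn (hX.integrable h hd s).integrableOn] at hzero
  linarith

lemma integral_one (h : IsModel P ε ξ η θ) (hd : IsMartingaleData P η θ c₀ K J)
    (hX : HasJumpPaths P ξ η θ c₀ K J X) : ∫ ω, X 1 ω ∂P = c₀ := by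
  have hhalf : X halfTime =ᵐ[P] fun ω => K (ξ ω) (1 / 2) := by
    filter_upwards [hX, h.ae_half_lt_jumpTime] with ω hω hσ
    rw [hω halfTime]
    exact jumpPath_mid le_rfl hσ
  have hlate := hX.setIntegral_eq_of_half_le h hd (s := halfTime) le_rfl MeasurableSet.univ
  have hξ : ∀ v, MeasurableSet {ω | ξ ω = v} := fun v => h.measurable_xi (measurableSet_singleton v)
  rw [setIntegral_univ, setIntegral_univ] at hlate
  rw [← hlate, integral_congr_ae hhalf,
    integral_congr_ae (ae_eq_add_indicator_xi h fun v _ => K v (1 / 2)),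
    integral_add' ((integrable_const _).indicator (hξ _)) ((integrable_const _).indicator (hξ _)),
    integral_indicator_const _ (hξ _), integral_indicator_const _ (hξ _), h.xi_up,
    h.xi_down, smul_eq_mul, smul_eq_mul, hd.mean]

lemma setIntegral_eq_of_lt_half (h : IsModel P ε ξ η θ) (hd : IsMartingaleData P η θ c₀ K J)
    (hX : HasJumpPaths P ξ η θ c₀ K J X) {s : unitInterval} (hs : (s : ℝ) < 1 / 2) {A : Set Ω}
    (hA : MeasurableSet[marketFiltration P h s] A) :
    ∫ ω in A, X s ω ∂P = ∫ ω in A, X 1 ω ∂P := by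
  rcases measure_eq_zero_or_compl_of_lt_half h hs hA with h0 | h0
  · rw [setIntegral_measure_zero _ h0, setIntegral_measure_zero _ h0]
  have hconst : X s =ᵐ[P] fun _ => c₀ := by
    filter_upwards [hX] with ω hω
    rw [hω s, jumpPath_early hs]
  have hfull : A =ᵐ[P] univ := eventuallyEq_univ.2 h0
  rw [setIntegral_congr_set hfull, setIntegral_congr_set hfull, setIntegral_univ,
    setIntegral_univ, hX.integral_one h hd, integral_congr_ae hconst, integral_const,
    probReal_univ, one_smul]

theorem isCadlagMartingale (h : IsModel P ε ξ η θ) (hd : IsMartingaleData P η θ c₀ K J)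
    (hX : HasJumpPaths P ξ η θ c₀ K J X) : IsCadlagMartingale X (marketFiltration P h) P := by
  refine ⟨martingale_of_setIntegral_eq_top (fun t => (hX.measurable h hd t).stronglyMeasurable)
    (hX.integrable h hd) fun s A hA => ?_, ?_⟩
  · rcases lt_or_ge (s : ℝ) (1 / 2) with hs | hs
    exacts [hX.setIntegral_eq_of_lt_half h hd hs hA, hX.setIntegral_eq_of_half_le h hd hs hA]
  · filter_upwards [hX, h.ae_xi] with ω hω hξ
    rw [show (fun t => X t ω) = fun t : unitInterval => jumpPath c₀ K J _ _ _ t from funext hω]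
    exact isCadlagPath_jumpPath (hd.continuous _ hξ)

end HasJumpPaths

end Martingale

/-! ### The time of return to the ask price -/

/-- The relative excess over the bid price `(1 - λ) ξ` of `M̃ⁿ`, at time `1/2 + y` and before the
jump at `σ`; `b` stands for `bₙ`. -/
noncomputable def premium (n : ℕ) (b y : ℝ) : ℝ :=
  -b / 3 * ((Real.exp (n * y) - 1) * (1 - 1 / (n : ℝ)) + y)

/-- The deterministic time at which `M̃ⁿ` reaches the ask price when there is no earlier jump. -/
def IsSwitchTime (lam : ℝ) (n : ℕ) (b r : ℝ) : Prop :=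
  r ∈ Ioo (1 / 2 : ℝ) 1 ∧ (1 - lam) * (1 + premium n b (r - 1 / 2)) = 1

/-- The time from which on, before the jump at `σ`, the approximating price is the ask price: the
switch time `r` after a downward move of `ξ`, and `1/2` after an upward one. -/
noncomputable def returnTime (r x : ℝ) : ℝ := if x < 1 then r else 1 / 2

section Premium

variable {n : ℕ} {b y : ℝ}

@[fun_prop]
lemma continuous_premium : Continuous (premium n b) := by
  unfold premium
  fun_prop

lemma premium_zero : premium n b 0 = 0 := by simp [premium]

lemma strictMono_premium (hb : b < 0) : StrictMono (premium n b) := by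
  intro y z hyz
  have hn : 0 ≤ 1 - 1 / (n : ℝ) := by
    rw [one_div]
    exact sub_nonneg.2 (Nat.cast_inv_le_one n)
  have hexp : Real.exp (n * y) - 1 ≤ Real.exp (n * z) - 1 := by gcongr
  have hb3 : 0 < -b / 3 := by linarith
  unfold premium
  gcongr ?_ * ?_
  exact add_lt_add_of_le_of_lt (mul_le_mul_of_nonneg_right hexp hn) hyz

lemma hasDerivAt_premium (hn : n ≠ 0) :
    HasDerivAt (premium n b) (n * (premium n b y - coefA (1 / 2 + y) * b)) y := by
  have hexp : HasDerivAt (fun y : ℝ => Real.exp (n * y)) (Real.exp (n * y) * (n * 1)) y :=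
    ((hasDerivAt_id y).const_mul (n : ℝ)).exp
  refine ((((hexp.sub_const 1).mul_const (1 - 1 / (n : ℝ))).add
    (hasDerivAt_id y)).const_mul (-b / 3)).congr_deriv ?_
  simp only [premium, coefA]
  field_simp
  ring

lemma tildeA_eq (hn : n ≠ 0) (lam x t : ℝ) :
    tildeA lam x n b t = -((1 - lam) * x * premium n b (t - 1 / 2)) := by
  have hderiv : ∀ u, HasDerivAt
      (fun u => -(Real.exp (-(n * (u - 1 / 2))) * premium n b (u - 1 / 2)))
      (n * coefA u * b * Real.exp (-(n * (u - 1 / 2)))) u := fun u => by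
    have hsub : HasDerivAt (fun u : ℝ => u - 1 / 2) 1 u := (hasDerivAt_id u).sub_const _
    have hpremium : HasDerivAt (fun u => premium n b (u - 1 / 2)) _ u :=
      (hasDerivAt_premium hn).comp u hsub
    refine (((hsub.const_mul (n : ℝ)).fun_neg.exp).mul hpremium).neg.congr_deriv ?_
    rw [show 1 / 2 + (u - 1 / 2) = u by ring]
    ring
  have hcoefA := continuous_coefA
  rw [tildeA, intervalIntegral.integral_eq_sub_of_hasDerivAt (fun u _ => hderiv u)
    (Continuous.intervalIntegrable (by fun_prop) _ _), sub_self, premium_zero, Real.exp_neg]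
  field_simp
  ring

variable {lam x e s r t : ℝ}

lemma exists_isSwitchTime (hlam : 0 < lam) (hlam' : lam < 1 / 14) (hn : 2 ≤ n) (hb : b ≤ -1 / 2) :
    ∃ r, IsSwitchTime lam n b r := by
  have hn2 : (2 : ℝ) ≤ n := by exact_mod_cast hn
  have hpremium : 1 / 12 ≤ premium n b (1 - 1 / 2) := by
    have hexp : 1 ≤ Real.exp (n * (1 - 1 / 2)) - 1 := by
      linarith [Real.add_one_le_exp ((n : ℝ) * (1 - 1 / 2))]
    have hinv : 1 / (n : ℝ) ≤ 1 / 2 := one_div_le_one_div_of_le (by norm_num) hn2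
    have hprod : (1 : ℝ) * (1 / 2) ≤ (Real.exp (n * (1 - 1 / 2)) - 1) * (1 - 1 / (n : ℝ)) :=
      mul_le_mul hexp (by linarith) (by norm_num) (by linarith)
    calc (1 / 12 : ℝ) ≤ 1 / 6 * (1 * (1 / 2) + (1 - 1 / 2)) := by norm_num
      _ ≤ premium n b (1 - 1 / 2) :=
        mul_le_mul (by linarith) (by linarith) (by norm_num) (by linarith)
  have hcont : ContinuousOn (fun r => (1 - lam) * (1 + premium n b (r - 1 / 2))) (Icc (1 / 2) 1) :=
    Continuous.continuousOn (by fun_prop)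
  obtain ⟨r, hr, hr1⟩ := intermediate_value_Ioo (by norm_num : (1 / 2 : ℝ) ≤ 1) hcont
    (show (1 : ℝ) ∈ _ from ⟨by simpa [premium_zero] using hlam, by nlinarith⟩)
  exact ⟨r, hr, hr1⟩

lemma IsSwitchTime.premium_eq (hr : IsSwitchTime lam n b r) :
    premium n b (r - 1 / 2) = lam / (1 - lam) := by
  have hlam : 1 - lam ≠ 0 := left_ne_zero_of_mul_eq_one hr.2
  rw [eq_div_iff hlam]
  linear_combination hr.2

lemma IsSwitchTime.returnTime_mem (hr : IsSwitchTime lam n b r) (x : ℝ) :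
    returnTime r x ∈ Ico (1 / 2 : ℝ) 1 := by
  unfold returnTime
  split_ifs
  exacts [⟨hr.1.1.le, hr.1.2⟩, by norm_num]

lemma tildeM_mid (hn : n ≠ 0) (ht : 1 / 2 < t) (hts : t < s) :
    tildeM lam x e s n b t = (1 - lam) * x * (1 + premium n b (t - 1 / 2)) := by
  rw [tildeM, if_neg ht.not_ge, if_pos hts, tildeA_eq hn]
  ring

lemma tildeM_late (hs : 1 / 2 < s) (hst : s ≤ t) :
    tildeM lam x e s n b t = (1 - lam) * x * (1 + coefA s * (e - 1)) := by
  rw [tildeM, if_neg (hs.trans_le hst).not_ge, if_neg hst.not_gt, ask_late hs.le le_rfl]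
  ring

lemma lt_tildeM_iff (hn : n ≠ 0) (hb : b < 0) (hlam : lam < 1) (hr : IsSwitchTime lam n b r)
    (hx : 0 < x) (ht : 1 / 2 < t) (hts : t < s) : x < tildeM lam x e s n b t ↔ r < t := by
  have hlam' : 0 < 1 - lam := sub_pos.2 hlam
  rw [tildeM_mid hn ht hts, mul_right_comm, lt_mul_iff_one_lt_left hx]
  nth_rewrite 1 [← hr.2]
  rw [mul_lt_mul_iff_right₀ hlam', add_lt_add_iff_left, (strictMono_premium hb).lt_iff_lt,
    sub_lt_sub_iff_right]

lemma tildeSigma_eq (hn : n ≠ 0) (hb : b < 0) (hlam : lam < 1) (hr : IsSwitchTime lam n b r)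
    (hx : 0 < x) (hs : s ∈ Ioc (1 / 2 : ℝ) 1) :
    tildeSigma lam x e s n b = if s ≤ returnTime r x then 1 else returnTime r x := by
  unfold tildeSigma returnTime
  split_ifs with hx1 hsr hs2
  · have hempty : {t | 1 / 2 < t ∧ t < s ∧ x < tildeM lam x e s n b t} = ∅ :=
      eq_empty_of_forall_notMem fun t ⟨ht, hts, hxt⟩ =>
        (((lt_tildeM_iff hn hb hlam hr hx ht hts).1 hxt).trans hts).not_ge hsr
    rw [hempty, empty_union, csInf_singleton]
  · have hIoo : {t | 1 / 2 < t ∧ t < s ∧ x < tildeM lam x e s n b t} = Ioo r s := by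
      ext t
      refine ⟨fun ⟨ht, hts, hxt⟩ => ⟨(lt_tildeM_iff hn hb hlam hr hx ht hts).1 hxt, hts⟩,
        fun ⟨hrt, hts⟩ => ?_⟩
      have ht := hr.1.1.trans hrt
      exact ⟨ht, hts, (lt_tildeM_iff hn hb hlam hr hx ht hts).2 hrt⟩
    rw [hIoo, ((isGLB_Ioo (not_le.1 hsr)).union isGLB_singleton).csInf_eq ⟨1, Or.inr rfl⟩]
    exact min_eq_left hr.1.2.le
  · exact absurd hs.1 hs2.not_gt
  · rfl

end Premium

/-! ### Closed forms of the approximating processes -/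

section ClosedForm

variable {Ω : Type*} [MeasurableSpace Ω] {P : Measure Ω} {ξ η θ : Ω → ℝ} {etaT : ℕ → Ω → ℝ}
  {lam b r x e s t : ℝ} {n : ℕ}

/-- The value of `Z̃ⁿ` after time `1/2` and before the jump at `σ`. -/
noncomputable def tiltDensity (lam : ℝ) (n : ℕ) (x t : ℝ) : ℝ :=
  1 / wealthHalf lam x * Real.exp (-((n : ℝ) - 1) * (t - 1 / 2))

/-- The value of `M̃ⁿ` after time `1/2` and before the jump at `σ`, when `ξ < 1`; after an upward
move of `ξ` the process `M̃ⁿ` is used at time `1/2` only, where it is `ξ`. -/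
noncomputable def tiltPrice (lam : ℝ) (n : ℕ) (b x t : ℝ) : ℝ :=
  if x < 1 then (1 - lam) * x * (1 + premium n b (t - 1 / 2)) else x

/-- The value of `Z^{0,n}` after time `1/2` and before the jump at `σ`. -/
noncomputable def preDensity (lam : ℝ) (n : ℕ) (r x t : ℝ) : ℝ :=
  tiltDensity lam n x (min t (returnTime r x))

/-- The value of `Z^{1,n} / Z^{0,n}` after time `1/2` and before the jump at `σ`. -/
noncomputable def prePrice (lam : ℝ) (n : ℕ) (b r x t : ℝ) : ℝ :=
  tiltPrice lam n b x (min t (returnTime r x))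

/-- The value of `Z^{0,n}` after the jump at `σ`, where `g` is the density `η̃ⁿ` as a function
of `η`. -/
noncomputable def postDensity (P : Measure Ω) (η : Ω → ℝ) (lam : ℝ) (n : ℕ) (g : ℝ → ℝ)
    (r x e s : ℝ) : ℝ :=
  if s ≤ returnTime r x then tiltDensity lam n x s * (n * g e)
  else tiltDensity lam n x (returnTime r x) * jumpDensity P η lam n (clampTime s) e

/-- The value of `Z^{1,n} / Z^{0,n}` after the jump at `σ`. -/
noncomputable def postPrice (lam : ℝ) (n : ℕ) (r x e s : ℝ) : ℝ :=
  if s ≤ returnTime r x then (1 - lam) * x * (1 + coefA s * (e - 1))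
  else (1 - lam) * x * (1 + coefA (clampTime s) * (truncEta n e - 1))

lemma tildeZ_mid {g : ℝ} (ht : 1 / 2 ≤ t) (hts : t < s) :
    tildeZ lam x e s n g t = tiltDensity lam n x t := by
  rw [tildeZ, min_eq_left ht, min_eq_right hts.le, max_eq_left (by linarith), if_neg hts.not_ge,
    dualY0, wealth, if_neg (lt_irrefl _), if_pos rfl, mul_zero, add_zero, mul_one]
  rfl

lemma tildeZ_late {g : ℝ} (hs : 1 / 2 < s) (hst : s ≤ t) :
    tildeZ lam x e s n g t = tiltDensity lam n x s * (n * g) := by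
  rw [tildeZ, min_eq_left (hs.le.trans hst), min_eq_left hst, max_eq_left (by linarith),
    if_pos hst, dualY0, wealth, if_neg (lt_irrefl _), if_pos rfl, mul_one, add_sub_cancel]
  rfl

lemma tiltDensity_half : tiltDensity lam n x (1 / 2) = 1 / wealthHalf lam x := by
  simp [tiltDensity]

lemma preDensity_half (hr : IsSwitchTime lam n b r) :
    preDensity lam n r x (1 / 2) = 1 / wealthHalf lam x := by
  rw [preDensity, min_eq_left (hr.returnTime_mem x).1, tiltDensity_half]

lemma prePrice_half (hr : IsSwitchTime lam n b r) :
    prePrice lam n b r x (1 / 2) = if x < 1 then (1 - lam) * x else x := by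
  rw [prePrice, min_eq_left (hr.returnTime_mem x).1, tiltPrice, sub_self, premium_zero, add_zero,
    mul_one]

lemma tiltPrice_returnTime (hr : IsSwitchTime lam n b r) :
    tiltPrice lam n b x (returnTime r x) = x := by
  unfold tiltPrice returnTime
  split_ifs
  · rw [mul_right_comm, hr.2, one_mul]
  · rfl

lemma postDensity_mul_postPrice {g : ℝ → ℝ} (hr : IsSwitchTime lam n b r) :
    postDensity P η lam n g r x e s * postPrice lam n r x e s =
      if s ≤ returnTime r x
      then tiltDensity lam n x s * (n * g e) * ((1 - lam) * x * (1 + coefA s * (e - 1)))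
      else tiltDensity lam n x (returnTime r x) * tiltPrice lam n b x (returnTime r x) *
        jumpPrice P η lam n (clampTime s) e := by
  rw [postDensity, postPrice, tiltPrice_returnTime hr, jumpPrice]
  split_ifs
  · rfl
  · ring

/-- Both components of `Zⁿ` follow `f` up to the stopping time `σ̃ₙ`, which is `1` or the return
time `ρ`, and are frozen from then on, except for the jump at `σ`. -/
lemma switch_eq_ite {f D : ℝ → ℝ} {L c k y ρ : ℝ} (ht : 1 / 2 < t) (ht1 : t ≤ 1)
    (hmid : ∀ u, 1 / 2 < u → u < s → u ≤ ρ → f u = D u) (hlate : s ≤ t → f t = L)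
    (hfrozen : ρ < s → c * y = D ρ) :
    (if t ≤ (if s ≤ ρ then 1 else ρ) then f t
      else c * (1 + (k - 1) * (if s ≤ t then 1 else 0)) * y) =
      if t < s then D (min t ρ) else if s ≤ ρ then L else D ρ * k := by
  rcases le_or_gt s ρ with hsρ | hsρ
  · rw [if_pos hsρ, if_pos hsρ, if_pos ht1]
    split_ifs with hts
    · rw [min_eq_left (hts.le.trans hsρ), hmid t ht hts (hts.le.trans hsρ)]
    · exact hlate (not_lt.1 hts)
  rw [if_neg hsρ.not_ge, if_neg hsρ.not_ge]
  rcases le_or_gt t ρ with htρ | hρt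
  · rw [if_pos htρ, if_pos (htρ.trans_lt hsρ), min_eq_left htρ, hmid t ht (htρ.trans_lt hsρ) htρ]
  rw [if_neg hρt.not_ge, min_eq_right hρt.le, ← hfrozen hsρ]
  rcases lt_or_ge t s with hts | hst
  · rw [if_neg hts.not_ge, if_pos hts]
    ring
  · rw [if_pos hst, if_neg hst.not_gt]
    ring

variable {g : ℝ → ℝ}

lemma Z0_eq (hn : n ≠ 0) (hb : b < 0) (hbP : ∫ ω', etaT n ω' * (η ω' - 1) ∂P = b)
    (hlam : lam < 1) (hr : IsSwitchTime lam n b r) {ω : Ω} (hg : etaT n ω = g (η ω))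
    (hx : 0 < ξ ω) (hs : 1 / 2 < jumpTime (θ ω)) (t : unitInterval) :
    Z0 P lam ξ η θ etaT n t ω = jumpPath 1 (preDensity lam n r)
      (postDensity P η lam n g r) (ξ ω) (η ω) (jumpTime (θ ω)) t := by
  have hs1 : jumpTime (θ ω) ∈ Ioc (1 / 2 : ℝ) 1 := ⟨hs, jumpTime_le_one _⟩
  rcases lt_trichotomy (t : ℝ) (1 / 2) with ht | ht | ht
  · simp only [Z0, if_pos ht.le, jumpPath_early ht, dualY0, wealth, if_pos ht, div_one]
  · rw [Z0, if_pos ht.le, jumpPath_mid ht.ge (ht ▸ hs), dualY0, wealth, ht,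
      if_neg (lt_irrefl (1 / 2 : ℝ)), if_pos rfl, preDensity_half hr]
  have hswitch := switch_eq_ite (ρ := returnTime r (ξ ω))
    (f := tildeZ lam (ξ ω) (η ω) (jumpTime (θ ω)) n (g (η ω)))
    (k := jumpDensity P η lam n (clampTime (jumpTime (θ ω))) (η ω)) (y := 1)
    (c := tildeZ lam (ξ ω) (η ω) (jumpTime (θ ω)) n (g (η ω))
      (if jumpTime (θ ω) ≤ returnTime r (ξ ω) then 1 else returnTime r (ξ ω)))
    ht t.2.2 (fun u hu hus _ => tildeZ_mid hu.le hus) (tildeZ_late hs) fun hρ => by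
      rw [mul_one, if_neg hρ.not_ge, tildeZ_mid (hr.returnTime_mem _).1 hρ]
  rw [jumpPath, if_neg ht.not_gt, postDensity, preDensity, ← hswitch]
  simp only [Z0, hbP, hg, tildeSigma_eq hn hb hlam hr hx hs1, if_neg ht.not_ge, mul_one,
    clampTime_of_mem ⟨hs.le, hs1.2⟩]
  rfl

lemma tildeM_eq_tiltPrice (hn : n ≠ 0) (ht : 1 / 2 < t) (hts : t < s)
    (htr : t ≤ returnTime r x) : tildeM lam x e s n b t = tiltPrice lam n b x t := by
  have hx : x < 1 := by
    by_contra hx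
    rw [returnTime, if_neg hx] at htr
    exact htr.not_gt ht
  rw [tildeM_mid hn ht hts, tiltPrice, if_pos hx]

lemma Z1_eq (hn : n ≠ 0) (hb : b < 0) (hbP : ∫ ω', etaT n ω' * (η ω' - 1) ∂P = b)
    (hlam : lam < 1) (hr : IsSwitchTime lam n b r) {ω : Ω} (hg : etaT n ω = g (η ω))
    (hx : ξ ω = 3 ∨ ξ ω = 1 / 2) (hs : 1 / 2 < jumpTime (θ ω)) (t : unitInterval) :
    Z1 P lam ξ η θ etaT n t ω = jumpPath 1
      (fun x t => preDensity lam n r x t * prePrice lam n b r x t)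
      (fun x e s => postDensity P η lam n g r x e s * postPrice lam n r x e s)
      (ξ ω) (η ω) (jumpTime (θ ω)) t := by
  have hx0 : 0 < ξ ω := by rcases hx with hx | hx <;> norm_num [hx]
  have hs1 : jumpTime (θ ω) ∈ Ioc (1 / 2 : ℝ) 1 := ⟨hs, jumpTime_le_one _⟩
  rcases lt_trichotomy (t : ℝ) (1 / 2) with ht | ht | ht
  · simp only [Z1, if_pos ht.le, jumpPath_early ht, dualY1, shadow, wealth, if_pos ht, div_one]
  · rw [Z1, if_pos ht.le, jumpPath_mid ht.ge (ht ▸ hs), dualY1, shadow, wealth, ht,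
      if_neg (lt_irrefl (1 / 2 : ℝ)), if_neg (lt_irrefl (1 / 2 : ℝ)), if_pos rfl, if_pos rfl,
      preDensity_half hr, prePrice_half hr]
    rcases hx with hx | hx <;> norm_num [hx] <;> ring
  have hswitch := switch_eq_ite (ρ := returnTime r (ξ ω))
    (f := fun t => tildeZ lam (ξ ω) (η ω) (jumpTime (θ ω)) n (g (η ω)) t *
      tildeM lam (ξ ω) (η ω) (jumpTime (θ ω)) n b t)
    (k := jumpPrice P η lam n (clampTime (jumpTime (θ ω))) (η ω)) (y := ξ ω)
    (c := tildeZ lam (ξ ω) (η ω) (jumpTime (θ ω)) n (g (η ω))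
      (if jumpTime (θ ω) ≤ returnTime r (ξ ω) then 1 else returnTime r (ξ ω)))
    (D := fun t => tiltDensity lam n (ξ ω) t * tiltPrice lam n b (ξ ω) t)
    ht t.2.2 (fun u hu hus hur => by
      rw [tildeZ_mid hu.le hus, tildeM_eq_tiltPrice hn hu hus hur])
    (fun hst => by rw [tildeZ_late hs hst, tildeM_late hs hst]) fun hρ => by
      rw [if_neg hρ.not_ge, tildeZ_mid (hr.returnTime_mem _).1 hρ, tiltPrice_returnTime hr]
  rw [jumpPath, if_neg ht.not_gt, postDensity_mul_postPrice hr, preDensity, prePrice, ← hswitch]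
  simp only [Z1, hbP, hg, tildeSigma_eq hn hb hlam hr hx0 hs1, if_neg ht.not_ge,
    clampTime_of_mem ⟨hs.le, hs1.2⟩]
  rfl

lemma wealthHalf_up (hlam : 0 < lam) : wealthHalf lam 3 = 5 * (5 + lam) / (6 * (1 + lam)) := by
  have hlam' : 1 + lam ≠ 0 := by linarith
  rw [wealthHalf, if_pos (by norm_num), holdHalf]
  field_simp
  ring

lemma wealthHalf_down (hlam : 0 < lam) : wealthHalf lam (1 / 2) = (5 + lam) / 24 := by
  have hlam' : 1 + lam ≠ 0 := by linarith
  rw [wealthHalf, if_neg (by norm_num), holdHalf]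
  field_simp
  ring

lemma wealthHalf_pos (hlam : 0 < lam) (hx : x = 3 ∨ x = 1 / 2) : 0 < wealthHalf lam x := by
  rcases hx with rfl | rfl
  · rw [wealthHalf_up hlam]
    positivity
  · rw [wealthHalf_down hlam]
    positivity

end ClosedForm

/-! ### Martingale property of the approximating processes -/

/-- The jump `F e u` at time `σ = u`, as a function of the value `e` of `η`, is nonnegative and has
mean `M u`. -/
structure HasJumpMean {Ω : Type*} [MeasurableSpace Ω] (P : Measure Ω) (η : Ω → ℝ)
    (F : ℝ → ℝ → ℝ) (M : ℝ → ℝ) : Prop where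
  measurable : Measurable fun z : ℝ × ℝ => F z.1 z.2
  nonneg : ∀ u ∈ Ioc (1 / 2 : ℝ) 1, ∀ᵐ ω ∂P, 0 ≤ F (η ω) u
  integrable : ∀ u ∈ Ioc (1 / 2 : ℝ) 1, Integrable (fun ω => F (η ω) u) P
  integral : ∀ u ∈ Ioc (1 / 2 : ℝ) 1, ∫ ω, F (η ω) u ∂P = M u

section JumpMean

variable {Ω : Type*} [MeasurableSpace Ω] {P : Measure Ω} {ε : ℝ} {ξ η θ : Ω → ℝ}
  {F G H : ℝ → ℝ → ℝ} {M m K : ℝ → ℝ} {κ ρ s : ℝ}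

lemma HasJumpMean.measurable_comp_swap (hF : HasJumpMean P η F M) :
    Measurable fun z : ℝ × ℝ => F z.2 z.1 :=
  hF.measurable.comp measurable_swap

lemma HasJumpMean.ite (hG : HasJumpMean P η G m) (hH : HasJumpMean P η H fun _ => 1)
    (hκ : 0 ≤ κ) : HasJumpMean P η (fun e u => if u ≤ ρ then G e u else κ * H e u)
      (fun u => if u ≤ ρ then m u else κ) where
  measurable := Measurable.ite (measurableSet_le measurable_snd measurable_const) hG.measurable
    (hH.measurable.const_mul κ)
  nonneg u hu := by
    split_ifs
    · exact hG.nonneg u hu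
    · filter_upwards [hH.nonneg u hu] with ω hω using mul_nonneg hκ hω
  integrable u hu := by
    split_ifs
    exacts [hG.integrable u hu, (hH.integrable u hu).const_mul κ]
  integral u hu := by
    split_ifs
    · exact hG.integral u hu
    · rw [integral_const_mul, hH.integral u hu, mul_one]

lemma exists_abs_ite_le (hm : Continuous m) (ρ κ : ℝ) :
    ∃ C, ∀ u ∈ Ioc (1 / 2 : ℝ) 1, |if u ≤ ρ then m u else κ| ≤ C := by
  obtain ⟨C, hC⟩ := (isCompact_Icc (a := (1 / 2 : ℝ)) (b := 1)).exists_bound_of_continuousOn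
    hm.continuousOn
  refine ⟨max C |κ|, fun u hu => ?_⟩
  split_ifs
  exacts [(hC u (Ioc_subset_Icc_self hu)).trans (le_max_left _ _), le_max_right _ _]

/-- The primitive behind this formula: if `K' = K - m`, then `-exp (-(u - 1/2)) K u` has derivative
`exp (-(u - 1/2)) m u`, so jumps of mean `m` compensate the drift of `K`. -/
lemma IsModel.setIntegral_jumpTime_Ioc_of_hasDerivAt (h : IsModel P ε ξ η θ) (hK : Continuous K)
    (hm : Continuous m) (hderiv : ∀ u ∈ Ioo (1 / 2) ρ, HasDerivAt K (K u - m u) u) (hρ : ρ < 1)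
    (hs : 1 / 2 ≤ s) (hsρ : s ≤ ρ) :
    ∫ ω in {ω | s < jumpTime (θ ω) ∧ jumpTime (θ ω) ≤ ρ}, m (jumpTime (θ ω)) ∂P =
      Real.exp (-(s - 1 / 2)) * K s - Real.exp (-(ρ - 1 / 2)) * K ρ := by
  rw [h.setIntegral_jumpTime hs hsρ hρ hm.measurable,
    intervalIntegral.integral_eq_sub_of_hasDerivAt_of_le
      (f := fun u => -(Real.exp (-(u - 1 / 2)) * K u)) hsρ (by fun_prop)
      (fun u hu => ?_) (Continuous.intervalIntegrable (by fun_prop) _ _)]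
  · ring
  · have hexp := ((hasDerivAt_id' u).sub_const (1 / 2)).fun_neg.exp
    refine (hexp.mul (hderiv u ⟨hs.trans_lt hu.1, hu.2⟩)).neg.congr_deriv ?_
    ring

variable [IsProbabilityMeasure P]

namespace IsModel

lemma ae_jumpTime_mem (h : IsModel P ε ξ η θ) : ∀ᵐ ω ∂P, jumpTime (θ ω) ∈ Ioc (1 / 2 : ℝ) 1 := by
  filter_upwards [h.ae_half_lt_jumpTime] with ω hω using ⟨hω, jumpTime_le_one _⟩

lemma map_jumpTime_eta (h : IsModel P ε ξ η θ) :
    P.map (fun ω => (jumpTime (θ ω), η ω)) =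
      (P.map fun ω => jumpTime (θ ω)).prod (P.map η) :=
  (h.indepFun_eta_theta.symm.comp measurable_jumpTime measurable_id).map_prod_eq_prod_map_map
    (measurable_jumpTime.comp h.measurable_theta).aemeasurable h.measurable_eta.aemeasurable

lemma setIntegral_jumpTime_of_hasDerivAt (h : IsModel P ε ξ η θ) (hK : Continuous K)
    (hm : Continuous m) (hderiv : ∀ u ∈ Ioo (1 / 2) ρ, HasDerivAt K (K u - m u) u) (hρ : ρ < 1)
    (hs : 1 / 2 ≤ s) (hs1 : s < 1) :
    ∫ ω in {ω | s < jumpTime (θ ω)},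
      (if jumpTime (θ ω) ≤ ρ then m (jumpTime (θ ω)) else K ρ) ∂P =
      Real.exp (-(s - 1 / 2)) * K (min s ρ) := by
  have hσ : Measurable fun ω => jumpTime (θ ω) := measurable_jumpTime.comp h.measurable_theta
  have hset_le : MeasurableSet {ω | jumpTime (θ ω) ≤ ρ} := measurableSet_le hσ measurable_const
  have hset_lt := measurableSet_lt_jumpTime h.measurable_theta
  have hafter : ∀ u, 1 / 2 ≤ u → ρ ≤ u → u < 1 → ∫ ω in {ω | u < jumpTime (θ ω)},
      (if jumpTime (θ ω) ≤ ρ then m (jumpTime (θ ω)) else K ρ) ∂P =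
      Real.exp (-(u - 1 / 2)) * K ρ := fun u hu hρu hu1 => by
    rw [setIntegral_congr_fun (g := fun _ => K ρ) (hset_lt u)
      fun ω hω => if_neg (hρu.trans_lt hω).not_ge, setIntegral_const,
      h.measureReal_lt_jumpTime hu hu1, smul_eq_mul]
  rcases le_or_gt ρ s with hρs | hsρ
  · rw [hafter s hs hρs hs1, min_eq_right hρs]
  have hint : Integrable (fun ω => if jumpTime (θ ω) ≤ ρ then m (jumpTime (θ ω)) else K ρ) P := by
    obtain ⟨C, hC⟩ := exists_abs_ite_le hm ρ (K ρ)
    refine Integrable.of_bound (Measurable.ite hset_le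
      (hm.measurable.comp hσ) measurable_const).aestronglyMeasurable C ?_
    filter_upwards [h.ae_jumpTime_mem] with ω hω using hC _ hω
  have hset : {ω | s < jumpTime (θ ω)} \ {ω | jumpTime (θ ω) ≤ ρ} = {ω | ρ < jumpTime (θ ω)} := by
    ext ω
    simp only [Set.mem_sdiff, mem_ofPred_eq, not_le, and_iff_right_iff_imp]
    exact hsρ.trans
  have hbefore : ∫ ω in {ω | s < jumpTime (θ ω)} ∩ {ω | jumpTime (θ ω) ≤ ρ},
      (if jumpTime (θ ω) ≤ ρ then m (jumpTime (θ ω)) else K ρ) ∂P =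
      Real.exp (-(s - 1 / 2)) * K s - Real.exp (-(ρ - 1 / 2)) * K ρ :=
    (setIntegral_congr_fun ((hset_lt s).inter hset_le) fun ω hω => if_pos hω.2).trans
      (h.setIntegral_jumpTime_Ioc_of_hasDerivAt hK hm hderiv hρ hs hsρ.le)
  rw [← integral_inter_add_sdiff hset_le hint.integrableOn, hset, hbefore,
    hafter ρ (hs.trans hsρ.le) le_rfl hρ, min_eq_left hsρ.le, sub_add_cancel]

end IsModel

namespace HasJumpMean

lemma integrable_jump (h : IsModel P ε ξ η θ) (hF : HasJumpMean P η F M) {C : ℝ}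
    (hM : ∀ u ∈ Ioc (1 / 2 : ℝ) 1, |M u| ≤ C) :
    Integrable (fun ω => F (η ω) (jumpTime (θ ω))) P := by
  have hσ : Measurable fun ω => jumpTime (θ ω) := measurable_jumpTime.comp h.measurable_theta
  have := Measure.isProbabilityMeasure_map (μ := P) hσ.aemeasurable
  have := Measure.isProbabilityMeasure_map (μ := P) h.measurable_eta.aemeasurable
  suffices Integrable (fun z : ℝ × ℝ => F z.2 z.1)
      ((P.map fun ω => jumpTime (θ ω)).prod (P.map η)) by
    rw [← h.map_jumpTime_eta] at this
    exact this.comp_measurable (hσ.prodMk h.measurable_eta)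
  have hmem : ∀ᵐ u ∂P.map (fun ω => jumpTime (θ ω)), u ∈ Ioc (1 / 2 : ℝ) 1 :=
    (ae_map_iff hσ.aemeasurable measurableSet_Ioc).2 h.ae_jumpTime_mem
  have hsection : ∀ u, AEStronglyMeasurable (fun e => F e u) (P.map η) := fun u =>
    (hF.measurable.comp measurable_prodMk_right).aestronglyMeasurable
  rw [integrable_prod_iff hF.measurable_comp_swap.aestronglyMeasurable]
  constructor
  · filter_upwards [hmem] with u hu
    exact (integrable_map_measure (hsection u) h.measurable_eta.aemeasurable).2 (hF.integrable u hu)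
  · refine Integrable.of_bound
      hF.measurable_comp_swap.norm.stronglyMeasurable.integral_prod_right'.aestronglyMeasurable C ?_
    filter_upwards [hmem] with u hu
    rw [integral_map h.measurable_eta.aemeasurable (hsection u).norm,
      integral_congr_ae ((hF.nonneg u hu).mono fun ω hω => Real.norm_of_nonneg hω),
      hF.integral u hu]
    exact hM u hu

lemma setIntegral_jump (h : IsModel P ε ξ η θ) (hF : HasJumpMean P η F M)
    (hint : Integrable (fun ω => F (η ω) (jumpTime (θ ω))) P) (s : ℝ) :
    ∫ ω in {ω | s < jumpTime (θ ω)}, F (η ω) (jumpTime (θ ω)) ∂P =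
      ∫ ω in {ω | s < jumpTime (θ ω)}, M (jumpTime (θ ω)) ∂P := by
  have hσ : Measurable fun ω => jumpTime (θ ω) := measurable_jumpTime.comp h.measurable_theta
  have hη := h.measurable_eta
  have := Measure.isProbabilityMeasure_map (μ := P) hσ.aemeasurable
  have := Measure.isProbabilityMeasure_map (μ := P) hη.aemeasurable
  have hprod : Integrable (fun z : ℝ × ℝ => F z.2 z.1)
      ((P.map fun ω => jumpTime (θ ω)).prod (P.map η)) := by
    rw [← h.map_jumpTime_eta]
    exact (integrable_map_measure hF.measurable_comp_swap.aestronglyMeasurable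
      (hσ.prodMk hη).aemeasurable).2 hint
  have hset : {ω | s < jumpTime (θ ω)} =
      (fun ω => (jumpTime (θ ω), η ω)) ⁻¹' (Ioi s ×ˢ univ) := by
    ext ω
    simp
  calc ∫ ω in {ω | s < jumpTime (θ ω)}, F (η ω) (jumpTime (θ ω)) ∂P
      = ∫ z in Ioi s ×ˢ univ, F z.2 z.1 ∂(P.map fun ω => (jumpTime (θ ω), η ω)) := by
        rw [hset, setIntegral_map (measurableSet_Ioi.prod MeasurableSet.univ)
          hF.measurable_comp_swap.aestronglyMeasurable (hσ.prodMk hη).aemeasurable]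
    _ = ∫ u in Ioi s, ∫ e, F e u ∂(P.map η) ∂(P.map fun ω => jumpTime (θ ω)) := by
        rw [h.map_jumpTime_eta, setIntegral_prod _ hprod.integrableOn]
        simp_rw [setIntegral_univ]
    _ = ∫ ω in {ω | s < jumpTime (θ ω)}, ∫ e, F e (jumpTime (θ ω)) ∂(P.map η) ∂P :=
        setIntegral_map measurableSet_Ioi
          hF.measurable_comp_swap.stronglyMeasurable.integral_prod_right'.aestronglyMeasurable
          hσ.aemeasurable
    _ = ∫ ω in {ω | s < jumpTime (θ ω)}, M (jumpTime (θ ω)) ∂P := by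
        refine integral_congr_ae (ae_restrict_of_ae ?_)
        filter_upwards [h.ae_jumpTime_mem] with ω hω
        have hsection : AEStronglyMeasurable (fun e => F e (jumpTime (θ ω))) (P.map η) :=
          (hF.measurable.comp measurable_prodMk_right).aestronglyMeasurable
        rw [integral_map hη.aemeasurable hsection, hF.integral _ hω]

lemma integrable_ite_jump (h : IsModel P ε ξ η θ) (hG : HasJumpMean P η G m)
    (hH : HasJumpMean P η H fun _ => 1) (hm : Continuous m) (hκ : 0 ≤ κ) :
    Integrable (fun ω => if jumpTime (θ ω) ≤ ρ then G (η ω) (jumpTime (θ ω))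
      else κ * H (η ω) (jumpTime (θ ω))) P := by
  obtain ⟨C, hC⟩ := exists_abs_ite_le hm ρ κ
  exact (hG.ite hH hκ).integrable_jump h hC

lemma setIntegral_ite_jump (h : IsModel P ε ξ η θ) (hG : HasJumpMean P η G m)
    (hH : HasJumpMean P η H fun _ => 1) (hm : Continuous m) (hK : Continuous K)
    (hderiv : ∀ u ∈ Ioo (1 / 2) ρ, HasDerivAt K (K u - m u) u) (hρ : ρ < 1) (hκ : 0 ≤ K ρ)
    (hs : 1 / 2 ≤ s) (hs1 : s < 1) :
    ∫ ω in {ω | s < jumpTime (θ ω)}, (if jumpTime (θ ω) ≤ ρ then G (η ω) (jumpTime (θ ω))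
      else K ρ * H (η ω) (jumpTime (θ ω))) ∂P = Real.exp (-(s - 1 / 2)) * K (min s ρ) :=
  ((hG.ite hH hκ).setIntegral_jump h (hG.integrable_ite_jump h hH hm hκ) s).trans
    (h.setIntegral_jumpTime_of_hasDerivAt hK hm hderiv hρ hs hs1)

end HasJumpMean

end JumpMean

/-- The function `g` of `η` is a positive density under which `η - 1` has mean `b`, and `n` and `r`
are as required for an approximating price process with drift parameter `b`; the bound `large`
makes that process stay in the bid-ask spread at its first jump. -/
structure IsTiltedDensity {Ω : Type*} [MeasurableSpace Ω] (P : Measure Ω) (η : Ω → ℝ) (lam : ℝ)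
    (n : ℕ) (b r : ℝ) (g : ℝ → ℝ) : Prop where
  measurable : Measurable g
  pos : ∀ ω, 0 < g (η ω)
  mean : ∫ ω, g (η ω) ∂P = 1
  drift : ∫ ω, g (η ω) * (η ω - 1) ∂P = b
  drift_neg : b < 0
  large : 1 ≤ 2 * lam * n
  switch : IsSwitchTime lam n b r

section Tilted

variable {Ω : Type*} [MeasurableSpace Ω] {P : Measure Ω} {ε lam : ℝ} {ξ η θ : Ω → ℝ} {n : ℕ}
  {b r v u : ℝ} {g : ℝ → ℝ}

namespace IsTiltedDensity

lemma ne_zero (hg : IsTiltedDensity P η lam n b r g) : n ≠ 0 := by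
  rintro rfl
  exact absurd hg.large (by norm_num)

lemma integrable (hg : IsTiltedDensity P η lam n b r g) : Integrable (fun ω => g (η ω)) P :=
  .of_integral_ne_zero (hg.mean ▸ one_ne_zero)

lemma integrable_mul_sub_one (hg : IsTiltedDensity P η lam n b r g) :
    Integrable (fun ω => g (η ω) * (η ω - 1)) P :=
  .of_integral_ne_zero (hg.drift ▸ hg.drift_neg.ne)

lemma integrable_mul_jump (hg : IsTiltedDensity P η lam n b r g) (k : ℝ) :
    Integrable (fun ω => g (η ω) * (1 + k * (η ω - 1))) P :=
  (hg.integrable.add (hg.integrable_mul_sub_one.const_mul k)).congr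
    (ae_of_all _ fun ω => by simp only [Pi.add_apply]; ring)

lemma integral_mul_jump (hg : IsTiltedDensity P η lam n b r g) (k : ℝ) :
    ∫ ω, g (η ω) * (1 + k * (η ω - 1)) ∂P = 1 + k * b := by
  rw [← hg.drift, ← integral_const_mul]
  refine Eq.trans ?_ (congrArg (· + ∫ ω, k * (g (η ω) * (η ω - 1)) ∂P) hg.mean)
  rw [← integral_add hg.integrable (hg.integrable_mul_sub_one.const_mul k)]
  exact integral_congr_ae (ae_of_all _ fun ω => by ring)

end IsTiltedDensity

@[fun_prop]
lemma continuous_tiltDensity : Continuous (tiltDensity lam n v) := by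
  unfold tiltDensity
  fun_prop

lemma continuous_tiltPrice : Continuous (tiltPrice lam n b v) := by
  unfold tiltPrice
  split_ifs <;> fun_prop

lemma measurable_wealthHalf : Measurable (wealthHalf lam) := by
  unfold wealthHalf
  exact Measurable.ite measurableSet_Ioi (by fun_prop) (by fun_prop)

lemma measurable_returnTime : Measurable (returnTime r) :=
  Measurable.ite measurableSet_Iio measurable_const measurable_const

lemma measurable_tiltDensity : Measurable fun z : ℝ × ℝ => tiltDensity lam n z.1 z.2 := by
  have hwealth : Measurable (wealthHalf lam) := measurable_wealthHalf
  unfold tiltDensity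
  fun_prop

lemma measurable_tiltPrice : Measurable fun z : ℝ × ℝ => tiltPrice lam n b z.1 z.2 :=
  Measurable.ite (measurableSet_lt measurable_fst measurable_const) (by fun_prop) measurable_fst

lemma measurable_preDensity : Measurable fun z : ℝ × ℝ => preDensity lam n r z.1 z.2 := by
  have hreturn : Measurable (returnTime r) := measurable_returnTime
  have htime : Measurable fun z : ℝ × ℝ => (z.1, min z.2 (returnTime r z.1)) := by fun_prop
  exact (measurable_tiltDensity (lam := lam) (n := n)).comp htime

lemma measurable_prePrice : Measurable fun z : ℝ × ℝ => prePrice lam n b r z.1 z.2 := by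
  have hreturn : Measurable (returnTime r) := measurable_returnTime
  have htime : Measurable fun z : ℝ × ℝ => (z.1, min z.2 (returnTime r z.1)) := by fun_prop
  exact (measurable_tiltPrice (lam := lam) (n := n) (b := b)).comp htime

lemma measurable_postPrice :
    Measurable fun z : ℝ × ℝ × ℝ => postPrice lam n r z.1 z.2.1 z.2.2 := by
  have hreturn : Measurable fun z : ℝ × ℝ × ℝ => returnTime r z.1 :=
    measurable_returnTime.comp measurable_fst
  have hcoefA := continuous_coefA.measurable
  have hclamp := measurable_clampTime
  unfold postPrice truncEta
  exact Measurable.ite (measurableSet_le measurable_snd.snd hreturn) (by fun_prop) (by fun_prop)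

lemma tiltDensity_pos (hlam : 0 < lam) (hv : v = 3 ∨ v = 1 / 2) : 0 < tiltDensity lam n v u :=
  mul_pos (one_div_pos.2 (wealthHalf_pos hlam hv)) (Real.exp_pos _)

lemma tiltDensity_mul_tiltPrice_returnTime_pos (hr : IsSwitchTime lam n b r) (hlam : 0 < lam)
    (hv : v = 3 ∨ v = 1 / 2) :
    0 < tiltDensity lam n v (returnTime r v) * tiltPrice lam n b v (returnTime r v) := by
  rw [tiltPrice_returnTime hr]
  exact mul_pos (tiltDensity_pos hlam hv) (by rcases hv with rfl | rfl <;> norm_num)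

lemma hasDerivAt_tiltDensity :
    HasDerivAt (tiltDensity lam n v) (tiltDensity lam n v u - tiltDensity lam n v u * n) u := by
  have hexp := (((hasDerivAt_id' u).sub_const (1 / 2)).const_mul (-((n : ℝ) - 1))).exp
  refine (hexp.const_mul (1 / wealthHalf lam v)).congr_deriv ?_
  rw [tiltDensity]
  ring

lemma hasDerivAt_tiltDensity_mul_tiltPrice (hn : n ≠ 0) (hu : u ∈ Ioo (1 / 2) (returnTime r v)) :
    HasDerivAt (fun u => tiltDensity lam n v u * tiltPrice lam n b v u)
      (tiltDensity lam n v u * tiltPrice lam n b v u -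
        tiltDensity lam n v u * n * ((1 - lam) * v * (1 + coefA u * b))) u := by
  have hv : v < 1 := by
    by_contra hv
    rw [returnTime, if_neg hv] at hu
    exact hu.1.not_gt hu.2
  have hprice : tiltPrice lam n b v = fun u => (1 - lam) * v * (1 + premium n b (u - 1 / 2)) :=
    funext fun u => if_pos hv
  have hpremium : HasDerivAt (fun u => premium n b (u - 1 / 2)) _ u :=
    (hasDerivAt_premium hn).comp u ((hasDerivAt_id' u).sub_const (1 / 2))
  rw [hprice]
  refine (hasDerivAt_tiltDensity.mul
    ((hpremium.const_add 1).const_mul ((1 - lam) * v))).congr_deriv ?_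
  rw [add_sub_cancel]
  ring

lemma IsTiltedDensity.hasJumpMean_density (hg : IsTiltedDensity P η lam n b r g) (hlam : 0 < lam)
    (hv : v = 3 ∨ v = 1 / 2) :
    HasJumpMean P η (fun e u => tiltDensity lam n v u * (n * g e))
      (fun u => tiltDensity lam n v u * n) where
  measurable := by
    have := hg.measurable
    fun_prop
  nonneg u _ := ae_of_all _ fun ω =>
    mul_nonneg (tiltDensity_pos hlam hv).le (mul_nonneg n.cast_nonneg (hg.pos ω).le)
  integrable u _ := (hg.integrable.const_mul (n : ℝ)).const_mul _
  integral u _ := by rw [integral_const_mul, integral_const_mul, hg.mean, mul_one]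

variable [IsProbabilityMeasure P]

lemma IsTiltedDensity.hasJumpMean_price (hg : IsTiltedDensity P η lam n b r g)
    (h : IsCostlyModel P ε lam ξ η θ) (hv : v = 3 ∨ v = 1 / 2) :
    HasJumpMean P η
      (fun e u => tiltDensity lam n v u * (n * g e) * ((1 - lam) * v * (1 + coefA u * (e - 1))))
      (fun u => tiltDensity lam n v u * n * ((1 - lam) * v * (1 + coefA u * b))) where
  measurable := by
    have := hg.measurable
    have := continuous_coefA.measurable
    fun_prop
  nonneg u hu := by
    filter_upwards [h.ae_eta_mem] with ω hω
    have hcoefA := coefA_mem (Ioc_subset_Icc_self hu)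
    have hjump : 0 ≤ 1 + coefA u * (η ω - 1) := by
      nlinarith [hω.1, hcoefA.1, hcoefA.2]
    have hv0 : 0 < v := by rcases hv with rfl | rfl <;> norm_num
    have hlam : 0 < 1 - lam := sub_pos.2 h.lam_lt_one
    have hdensity := tiltDensity_pos (n := n) (u := u) h.lam_pos hv
    have hpos := hg.pos ω
    positivity
  integrable u _ := by
    refine ((hg.integrable_mul_jump (coefA u)).const_mul
      (tiltDensity lam n v u * n * ((1 - lam) * v))).congr (ae_of_all _ fun ω => ?_)
    ring
  integral u _ := by
    rw [← hg.integral_mul_jump, ← mul_assoc, ← integral_const_mul]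
    exact integral_congr_ae (ae_of_all _ fun ω => by ring)

namespace IsCostlyModel

lemma hasJumpMean_jumpDensity (h : IsCostlyModel P ε lam ξ η θ) (hn : n ≠ 0) :
    HasJumpMean P η (fun e u => jumpDensity P η lam n (clampTime u) e) fun _ => 1 where
  measurable := h.measurable_jumpDensity hn
  nonneg u _ := ae_of_all _ fun _ => (h.jumpDensity_pos hn (clampTime_mem u) _).le
  integrable u _ := h.integrable_jumpDensity hn (clampTime_mem u)
  integral u _ := h.integral_jumpDensity hn (clampTime_mem u)

lemma hasJumpMean_jumpPrice (h : IsCostlyModel P ε lam ξ η θ) (hn : n ≠ 0) :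
    HasJumpMean P η (fun e u => jumpPrice P η lam n (clampTime u) e) fun _ => 1 where
  measurable := h.measurable_jumpPrice hn
  nonneg u _ := ae_of_all _ fun _ => (h.jumpPrice_pos hn (clampTime_mem u) _).le
  integrable u _ := h.integrable_jumpPrice hn (clampTime_mem u)
  integral u _ := h.integral_jumpPrice hn (clampTime_mem u)

lemma measurable_postDensity (h : IsCostlyModel P ε lam ξ η θ) (hn : n ≠ 0) (hg : Measurable g) :
    Measurable fun z : ℝ × ℝ × ℝ => postDensity P η lam n g r z.1 z.2.1 z.2.2 := by
  have hreturn : Measurable fun z : ℝ × ℝ × ℝ => returnTime r z.1 :=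
    measurable_returnTime.comp measurable_fst
  have htilt : Measurable fun z : ℝ × ℝ => tiltDensity lam n z.1 z.2 := measurable_tiltDensity
  have hafter : Measurable fun z : ℝ × ℝ × ℝ => tiltDensity lam n z.1 (returnTime r z.1) :=
    htilt.comp (measurable_fst.prodMk hreturn)
  have hjump : Measurable fun z : ℝ × ℝ × ℝ =>
      jumpDensity P η lam n (clampTime z.2.2) z.2.1 :=
    (h.measurable_jumpDensity hn).comp measurable_snd
  unfold postDensity
  exact Measurable.ite (measurableSet_le measurable_snd.snd hreturn) (by fun_prop) (by fun_prop)

lemma isMartingaleData_density (h : IsCostlyModel P ε lam ξ η θ)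
    (hg : IsTiltedDensity P η lam n b r g) :
    IsMartingaleData P η θ 1 (preDensity lam n r) (postDensity P η lam n g r) where
  measurable_K := measurable_preDensity
  measurable_J := h.measurable_postDensity hg.ne_zero hg.measurable
  continuous v _ := continuous_tiltDensity.comp (continuous_id.min continuous_const)
  integrable v hv := (hg.hasJumpMean_density h.lam_pos hv).integrable_ite_jump h.toIsModel
    (h.hasJumpMean_jumpDensity hg.ne_zero) (by fun_prop) (tiltDensity_pos h.lam_pos hv).le
  integral v hv s hs hs1 := (hg.hasJumpMean_density h.lam_pos hv).setIntegral_ite_jump h.toIsModel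
    (h.hasJumpMean_jumpDensity hg.ne_zero) (by fun_prop) (by fun_prop)
    (fun _ _ => hasDerivAt_tiltDensity) (hg.switch.returnTime_mem v).2
    (tiltDensity_pos h.lam_pos hv).le hs hs1
  mean := by
    rw [preDensity_half hg.switch, preDensity_half hg.switch, wealthHalf_up h.lam_pos,
      wealthHalf_down h.lam_pos]
    have hlam := h.lam_pos
    field_simp
    ring

lemma isMartingaleData_price (h : IsCostlyModel P ε lam ξ η θ)
    (hg : IsTiltedDensity P η lam n b r g) :
    IsMartingaleData P η θ 1 (fun x t => preDensity lam n r x t * prePrice lam n b r x t)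
      (fun x e s => postDensity P η lam n g r x e s * postPrice lam n r x e s) where
  measurable_K := measurable_preDensity.mul measurable_prePrice
  measurable_J := (h.measurable_postDensity hg.ne_zero hg.measurable).mul measurable_postPrice
  continuous v _ := (continuous_tiltDensity.comp (continuous_id.min continuous_const)).mul
    (continuous_tiltPrice.comp (continuous_id.min continuous_const))
  integrable v hv := by
    simp only [postDensity_mul_postPrice hg.switch]
    exact (hg.hasJumpMean_price h hv).integrable_ite_jump h.toIsModel
      (h.hasJumpMean_jumpPrice hg.ne_zero) (by have := continuous_coefA; fun_prop)
      (tiltDensity_mul_tiltPrice_returnTime_pos hg.switch h.lam_pos hv).le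
  integral v hv s hs hs1 := by
    simp only [postDensity_mul_postPrice hg.switch]
    exact (hg.hasJumpMean_price h hv).setIntegral_ite_jump
      (K := fun u => tiltDensity lam n v u * tiltPrice lam n b v u) h.toIsModel
      (h.hasJumpMean_jumpPrice hg.ne_zero) (by have := continuous_coefA; fun_prop)
      (continuous_tiltDensity.mul continuous_tiltPrice)
      (fun u hu => hasDerivAt_tiltDensity_mul_tiltPrice hg.ne_zero hu)
      (hg.switch.returnTime_mem v).2
      (tiltDensity_mul_tiltPrice_returnTime_pos hg.switch h.lam_pos hv).le hs hs1
  mean := by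
    rw [preDensity_half hg.switch, preDensity_half hg.switch, prePrice_half hg.switch,
      prePrice_half hg.switch, wealthHalf_up h.lam_pos, wealthHalf_down h.lam_pos]
    rw [if_neg (by norm_num), if_pos (by norm_num)]
    have hlam := h.lam_pos
    field_simp
    ring

end IsCostlyModel

end Tilted

/-! ### Consistent price systems -/

section ChangeOfMeasure

variable {Ω : Type*} {m : MeasurableSpace Ω} {P : Measure Ω} {lam C : ℝ}

section Martingale

variable {ι : Type*} [Preorder ι] [OrderTop ι] {𝓕 : Filtration ι m} {Z T : ι → Ω → ℝ}

lemma setIntegral_withDensity_eq [IsFiniteMeasure P] (hZ : Martingale Z 𝓕 P)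
    (hpos : ∀ᵐ ω ∂P, 0 ≤ Z ⊤ ω) {X : Ω → ℝ} {i : ι} (hX : StronglyMeasurable[𝓕 i] X)
    (hXC : ∀ᵐ ω ∂P, ‖X ω‖ ≤ C) {A : Set Ω} (hA : MeasurableSet[𝓕 i] A) :
    ∫ ω in A, X ω ∂(P.withDensity fun ω => ENNReal.ofReal (Z ⊤ ω)) =
      ∫ ω in A, Z i ω * X ω ∂P := by
  have hint : Integrable (fun ω => X ω * Z ⊤ ω) P :=
    (hZ.integrable ⊤).bdd_mul (hX.mono (𝓕.le i)).aestronglyMeasurable hXC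
  have hpull : P[fun ω => X ω * Z ⊤ ω | 𝓕 i] =ᵐ[P] fun ω => X ω * (P[Z ⊤ | 𝓕 i]) ω :=
    condExp_mul_of_stronglyMeasurable_left hX hint (hZ.integrable ⊤)
  calc ∫ ω in A, X ω ∂(P.withDensity fun ω => ENNReal.ofReal (Z ⊤ ω))
      = ∫ ω in A, (ENNReal.ofReal (Z ⊤ ω)).toReal • X ω ∂P :=
        setIntegral_withDensity_eq_setIntegral_toReal_smul
          ((hZ.1 ⊤).mono (𝓕.le ⊤)).measurable.ennreal_ofReal
          (ae_of_all _ fun _ => ENNReal.ofReal_lt_top) _ (𝓕.le i A hA)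
    _ = ∫ ω in A, X ω * Z ⊤ ω ∂P := by
        refine integral_congr_ae (ae_restrict_of_ae ?_)
        filter_upwards [hpos] with ω hω
        rw [ENNReal.toReal_ofReal hω, smul_eq_mul, mul_comm]
    _ = ∫ ω in A, (P[fun ω => X ω * Z ⊤ ω | 𝓕 i]) ω ∂P :=
        (setIntegral_condExp (𝓕.le i) hint hA).symm
    _ = ∫ ω in A, Z i ω * X ω ∂P := by
        refine integral_congr_ae (ae_restrict_of_ae ?_)
        filter_upwards [hpull, hZ.2 i ⊤ le_top] with ω hω hZω
        rw [hω, hZω, mul_comm]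

lemma isProbabilityMeasure_withDensity {f : Ω → ℝ} (hf : Integrable f P) (hpos : 0 ≤ᵐ[P] f)
    (hone : ∫ ω, f ω ∂P = 1) :
    IsProbabilityMeasure (P.withDensity fun ω => ENNReal.ofReal (f ω)) where
  measure_univ := by
    rw [withDensity_apply _ MeasurableSet.univ, Measure.restrict_univ,
      ← ofReal_integral_eq_lintegral_ofReal hf hpos, hone, ENNReal.ofReal_one]

lemma martingale_withDensity [IsFiniteMeasure P] (hZ : Martingale Z 𝓕 P)
    (hpos : ∀ᵐ ω ∂P, 0 ≤ Z ⊤ ω) (hZT : Martingale (fun i ω => Z i ω * T i ω) 𝓕 P)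
    (hT : StronglyAdapted 𝓕 T) (hTC : ∀ᵐ ω ∂P, ∀ i, ‖T i ω‖ ≤ C)
    [IsFiniteMeasure (P.withDensity fun ω => ENNReal.ofReal (Z ⊤ ω))] :
    Martingale T 𝓕 (P.withDensity fun ω => ENNReal.ofReal (Z ⊤ ω)) := by
  have hbound : ∀ i, ∀ᵐ ω ∂P, ‖T i ω‖ ≤ C := fun i => hTC.mono fun ω hω => hω i
  refine martingale_of_setIntegral_eq_top hT (fun i => ?_) fun i A hA => ?_
  · exact Integrable.of_bound ((hT i).mono (𝓕.le i)).aestronglyMeasurable C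
      ((withDensity_absolutelyContinuous _ _).ae_le (hbound i))
  · rw [setIntegral_withDensity_eq hZ hpos (hT i) (hbound i) hA,
      setIntegral_withDensity_eq hZ hpos (hT ⊤) (hbound ⊤) (𝓕.mono le_top A hA)]
    exact hZT.setIntegral_eq le_top hA

end Martingale

variable [IsProbabilityMeasure P] {𝓕 : Filtration unitInterval m} {S U V : unitInterval → Ω → ℝ}

lemma IsCadlagMartingale.isDensityProcess (hU : IsCadlagMartingale U 𝓕 P)
    (hpos : ∀ᵐ ω ∂P, 0 ≤ U 1 ω) :
    IsDensityProcess U 𝓕 (P.withDensity fun ω => ENNReal.ofReal (U 1 ω)) P where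
  adapted := hU.1.1
  cadlag := hU.2
  integrable := hU.1.integrable
  density t A hA := by
    rw [measureReal_def, withDensity_apply _ (𝓕.le t A hA),
      ← ofReal_integral_eq_lintegral_ofReal (hU.1.integrable 1).integrableOn
        (ae_restrict_of_ae hpos),
      ENNReal.toReal_ofReal (integral_nonneg_of_ae (ae_restrict_of_ae hpos)),
      hU.1.setIntegral_eq (j := 1) t.2.2 hA]

theorem IsCadlagMartingale.isConsistentPriceSystem (hU : IsCadlagMartingale U 𝓕 P)
    (hV : IsCadlagMartingale V 𝓕 P) (hpos : ∀ᵐ ω ∂P, ∀ t, 0 < U t ω) (hone : ∫ ω, U 1 ω ∂P = 1)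
    (hcadlag : ∀ᵐ ω ∂P, IsCadlagPath fun t => V t ω / U t ω)
    (hbound : ∀ᵐ ω ∂P, ∀ t, ‖V t ω / U t ω‖ ≤ C)
    (hspread : ∀ᵐ ω ∂P, ∀ t, V t ω / U t ω ∈ Icc ((1 - lam) * S t ω) (S t ω)) :
    IsConsistentPriceSystem P 𝓕 lam S U V := by
  have hpos1 : ∀ᵐ ω ∂P, 0 ≤ U 1 ω := hpos.mono fun ω hω => (hω 1).le
  have hmul : ∀ᵐ ω ∂P, ∀ t, V t ω = U t ω * (V t ω / U t ω) :=
    hpos.mono fun ω hω t => (mul_div_cancel₀ _ (hω t).ne').symm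
  have hQ := isProbabilityMeasure_withDensity (hU.1.integrable 1) hpos1 hone
  have hQP : (P.withDensity fun ω => ENNReal.ofReal (U 1 ω)) ≪ P :=
    withDensity_absolutelyContinuous _ _
  have hadapted : StronglyAdapted 𝓕 fun t ω => V t ω / U t ω := fun t =>
    ((hV.1.1 t).measurable.div (hU.1.1 t).measurable).stronglyMeasurable
  have hUT : Martingale (fun t ω => U t ω * (V t ω / U t ω)) 𝓕 P :=
    hV.1.congr (fun t => (hU.1.1 t).mul (hadapted t)) fun t => hmul.mono fun ω hω => hω t
  refine ⟨_, fun t ω => V t ω / U t ω, hQ, hQP, ?_, hU.isDensityProcess hpos1, ?_, hspread, hmul⟩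
  · refine withDensity_absolutelyContinuous' ?_ (hpos.mono fun ω hω => ?_)
    · exact ((hU.1.1 1).mono (𝓕.le 1)).measurable.ennreal_ofReal.aemeasurable
    · exact (ENNReal.ofReal_pos.2 (hω 1)).ne'
  · exact Locally.of_prop ⟨martingale_withDensity (C := C) hU.1 hpos1 hUT hadapted hbound,
      hQP.ae_le hcadlag⟩

end ChangeOfMeasure

section Spread

variable {lam b r x e s t : ℝ} {n : ℕ}

lemma ask_mem (hx : x = 3 ∨ x = 1 / 2) (he : e ∈ Ioc (0 : ℝ) 2) (hs : s ∈ Ioc (1 / 2 : ℝ) 1) :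
    ask x e s t ∈ Icc (0 : ℝ) 4 := by
  have hcoefA := coefA_mem (Ioc_subset_Icc_self hs)
  have hfst : 1 + (x - 1) * (if 1 / 2 ≤ t then (1 : ℝ) else 0) ∈ Icc (0 : ℝ) 3 := by
    rcases hx with rfl | rfl <;> split_ifs <;> norm_num
  have hsnd : 1 + coefA s * (e - 1) * (if s ≤ t then (1 : ℝ) else 0) ∈ Icc (0 : ℝ) (4 / 3) := by
    split_ifs
    · constructor <;> nlinarith [hcoefA.1, hcoefA.2, he.1, he.2]
    · norm_num
  refine ⟨mul_nonneg hfst.1 hsnd.1, (mul_le_mul hfst.2 hsnd.2 hsnd.1 (by norm_num)).trans ?_⟩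
  norm_num

lemma prePrice_mem (hlam : lam ∈ Ioo (0 : ℝ) 1) (hb : b < 0) (hr : IsSwitchTime lam n b r)
    (hx : 0 < x) (ht : 1 / 2 ≤ t) : prePrice lam n b r x t ∈ Icc ((1 - lam) * x) x := by
  have hbid : (1 - lam) * x ≤ x := mul_le_of_le_one_left hx.le (by linarith [hlam.1])
  have hbid0 : 0 ≤ (1 - lam) * x := mul_nonneg (by linarith [hlam.2]) hx.le
  rw [prePrice, tiltPrice]
  split_ifs with hx1
  · rw [returnTime, if_pos hx1]
    have hmono := (strictMono_premium (n := n) hb).monotone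
    have hzero : 0 ≤ premium n b (min t r - 1 / 2) :=
      premium_zero.symm.le.trans (hmono (sub_nonneg.2 (le_min ht hr.1.1.le)))
    have hreturn : premium n b (min t r - 1 / 2) ≤ premium n b (r - 1 / 2) :=
      hmono (sub_le_sub_right (min_le_right t r) _)
    constructor
    · exact le_mul_of_one_le_right hbid0 (by linarith)
    · calc (1 - lam) * x * (1 + premium n b (min t r - 1 / 2))
          ≤ (1 - lam) * x * (1 + premium n b (r - 1 / 2)) := by gcongr
        _ = x := by linear_combination x * hr.2
  · exact ⟨hbid, le_rfl⟩

lemma mul_one_add_coefA_mul_truncEta_le (hlam : lam ∈ Ioo (0 : ℝ) 1) (hn : 1 ≤ 2 * lam * n)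
    (he : e ∈ Ioc (0 : ℝ) 2) (hs : s ∈ Icc (1 / 2 : ℝ) 1) :
    (1 - lam) * (1 + coefA s * (truncEta n e - 1)) ≤ 1 + coefA s * (e - 1) := by
  obtain ⟨hlam0, hlam1⟩ := hlam
  obtain ⟨ha, ha'⟩ := coefA_mem hs
  have hinv : 1 / (n : ℝ) ≤ 2 * lam := by
    rcases n.eq_zero_or_pos with rfl | hn0
    · norm_num at hn
    · rwa [div_le_iff₀ (by exact_mod_cast hn0)]
  have htrunc : truncEta n e ≤ max e (2 * lam) := max_le_max_left e hinv
  calc (1 - lam) * (1 + coefA s * (truncEta n e - 1))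
      ≤ (1 - lam) * (1 + coefA s * (max e (2 * lam) - 1)) := by gcongr
    _ ≤ 1 + coefA s * (e - 1) := by
        have ha0 : 0 < coefA s := by linarith
        have hbid : 0 ≤ lam * (1 / 3 - coefA s) := mul_nonneg hlam0.le (sub_nonneg.2 ha')
        have hprice : 0 < coefA s * e := mul_pos ha0 he.1
        rcases max_cases e (2 * lam) with ⟨h, -⟩ | ⟨h, -⟩ <;> rw [h] <;> nlinarith

lemma postPrice_mem (hlam : lam ∈ Ioo (0 : ℝ) 1) (hn : 1 ≤ 2 * lam * n) (hx : 0 < x)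
    (he : e ∈ Ioc (0 : ℝ) 2) (hs : s ∈ Icc (1 / 2 : ℝ) 1) :
    postPrice lam n r x e s ∈ Icc ((1 - lam) * (x * (1 + coefA s * (e - 1))))
      (x * (1 + coefA s * (e - 1))) := by
  have ha := coefA_mem hs
  have hjump : 0 ≤ 1 + coefA s * (e - 1) := by nlinarith [ha.1, ha.2, he.1]
  rw [postPrice, clampTime_of_mem hs, ← mul_assoc (1 - lam)]
  split_ifs
  · refine ⟨le_rfl, ?_⟩
    rw [mul_assoc]
    exact mul_le_of_le_one_left (mul_nonneg hx.le hjump) (by linarith [hlam.1])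
  constructor
  · have ha0 : 0 ≤ coefA s := by linarith [ha.1]
    have hlam1 : 0 ≤ 1 - lam := by linarith [hlam.2]
    have htrunc : e ≤ truncEta n e := le_max_left _ _
    gcongr
  · rw [mul_right_comm, mul_comm x]
    exact mul_le_mul_of_nonneg_right (mul_one_add_coefA_mul_truncEta_le hlam hn he hs) hx.le

lemma jumpPath_price_mem (hlam : lam ∈ Ioo (0 : ℝ) 1) (hn : 1 ≤ 2 * lam * n) (hb : b < 0)
    (hr : IsSwitchTime lam n b r) (hx : 0 < x) (he : e ∈ Ioc (0 : ℝ) 2)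
    (hs : s ∈ Ioc (1 / 2 : ℝ) 1) :
    jumpPath 1 (prePrice lam n b r) (postPrice lam n r) x e s t ∈
      Icc ((1 - lam) * ask x e s t) (ask x e s t) := by
  rcases lt_or_ge t (1 / 2) with ht | ht
  · have hask : ask x e s t = 1 := by
      rw [ask, if_neg ht.not_ge, if_neg (ht.trans hs.1).not_ge]
      norm_num
    rw [jumpPath_early ht, hask]
    constructor <;> linarith [hlam.1]
  rcases lt_or_ge t s with hts | hts
  · rw [jumpPath_mid ht hts, ask_mid ht hts]
    exact prePrice_mem hlam hb hr hx ht
  · rw [jumpPath_late ht hts, ask_late ht hts]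
    exact postPrice_mem hlam hn hx he (Ioc_subset_Icc_self hs)

end Spread

lemma jumpPath_mul {c d : ℝ} {K L : ℝ → ℝ → ℝ} {J I : ℝ → ℝ → ℝ → ℝ} {x e s t : ℝ} :
    jumpPath (c * d) (fun x t => K x t * L x t) (fun x e s => J x e s * I x e s) x e s t =
      jumpPath c K J x e s t * jumpPath d L I x e s t := by
  unfold jumpPath
  split_ifs <;> rfl

section PriceSystem

variable {Ω : Type*} [MeasurableSpace Ω] {P : Measure Ω} [IsProbabilityMeasure P]
  {ε lam b r : ℝ} {n : ℕ} {ξ η θ : Ω → ℝ} {etaT : ℕ → Ω → ℝ} {g : ℝ → ℝ}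

namespace IsCostlyModel

lemma hasJumpPaths_Z0 (h : IsCostlyModel P ε lam ξ η θ) (hg : IsTiltedDensity P η lam n b r g)
    (heta : ∀ ω, etaT n ω = g (η ω)) :
    HasJumpPaths P ξ η θ 1 (preDensity lam n r) (postDensity P η lam n g r)
      (Z0 P lam ξ η θ etaT n) := by
  filter_upwards [h.ae_xi, h.ae_half_lt_jumpTime] with ω hx hs t
  exact Z0_eq hg.ne_zero hg.drift_neg (by simp only [heta, hg.drift]) h.lam_lt_one hg.switch
    (heta ω) (by rcases hx with hx | hx <;> norm_num [hx]) hs t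

lemma hasJumpPaths_Z1 (h : IsCostlyModel P ε lam ξ η θ) (hg : IsTiltedDensity P η lam n b r g)
    (heta : ∀ ω, etaT n ω = g (η ω)) :
    HasJumpPaths P ξ η θ 1 (fun x t => preDensity lam n r x t * prePrice lam n b r x t)
      (fun x e s => postDensity P η lam n g r x e s * postPrice lam n r x e s)
      (Z1 P lam ξ η θ etaT n) := by
  filter_upwards [h.ae_xi, h.ae_half_lt_jumpTime] with ω hx hs t
  exact Z1_eq hg.ne_zero hg.drift_neg (by simp only [heta, hg.drift]) h.lam_lt_one hg.switch
    (heta ω) hx hs t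

lemma ae_Z0_pos (h : IsCostlyModel P ε lam ξ η θ) (hg : IsTiltedDensity P η lam n b r g)
    (heta : ∀ ω, etaT n ω = g (η ω)) : ∀ᵐ ω ∂P, ∀ t, 0 < Z0 P lam ξ η θ etaT n t ω := by
  filter_upwards [h.hasJumpPaths_Z0 hg heta, h.ae_xi] with ω hω hx t
  have hn : (0 : ℝ) < n := Nat.cast_pos.2 (Nat.pos_of_ne_zero hg.ne_zero)
  rw [hω t, jumpPath, preDensity, postDensity]
  split_ifs
  · exact one_pos
  · exact tiltDensity_pos h.lam_pos hx
  · exact mul_pos (tiltDensity_pos h.lam_pos hx) (mul_pos hn (hg.pos ω))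
  · exact mul_pos (tiltDensity_pos h.lam_pos hx) (h.jumpDensity_pos hg.ne_zero (clampTime_mem _) _)

lemma hasJumpPaths_price (h : IsCostlyModel P ε lam ξ η θ) (hg : IsTiltedDensity P η lam n b r g)
    (heta : ∀ ω, etaT n ω = g (η ω)) :
    HasJumpPaths P ξ η θ 1 (prePrice lam n b r) (postPrice lam n r)
      (fun t ω => Z1 P lam ξ η θ etaT n t ω / Z0 P lam ξ η θ etaT n t ω) := by
  filter_upwards [h.hasJumpPaths_Z0 hg heta, h.hasJumpPaths_Z1 hg heta, h.ae_Z0_pos hg heta]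
    with ω hZ0 hZ1 hpos t
  rw [div_eq_iff (hpos t).ne', hZ0 t, hZ1 t, mul_comm, ← jumpPath_mul, one_mul]

lemma ae_price_mem (h : IsCostlyModel P ε lam ξ η θ) (hg : IsTiltedDensity P η lam n b r g)
    (heta : ∀ ω, etaT n ω = g (η ω)) :
    ∀ᵐ ω ∂P, ∀ t, Z1 P lam ξ η θ etaT n t ω / Z0 P lam ξ η θ etaT n t ω ∈
      Icc ((1 - lam) * askProcess ξ η θ t ω) (askProcess ξ η θ t ω) := by
  filter_upwards [h.hasJumpPaths_price hg heta, h.ae_xi, h.ae_jumpTime_mem, h.ae_eta_mem]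
    with ω hω hx hs he t
  rw [hω t]
  exact jumpPath_price_mem ⟨h.lam_pos, h.lam_lt_one⟩ hg.large hg.drift_neg hg.switch
    (by rcases hx with hx | hx <;> norm_num [hx]) he hs

lemma ae_norm_price_le (h : IsCostlyModel P ε lam ξ η θ) (hg : IsTiltedDensity P η lam n b r g)
    (heta : ∀ ω, etaT n ω = g (η ω)) :
    ∀ᵐ ω ∂P, ∀ t, ‖Z1 P lam ξ η θ etaT n t ω / Z0 P lam ξ η θ etaT n t ω‖ ≤ 4 := by
  filter_upwards [h.ae_price_mem hg heta, h.ae_xi, h.ae_jumpTime_mem, h.ae_eta_mem]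
    with ω hω hx hs he t
  have hask : askProcess ξ η θ t ω ∈ Icc (0 : ℝ) 4 := ask_mem hx he hs
  have hbid : 0 ≤ (1 - lam) * askProcess ξ η θ t ω :=
    mul_nonneg (by linarith [h.lam_lt_one]) hask.1
  rw [Real.norm_of_nonneg (hbid.trans (hω t).1)]
  exact (hω t).2.trans hask.2

theorem isConsistentPriceSystem [P.IsComplete] (h : IsCostlyModel P ε lam ξ η θ)
    (hg : IsTiltedDensity P η lam n b r g) (heta : ∀ ω, etaT n ω = g (η ω)) :
    IsCadlagMartingale (Z0 P lam ξ η θ etaT n) (marketFiltration P h.toIsModel) P ∧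
    IsCadlagMartingale (Z1 P lam ξ η θ etaT n) (marketFiltration P h.toIsModel) P ∧
    IsConsistentPriceSystem P (marketFiltration P h.toIsModel) lam (askProcess ξ η θ)
      (Z0 P lam ξ η θ etaT n) (Z1 P lam ξ η θ etaT n) := by
  have hdata := h.isMartingaleData_density hg
  have hZ0 := (h.hasJumpPaths_Z0 hg heta).isCadlagMartingale h.toIsModel hdata
  have hZ1 := (h.hasJumpPaths_Z1 hg heta).isCadlagMartingale h.toIsModel
    (h.isMartingaleData_price hg)
  refine ⟨hZ0, hZ1, hZ0.isConsistentPriceSystem hZ1 (h.ae_Z0_pos hg heta)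
    ((h.hasJumpPaths_Z0 hg heta).integral_one h.toIsModel hdata) ?_ (h.ae_norm_price_le hg heta)
    (h.ae_price_mem hg heta)⟩
  filter_upwards [h.hasJumpPaths_price hg heta] with ω hω
  rw [funext hω]
  exact isCadlagPath_jumpPath (continuous_tiltPrice.comp (continuous_id.min continuous_const))

end IsCostlyModel

end PriceSystem

/-! ### Closed form of the dual optimiser -/

section Dual

variable {lam x e s t : ℝ}

lemma wealthPlus_eq (hlam : lam < 1) (hx : x = 3 ∨ x = 1 / 2) :
    wealthPlus lam x = wealthHalf lam x * (if 1 < x then 1 else 1 + 3 * lam / (1 - lam)) := by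
  have hlam' : 1 - lam ≠ 0 := (sub_pos.2 hlam).ne'
  unfold wealthPlus
  rcases hx with rfl | rfl
  · rw [if_pos (by norm_num), if_pos (by norm_num)]
    ring
  · rw [if_neg (by norm_num), if_neg (by norm_num), holdPlus, if_neg (by norm_num), coefA]
    field_simp
    ring

lemma wealthPlus_down (hlam : lam < 1) :
    wealthPlus lam (1 / 2) = wealthHalf lam (1 / 2) * ((1 + 2 * lam) / (1 - lam)) := by
  have hlam' : 1 - lam ≠ 0 := (sub_pos.2 hlam).ne'
  rw [wealthPlus_eq hlam (.inr rfl), if_neg (by norm_num)]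
  congr 1
  field_simp
  ring

lemma add_mul_coefA_half : lam + (1 - lam) * coefA (1 / 2) = (1 + 2 * lam) / 3 := by
  unfold coefA
  ring

lemma holdPlus_eq (hlam : lam ∈ Ioo (0 : ℝ) 1) (hx : x = 3 ∨ x = 1 / 2) :
    holdPlus lam x = wealthPlus lam x / x * (1 / (lam + (1 - lam) * coefA (1 / 2))) := by
  have hlam' : 1 - lam ≠ 0 := (sub_pos.2 hlam.2).ne'
  rcases hx with rfl | rfl
  · rw [wealthPlus, holdPlus, if_pos (by norm_num), if_pos (by norm_num), add_zero]
  · have hne : 1 + 2 * lam ≠ 0 := by linarith [hlam.1]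
    rw [wealthPlus_down hlam.2, holdPlus, if_neg (by norm_num),
      add_mul_coefA_half, coefA]
    field_simp
    norm_num [mul_comm]

lemma hold_eq (hlam : lam ∈ Ioo (0 : ℝ) 1) (hx : x = 3 ∨ x = 1 / 2) (hs : s ∈ Ioc (1 / 2 : ℝ) 1) :
    hold lam x s s = wealthPlus lam x / x * (1 / (lam + (1 - lam) * coefA s)) := by
  have hne : ∀ u ∈ uIcc (1 / 2 : ℝ) s, lam + (1 - lam) * coefA u ≠ 0 := by
    intro u hu
    rw [uIcc_of_le hs.1.le] at hu
    have hcoef := mul_coefA_pos hlam.2 ⟨hu.1, hu.2.trans hs.2⟩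
    linarith [hlam.1]
  have hderiv : ∀ u ∈ uIcc (1 / 2 : ℝ) s,
      HasDerivAt (fun u => wealthPlus lam x / x * (1 / (lam + (1 - lam) * coefA u)))
        (wealthPlus lam x / x * ((1 - lam) / (lam + (1 - lam) * coefA u) ^ 2) * (1 / 3)) u := by
    intro u hu
    have hcoef : HasDerivAt coefA (-(1 / 3 * 1)) u :=
      (((hasDerivAt_id u).sub_const _).const_mul _).const_sub _
    simp only [one_div]
    refine ((((hcoef.const_mul (1 - lam)).const_add lam).fun_inv (hne u hu)).const_mul
      (wealthPlus lam x / x)).congr_deriv ?_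
    ring
  have hcont := continuous_coefA
  have hint : ContinuousOn (fun u => wealthPlus lam x / x *
      ((1 - lam) / (lam + (1 - lam) * coefA u) ^ 2) * (1 / 3)) (uIcc (1 / 2) s) :=
    (continuousOn_const.mul (continuousOn_const.div (by fun_prop)
      fun u hu => pow_ne_zero 2 (hne u hu))).mul continuousOn_const
  rw [hold, if_neg (by linarith [hs.1]), if_neg (not_le.2 hs.1), min_self,
    intervalIntegral.integral_eq_sub_of_hasDerivAt hderiv hint.intervalIntegrable,
    holdPlus_eq hlam hx]
  ring

lemma wealth_mid (ht : 1 / 2 < t) (hts : t < s) : wealth lam x e s t = wealthPlus lam x := by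
  rw [wealth, if_neg (not_lt.2 ht.le), if_neg ht.ne', if_pos hts]

lemma wealth_late (hlam : lam ∈ Ioo (0 : ℝ) 1) (hx : x = 3 ∨ x = 1 / 2)
    (hs : s ∈ Ioc (1 / 2 : ℝ) 1) (hst : s ≤ t) : wealth lam x e s t =
      wealthPlus lam x * (1 + 1 / (lam + (1 - lam) * coefA s) * oneReturn lam s e) := by
  have ht := hs.1.trans_le hst
  have hx0 : x ≠ 0 := by rcases hx with rfl | rfl <;> norm_num
  rw [wealth, if_neg (not_lt.2 ht.le), if_neg ht.ne', if_neg (not_lt.2 hst),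
    hold_eq hlam hx hs, ask_late hs.1.le le_rfl, oneReturn]
  field_simp

lemma shadow_mid (ht : 1 / 2 < t) (hts : t < s) : shadow lam x e s t = x := by
  rw [shadow, if_neg (not_lt.2 ht.le), if_neg ht.ne', if_pos hts]

lemma shadow_late (hs : 1 / 2 < s) (hst : s ≤ t) :
    shadow lam x e s t = (1 - lam) * x * (1 + coefA s * (e - 1)) := by
  have ht := hs.trans_le hst
  rw [shadow, if_neg (not_lt.2 ht.le), if_neg ht.ne', if_neg (not_lt.2 hst),
    ask_late hs.le le_rfl, mul_assoc]

lemma dualY1_eq : dualY1 lam x e s t = dualY0 lam x e s t * shadow lam x e s t := by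
  rw [dualY1, dualY0, one_div_mul_eq_div]

end Dual

/-! ### Convergence to the dual optimiser -/

section SwitchTime

variable {lam : ℝ} {b r : ℕ → ℝ}

lemma IsSwitchTime.sub_half_le {n : ℕ} {b r : ℝ} (hr : IsSwitchTime lam n b r) (hn : 2 ≤ n)
    (hb : b ≤ -1 / 2) : r - 1 / 2 ≤ 12 * (lam / (1 - lam)) * (1 / (n : ℝ)) := by
  have hn' : (2 : ℝ) ≤ n := by exact_mod_cast hn
  have hy : 0 < r - 1 / 2 := sub_pos.2 hr.1.1
  have hinv : 1 / (n : ℝ) ≤ 1 / 2 := one_div_le_one_div_of_le two_pos hn'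
  have hexp : (n : ℝ) * (r - 1 / 2) ≤ Real.exp (n * (r - 1 / 2)) - 1 :=
    le_sub_iff_add_le.2 (Real.add_one_le_exp _)
  have hprod : (n : ℝ) * (r - 1 / 2) * (1 / 2) ≤
      (Real.exp (n * (r - 1 / 2)) - 1) * (1 - 1 / (n : ℝ)) :=
    mul_le_mul hexp (by linarith) (by norm_num) (hexp.trans' (by positivity))
  have hpremium : 1 / 6 * ((n : ℝ) * (r - 1 / 2) * (1 / 2)) ≤ premium n b (r - 1 / 2) :=
    mul_le_mul (by linarith) (by linarith) (by positivity) (by linarith)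
  rw [hr.premium_eq] at hpremium
  rw [mul_one_div, le_div_iff₀ (by linarith)]
  linarith

lemma IsSwitchTime.exp_eq {n : ℕ} {b r : ℝ} (hr : IsSwitchTime lam n b r) (hn : 2 ≤ n)
    (hb : b ≠ 0) : Real.exp (n * (r - 1 / 2)) =
      1 + (lam / (1 - lam) / (-b / 3) - (r - 1 / 2)) / (1 - 1 / (n : ℝ)) := by
  have hinv : 1 / (n : ℝ) < 1 :=
    (div_lt_one (by positivity)).2 (by exact_mod_cast hn)
  have hb3 : -b / 3 ≠ 0 := div_ne_zero (neg_ne_zero.2 hb) three_ne_zero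
  rw [← hr.premium_eq, premium, mul_div_cancel_left₀ _ hb3, add_sub_cancel_right,
    mul_div_cancel_right₀ _ (sub_pos.2 hinv).ne', add_sub_cancel]

lemma eventually_le_neg_half (hb : Tendsto b atTop (𝓝 (-1))) : ∀ᶠ n in atTop, b n ≤ -1 / 2 :=
  hb.eventually_le_const (by norm_num)

lemma tendsto_switchTime (hb : Tendsto b atTop (𝓝 (-1)))
    (hr : ∀ᶠ n in atTop, IsSwitchTime lam n (b n) (r n)) : Tendsto r atTop (𝓝 (1 / 2)) := by
  have hbound : Tendsto (fun n : ℕ => 12 * (lam / (1 - lam)) * (1 / (n : ℝ))) atTop (𝓝 0) := by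
    simpa only [mul_zero] using
      (tendsto_one_div_atTop_nhds_zero_nat (𝕜 := ℝ)).const_mul (12 * (lam / (1 - lam)))
  refine tendsto_sub_nhds_zero_iff.1 (squeeze_zero' ?_ ?_ hbound)
  · filter_upwards [hr] with n hn using sub_nonneg.2 hn.1.1.le
  · filter_upwards [hr, eventually_le_neg_half hb, eventually_ge_atTop 2] with n hn hbn hn2
      using hn.sub_half_le hn2 hbn

lemma tendsto_exp_switchTime (hlam : lam ∈ Ioo (0 : ℝ) 1) (hb : Tendsto b atTop (𝓝 (-1)))
    (hr : ∀ᶠ n in atTop, IsSwitchTime lam n (b n) (r n)) :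
    Tendsto (fun n : ℕ => Real.exp (-((n : ℝ) - 1) * (r n - 1 / 2))) atTop
      (𝓝 (1 / (1 + 3 * lam / (1 - lam)))) := by
  have hr0 : Tendsto (fun n => r n - 1 / 2) atTop (𝓝 0) :=
    tendsto_sub_nhds_zero_iff.2 (tendsto_switchTime hb hr)
  have hgrowth : Tendsto (fun n : ℕ => Real.exp (n * (r n - 1 / 2))) atTop
      (𝓝 (1 + 3 * lam / (1 - lam))) := by
    have hdrift : Tendsto (fun n => lam / (1 - lam) / (-b n / 3)) atTop
        (𝓝 (lam / (1 - lam) / (- -1 / 3))) :=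
      tendsto_const_nhds.div (hb.neg.div_const 3) (by norm_num)
    have hlim := ((hdrift.sub hr0).div
      ((tendsto_one_div_atTop_nhds_zero_nat (𝕜 := ℝ)).const_sub 1) (by norm_num)).const_add 1
    have hvalue : 1 + (lam / (1 - lam) / (- -1 / 3) - 0) / (1 - 0) = 1 + 3 * lam / (1 - lam) := by
      ring
    rw [hvalue] at hlim
    refine hlim.congr' ?_
    filter_upwards [hr, eventually_le_neg_half hb, eventually_ge_atTop 2] with n hn hbn hn2
    exact (hn.exp_eq hn2 (by linarith)).symm
  have hpos : 0 < 1 + 3 * lam / (1 - lam) := by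
    have := sub_pos.2 hlam.2
    have := hlam.1
    positivity
  have hquot := ((Real.continuous_exp.tendsto 0).comp hr0).div hgrowth hpos.ne'
  rw [Real.exp_zero] at hquot
  refine hquot.congr fun n => ?_
  simp only [Pi.div_apply, Function.comp_apply]
  rw [← Real.exp_sub]
  ring_nf

lemma tendsto_returnTime (hb : Tendsto b atTop (𝓝 (-1)))
    (hr : ∀ᶠ n in atTop, IsSwitchTime lam n (b n) (r n)) (x : ℝ) :
    Tendsto (fun n => returnTime (r n) x) atTop (𝓝 (1 / 2)) := by
  unfold returnTime
  split_ifs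
  · exact tendsto_switchTime hb hr
  · exact tendsto_const_nhds

lemma tendsto_tiltDensity_returnTime (hlam : lam ∈ Ioo (0 : ℝ) 1) (hb : Tendsto b atTop (𝓝 (-1)))
    (hr : ∀ᶠ n in atTop, IsSwitchTime lam n (b n) (r n)) {x : ℝ} (hx : x = 3 ∨ x = 1 / 2) :
    Tendsto (fun n : ℕ => tiltDensity lam n x (returnTime (r n) x)) atTop
      (𝓝 (1 / wealthPlus lam x)) := by
  rw [wealthPlus_eq hlam.2 hx, ← one_div_mul_one_div]
  refine Tendsto.const_mul _ ?_
  unfold returnTime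
  rcases hx with rfl | rfl
  · simp only [show ¬ ((3 : ℝ) < 1) by norm_num, show (1 : ℝ) < 3 by norm_num, if_true, if_false,
      sub_self, mul_zero, Real.exp_zero, div_one]
    exact tendsto_const_nhds
  · simp only [show (1 : ℝ) / 2 < 1 by norm_num, show ¬ ((1 : ℝ) < 1 / 2) by norm_num, if_true,
      if_false]
    exact tendsto_exp_switchTime hlam hb hr

end SwitchTime

section Convergence

variable {Ω : Type*} [MeasurableSpace Ω] {P : Measure Ω} {ε lam : ℝ} {ξ η θ : Ω → ℝ}
  {b r : ℕ → ℝ} {g : ℕ → ℝ → ℝ} {x e s : ℝ}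

lemma tendsto_jumpPath_price (hb : Tendsto b atTop (𝓝 (-1)))
    (hr : ∀ᶠ n in atTop, IsSwitchTime lam n (b n) (r n)) (hx : x = 3 ∨ x = 1 / 2) (he : 0 < e)
    (hs : s ∈ Ioc (1 / 2 : ℝ) 1) (t : ℝ) :
    Tendsto (fun n => jumpPath 1 (prePrice lam n (b n) (r n)) (postPrice lam n (r n)) x e s t)
      atTop (𝓝 (shadow lam x e s t)) := by
  have hreturn := tendsto_returnTime hb hr x
  rcases lt_trichotomy t (1 / 2) with ht | rfl | ht
  · simp only [jumpPath_early ht, shadow, if_pos ht, tendsto_const_nhds]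
  · simp only [jumpPath_mid le_rfl hs.1, shadow, lt_irrefl, if_false, if_true]
    refine tendsto_const_nhds.congr' ?_
    filter_upwards [hr] with n hn
    rw [prePrice_half hn]
    rcases hx with rfl | rfl <;> norm_num
  rcases lt_or_ge t s with hts | hst
  · simp only [jumpPath_mid ht.le hts, shadow_mid ht hts]
    refine tendsto_const_nhds.congr' ?_
    filter_upwards [hreturn.eventually_lt_const ht, hr] with n hn hrn
    rw [prePrice, min_eq_right hn.le, tiltPrice_returnTime hrn]
  · simp only [jumpPath_late ht.le hst, shadow_late hs.1 hst]
    refine tendsto_const_nhds.congr' ?_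
    filter_upwards [hreturn.eventually_lt_const hs.1, eventually_truncEta_eq he] with n hn hen
    rw [postPrice, if_neg (not_le.2 hn), clampTime_of_mem ⟨hs.1.le, hs.2⟩, hen]

lemma measurable_jumpPath_comp {c : ℝ} {K : ℝ → ℝ → ℝ} {J : ℝ → ℝ → ℝ → ℝ}
    (hK : Measurable fun z : ℝ × ℝ => K z.1 z.2)
    (hJ : Measurable fun z : ℝ × ℝ × ℝ => J z.1 z.2.1 z.2.2) {x e s t : Ω → ℝ}
    (hx : Measurable x) (he : Measurable e) (hs : Measurable s) (ht : Measurable t) :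
    Measurable fun ω => jumpPath c K J (x ω) (e ω) (s ω) (t ω) :=
  Measurable.ite (measurableSet_lt ht measurable_const) measurable_const
    (Measurable.ite (measurableSet_lt ht hs) (hK.comp (hx.prodMk ht))
      (hJ.comp (hx.prodMk (he.prodMk hs))))

lemma HasJumpPaths.aestronglyMeasurable_comp (h : IsModel P ε ξ η θ) {c₀ : ℝ} {K : ℝ → ℝ → ℝ}
    {J : ℝ → ℝ → ℝ → ℝ} {X : unitInterval → Ω → ℝ} (hX : HasJumpPaths P ξ η θ c₀ K J X)
    (hd : IsMartingaleData P η θ c₀ K J) {τ : Ω → unitInterval} (hτ : Measurable τ) :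
    AEStronglyMeasurable (fun ω => X (τ ω) ω) P := by
  refine ((measurable_jumpPath_comp (c := c₀) hd.measurable_K hd.measurable_J h.measurable_xi
    h.measurable_eta (measurable_jumpTime.comp h.measurable_theta)
    (measurable_subtype_coe.comp hτ)).aestronglyMeasurable (μ := P)).congr ?_
  filter_upwards [hX] with ω hω using (hω _).symm

lemma ae_eventually_of_eventually_ae {p : ℕ → Ω → Prop}
    (hp : ∀ᶠ n in atTop, ∀ᵐ ω ∂P, p n ω) : ∀ᵐ ω ∂P, ∀ᶠ n in atTop, p n ω := by
  obtain ⟨N, hN⟩ := eventually_atTop.1 hp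
  filter_upwards [ae_all_iff.2 fun n => hN (n + N) (Nat.le_add_left N n)] with ω hω
  filter_upwards [eventually_ge_atTop N] with n hn
  simpa only [Nat.sub_add_cancel hn] using hω (n - N)

lemma tendstoInMeasure_of_eventually_aestronglyMeasurable [IsFiniteMeasure P] {E : Type*}
    [PseudoEMetricSpace E] {f : ℕ → Ω → E} {f₀ : Ω → E}
    (hf : ∀ᶠ n in atTop, AEStronglyMeasurable (f n) P)
    (hlim : ∀ᵐ ω ∂P, Tendsto (fun n => f n ω) atTop (𝓝 (f₀ ω))) :
    TendstoInMeasure P f atTop f₀ := by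
  obtain ⟨N, hN⟩ := eventually_atTop.1 hf
  have hshift : TendstoInMeasure P (fun n => f (n + N)) atTop f₀ :=
    tendstoInMeasure_of_tendsto_ae (fun n => hN (n + N) (Nat.le_add_left N n)) <| by
      filter_upwards [hlim] with ω hω using hω.comp (tendsto_add_atTop_nat N)
  exact fun δ hδ => (tendsto_add_atTop_iff_nat N).1 (hshift δ hδ)

namespace IsCostlyModel

variable {etaT : ℕ → Ω → ℝ}

lemma exists_isTiltedDensity (h : IsCostlyModel P ε lam ξ η θ) (hpos : ∀ n ω, 0 < etaT n ω)
    (hmeas : ∀ n, Measurable[MeasurableSpace.comap η inferInstance] (etaT n))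
    (hmean : ∀ n, ∫ ω, etaT n ω ∂P = 1)
    (hb : Tendsto (fun n => ∫ ω, etaT n ω * (η ω - 1) ∂P) atTop (𝓝 (-1))) :
    ∃ (r : ℕ → ℝ) (g : ℕ → ℝ → ℝ), (∀ n ω, etaT n ω = g n (η ω)) ∧
      ∀ᶠ n in atTop, IsTiltedDensity P η lam n (∫ ω, etaT n ω * (η ω - 1) ∂P) (r n) (g n) := by
  choose g hgmeas hgeq using fun n => (hmeas n).exists_eq_measurable_comp
  have heta : ∀ n ω, etaT n ω = g n (η ω) := fun n ω => congrFun (hgeq n) ω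
  have hlarge : Tendsto (fun n : ℕ => 2 * lam * (n : ℝ)) atTop atTop :=
    tendsto_natCast_atTop_atTop.const_mul_atTop (by linarith [h.lam_pos])
  refine ⟨fun n => Classical.epsilon (IsSwitchTime lam n (∫ ω, etaT n ω * (η ω - 1) ∂P)), g,
    heta, ?_⟩
  filter_upwards [eventually_ge_atTop 2, hlarge.eventually_ge_atTop 1,
    eventually_le_neg_half hb] with n hn2 hn hbn
  exact
    { measurable := hgmeas n
      pos := fun ω => heta n ω ▸ hpos n ω
      mean := by simp only [← heta, hmean]
      drift := by simp only [← heta]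
      drift_neg := hbn.trans_lt (by norm_num)
      large := hn
      switch := Classical.epsilon_spec (exists_isSwitchTime h.lam_pos h.lam_lt hn2 hbn) }

variable [IsProbabilityMeasure P]

lemma tendsto_jumpPath_density (h : IsCostlyModel P ε lam ξ η θ) (hb : Tendsto b atTop (𝓝 (-1)))
    (hr : ∀ᶠ n in atTop, IsSwitchTime lam n (b n) (r n)) (hx : x = 3 ∨ x = 1 / 2) (he : 0 < e)
    (hs : s ∈ Ioc (1 / 2 : ℝ) 1) (t : ℝ) :
    Tendsto (fun n => jumpPath 1 (preDensity lam n (r n)) (postDensity P η lam n (g n) (r n))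
      x e s t) atTop (𝓝 (dualY0 lam x e s t)) := by
  have hlam : lam ∈ Ioo (0 : ℝ) 1 := ⟨h.lam_pos, h.lam_lt_one⟩
  have hreturn := tendsto_returnTime hb hr x
  have hdensity := tendsto_tiltDensity_returnTime hlam hb hr hx
  rcases lt_trichotomy t (1 / 2) with ht | rfl | ht
  · simp only [jumpPath_early ht, dualY0, wealth, if_pos ht, div_one, tendsto_const_nhds]
  · simp only [jumpPath_mid le_rfl hs.1, dualY0, wealth, lt_irrefl, if_false, if_true]
    refine tendsto_const_nhds.congr' ?_
    filter_upwards [hr] with n hn using (preDensity_half hn).symm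
  rcases lt_or_ge t s with hts | hst
  · simp only [jumpPath_mid ht.le hts, dualY0, wealth_mid ht hts]
    refine hdensity.congr' ?_
    filter_upwards [hreturn.eventually_lt_const ht] with n hn
    rw [preDensity, min_eq_right hn.le]
  · simp only [jumpPath_late ht.le hst, dualY0, wealth_late hlam hx hs hst]
    rw [← one_div_mul_one_div]
    refine (hdensity.mul (h.tendsto_jumpDensity ⟨hs.1.le, hs.2⟩ he)).congr' ?_
    filter_upwards [hreturn.eventually_lt_const hs.1] with n hn
    rw [postDensity, if_neg (not_le.2 hn), clampTime_of_mem ⟨hs.1.le, hs.2⟩]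

lemma ae_tendsto_Z (h : IsCostlyModel P ε lam ξ η θ) (hb : Tendsto b atTop (𝓝 (-1)))
    (heta : ∀ n ω, etaT n ω = g n (η ω))
    (hg : ∀ᶠ n in atTop, IsTiltedDensity P η lam n (b n) (r n) (g n)) :
    ∀ᵐ ω ∂P, ∀ t : unitInterval, Tendsto
      (fun n => (Z0 P lam ξ η θ etaT n t ω, Z1 P lam ξ η θ etaT n t ω)) atTop
      (𝓝 (Y0 lam ξ η θ t ω, Y1 lam ξ η θ t ω)) := by
  have hr : ∀ᶠ n in atTop, IsSwitchTime lam n (b n) (r n) := hg.mono fun n hn => hn.switch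
  filter_upwards [h.ae_xi, h.ae_jumpTime_mem, h.ae_eta_mem,
    ae_eventually_of_eventually_ae (hg.mono fun n hn => h.hasJumpPaths_Z0 hn (heta n)),
    ae_eventually_of_eventually_ae (hg.mono fun n hn => h.hasJumpPaths_Z1 hn (heta n))]
    with ω hx hs he hZ0 hZ1 t
  have hdensity := h.tendsto_jumpPath_density (g := g) hb hr hx he.1 hs t
  refine (hdensity.congr' ?_).prodMk_nhds ?_
  · filter_upwards [hZ0] with n hn using (hn t).symm
  · rw [Y1, dualY1_eq]
    refine (hdensity.mul (tendsto_jumpPath_price hb hr hx he.1 hs t)).congr' ?_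
    filter_upwards [hZ1] with n hn
    rw [hn t, ← jumpPath_mul, one_mul]

theorem tendstoInMeasure_Z (h : IsCostlyModel P ε lam ξ η θ) (hb : Tendsto b atTop (𝓝 (-1)))
    (heta : ∀ n ω, etaT n ω = g n (η ω))
    (hg : ∀ᶠ n in atTop, IsTiltedDensity P η lam n (b n) (r n) (g n)) {τ : Ω → unitInterval}
    (hτ : Measurable τ) :
    TendstoInMeasure P
      (fun n ω => (Z0 P lam ξ η θ etaT n (τ ω) ω, Z1 P lam ξ η θ etaT n (τ ω) ω)) atTop
      (fun ω => (Y0 lam ξ η θ (τ ω) ω, Y1 lam ξ η θ (τ ω) ω)) := by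
  refine tendstoInMeasure_of_eventually_aestronglyMeasurable ?_ ?_
  · filter_upwards [hg] with n hn
    exact ((h.hasJumpPaths_Z0 hn (heta n)).aestronglyMeasurable_comp h.toIsModel
      (h.isMartingaleData_density hn) hτ).prodMk
      ((h.hasJumpPaths_Z1 hn (heta n)).aestronglyMeasurable_comp h.toIsModel
        (h.isMartingaleData_price hn) hτ)
  · filter_upwards [h.ae_tendsto_Z hb heta hg] with ω hω using hω (τ ω)

end IsCostlyModel

end Convergence

lemma measurable_of_isStoppingTime {Ω : Type*} {m : MeasurableSpace Ω}
    {𝓕 : Filtration unitInterval m} {τ : Ω → unitInterval}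
    (hτ : IsStoppingTime 𝓕 fun ω => (τ ω : WithTop unitInterval)) : Measurable τ := by
  refine measurable_of_Iic fun t => ?_
  have hle : MeasurableSet {ω | τ ω ≤ t} := by
    simpa only [WithTop.coe_le_coe] using 𝓕.le t _ (hτ t)
  exact hle

/-! ### Right jumps of the dual optimiser -/

section LadlagPath

variable {f g : unitInterval → ℝ}

lemma IsCadlagPath.tendsto_nhdsGT (hf : IsCadlagPath f) (t : unitInterval) :
    Tendsto f (𝓝[>] t) (𝓝 (f t)) :=
  (hf t).1.mono Ioi_subset_Ici_self

lemma IsCadlagPath.isLadlagPath (hf : IsCadlagPath f) : IsLadlagPath f :=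
  fun t => ⟨(hf t).2, f t, hf.tendsto_nhdsGT t⟩

lemma IsLadlagPath.congr_of_ne (hf : IsLadlagPath f) {t₀ : unitInterval}
    (hfg : ∀ t ≠ t₀, f t = g t) : IsLadlagPath g := by
  intro t
  have heq : f =ᶠ[𝓝[≠] t] g := by
    rcases eq_or_ne t t₀ with rfl | ht
    · filter_upwards [self_mem_nhdsWithin] with u hu using hfg u hu
    · filter_upwards [nhdsWithin_le_nhds (isOpen_ne.mem_nhds ht)] with u hu using hfg u hu
  obtain ⟨⟨l, hl⟩, r, hr⟩ := hf t
  exact ⟨⟨l, hl.congr' (heq.filter_mono (nhdsLT_le_nhdsNE t))⟩,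
    r, hr.congr' (heq.filter_mono (nhdsGT_le_nhdsNE t))⟩

variable {F : ℝ → ℝ} {c₀ : ℝ} {K : ℝ → ℝ → ℝ} {J : ℝ → ℝ → ℝ → ℝ} {x e s : ℝ}

lemma isLadlagPath_of_eq_jumpPath (hK : Continuous (K x))
    (hF : ∀ t ≠ 1 / 2, F t = jumpPath c₀ K J x e s t) : IsLadlagPath fun t => F t :=
  (isCadlagPath_jumpPath hK).isLadlagPath.congr_of_ne (t₀ := halfTime) fun t ht =>
    (hF t fun h => ht (Subtype.ext h)).symm

lemma tendsto_halfTime_of_eq_jumpPath (hK : Continuous (K x)) (hs : 1 / 2 < s)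
    (hF : ∀ t ≠ 1 / 2, F t = jumpPath c₀ K J x e s t) :
    Tendsto (fun t : unitInterval => F t) (𝓝[>] halfTime) (𝓝 (K x (1 / 2))) := by
  have hlim : Tendsto (fun t : unitInterval => jumpPath c₀ K J x e s t) (𝓝[>] halfTime)
      (𝓝 (jumpPath c₀ K J x e s (1 / 2))) := (isCadlagPath_jumpPath hK).tendsto_nhdsGT halfTime
  rw [jumpPath_mid le_rfl hs] at hlim
  refine hlim.congr' ?_
  filter_upwards [self_mem_nhdsWithin] with t ht
  exact (hF t (show (1 / 2 : ℝ) < t from ht).ne').symm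

end LadlagPath

section RightJump

variable {lam x e s t : ℝ}

lemma dualY0_eq_jumpPath (ht : t ≠ 1 / 2) : dualY0 lam x e s t =
    jumpPath 1 (fun x _ => 1 / wealthPlus lam x)
      (fun x e s => 1 / (wealthPlus lam x + hold lam x s s * ((1 - lam) * ask x e s s - x)))
      x e s t := by
  unfold dualY0 wealth jumpPath
  split_ifs <;> simp

lemma dualY1_eq_jumpPath (ht : t ≠ 1 / 2) : dualY1 lam x e s t =
    jumpPath 1 (fun x _ => x / wealthPlus lam x) (fun x e s => (1 - lam) * ask x e s s /
      (wealthPlus lam x + hold lam x s s * ((1 - lam) * ask x e s s - x))) x e s t := by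
  unfold dualY1 shadow wealth jumpPath
  split_ifs <;> simp

lemma isLadlagPath_dualY0 : IsLadlagPath fun t => dualY0 lam x e s t :=
  isLadlagPath_of_eq_jumpPath continuous_const fun _ => dualY0_eq_jumpPath

lemma isLadlagPath_dualY1 : IsLadlagPath fun t => dualY1 lam x e s t :=
  isLadlagPath_of_eq_jumpPath continuous_const fun _ => dualY1_eq_jumpPath

lemma tendsto_dualY0_halfTime (hs : 1 / 2 < s) :
    Tendsto (fun t : unitInterval => dualY0 lam x e s t) (𝓝[>] halfTime)
      (𝓝 (1 / wealthPlus lam x)) :=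
  tendsto_halfTime_of_eq_jumpPath (K := fun x _ => 1 / wealthPlus lam x) continuous_const hs
    fun _ => dualY0_eq_jumpPath

lemma tendsto_dualY1_halfTime (hs : 1 / 2 < s) :
    Tendsto (fun t : unitInterval => dualY1 lam x e s t) (𝓝[>] halfTime)
      (𝓝 (x / wealthPlus lam x)) :=
  tendsto_halfTime_of_eq_jumpPath (K := fun x _ => x / wealthPlus lam x) continuous_const hs
    fun _ => dualY1_eq_jumpPath

lemma dualY0_halfTime : dualY0 lam x e s halfTime = 1 / wealthHalf lam x := by
  simp [dualY0, wealth, halfTime]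

lemma dualY1_halfTime_down :
    dualY1 lam (1 / 2) e s halfTime = (1 - lam) * (1 / 2) / wealthHalf lam (1 / 2) := by
  norm_num [dualY1, wealth, shadow, halfTime]

lemma dualY0_rightJump_eq (hlam : lam ∈ Ioo (0 : ℝ) 1) :
    1 / wealthPlus lam (1 / 2) - dualY0 lam (1 / 2) e s halfTime =
      dualY0 lam (1 / 2) e s halfTime * (-lam / (lam + (1 - lam) * coefA (1 / 2))) := by
  have hwealth := wealthHalf_pos hlam.1 (.inr rfl : (1 / 2 : ℝ) = 3 ∨ (1 / 2 : ℝ) = 1 / 2)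
  have hmid : 0 < 1 + 2 * lam := by linarith [hlam.1]
  rw [dualY0_halfTime, wealthPlus_down hlam.2, add_mul_coefA_half]
  field_simp
  ring

lemma dualY1_rightJump_eq (hlam : lam ∈ Ioo (0 : ℝ) 1) :
    1 / 2 / wealthPlus lam (1 / 2) - dualY1 lam (1 / 2) e s halfTime =
      dualY1 lam (1 / 2) e s halfTime *
        (-lam * (1 - coefA (1 / 2)) / (lam + (1 - lam) * coefA (1 / 2))) := by
  have hwealth := wealthHalf_pos hlam.1 (.inr rfl : (1 / 2 : ℝ) = 3 ∨ (1 / 2 : ℝ) = 1 / 2)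
  have hmid : 0 < 1 + 2 * lam := by linarith [hlam.1]
  rw [dualY1_halfTime_down, wealthPlus_down hlam.2, add_mul_coefA_half, coefA]
  field_simp
  ring

theorem rightJump_dual (hlam : lam ∈ Ioo (0 : ℝ) 1) (hs : 1 / 2 < s) :
    ∃ y₀ y₁ : ℝ,
      Tendsto (fun t : unitInterval => dualY0 lam (1 / 2) e s t) (𝓝[>] halfTime) (𝓝 y₀) ∧
      Tendsto (fun t : unitInterval => dualY1 lam (1 / 2) e s t) (𝓝[>] halfTime) (𝓝 y₁) ∧
      y₀ < dualY0 lam (1 / 2) e s halfTime ∧ y₁ < dualY1 lam (1 / 2) e s halfTime ∧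
      y₀ - dualY0 lam (1 / 2) e s halfTime = dualY0 lam (1 / 2) e s halfTime *
        (-lam / (lam + (1 - lam) * coefA (1 / 2))) ∧
      y₁ - dualY1 lam (1 / 2) e s halfTime = dualY1 lam (1 / 2) e s halfTime *
        (-lam * (1 - coefA (1 / 2)) / (lam + (1 - lam) * coefA (1 / 2))) := by
  have hwealth := wealthHalf_pos hlam.1 (.inr rfl : (1 / 2 : ℝ) = 3 ∨ (1 / 2 : ℝ) = 1 / 2)
  have hbid := sub_pos.2 hlam.2
  have hsum : 0 < lam + (1 - lam) * coefA (1 / 2) := by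
    rw [add_mul_coefA_half]
    linarith [hlam.1]
  have hcoef : coefA (1 / 2) < 1 := by norm_num [coefA]
  have hY0 : 0 < dualY0 lam (1 / 2) e s halfTime := by
    rw [dualY0_halfTime]
    positivity
  have hY1 : 0 < dualY1 lam (1 / 2) e s halfTime := by
    rw [dualY1_halfTime_down]
    positivity
  have hjump0 := dualY0_rightJump_eq (e := e) (s := s) hlam
  have hjump1 := dualY1_rightJump_eq (e := e) (s := s) hlam
  refine ⟨_, _, tendsto_dualY0_halfTime hs, tendsto_dualY1_halfTime hs, sub_neg.1 ?_,
    sub_neg.1 ?_, hjump0, hjump1⟩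
  · rw [hjump0]
    exact mul_neg_of_pos_of_neg hY0 (div_neg_of_neg_of_pos (neg_lt_zero.2 hlam.1) hsum)
  · rw [hjump1]
    exact mul_neg_of_pos_of_neg hY1 (div_neg_of_neg_of_pos
      (mul_neg_of_neg_of_pos (neg_lt_zero.2 hlam.1) (sub_pos.2 hcoef)) hsum)

end RightJump

end LadlagExample

open LadlagExample in
theorem mainTheorem9_general {Ω : Type*} [MeasurableSpace Ω] {P : Measure Ω}
    [IsProbabilityMeasure P] [P.IsComplete] {ε lam : ℝ} {ξ η θ : Ω → ℝ} {etaT : ℕ → Ω → ℝ}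
    (h : IsCostlyModel P ε lam ξ η θ) (hpos : ∀ n ω, 0 < etaT n ω)
    (hmeas : ∀ n, Measurable[MeasurableSpace.comap η inferInstance] (etaT n))
    (hmean : ∀ n, ∫ ω, etaT n ω ∂P = 1)
    (hb : Tendsto (fun n => ∫ ω, etaT n ω * (η ω - 1) ∂P) atTop (𝓝 (-1))) :
    (∀ᶠ n in atTop,
      IsCadlagMartingale (Z0 P lam ξ η θ etaT n) (marketFiltration P h.toIsModel) P ∧
      IsCadlagMartingale (Z1 P lam ξ η θ etaT n) (marketFiltration P h.toIsModel) P ∧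
      IsConsistentPriceSystem P (marketFiltration P h.toIsModel) lam (askProcess ξ η θ)
        (Z0 P lam ξ η θ etaT n) (Z1 P lam ξ η θ etaT n)) ∧
    (∀ τ : Ω → unitInterval, Measurable τ →
      TendstoInMeasure P
        (fun n ω => (Z0 P lam ξ η θ etaT n (τ ω) ω, Z1 P lam ξ η θ etaT n (τ ω) ω)) atTop
        (fun ω => (Y0 lam ξ η θ (τ ω) ω, Y1 lam ξ η θ (τ ω) ω))) ∧
    (∀ᵐ ω ∂P, IsLadlagPath (fun t => Y0 lam ξ η θ t ω) ∧
      IsLadlagPath (fun t => Y1 lam ξ η θ t ω)) ∧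
    (∀ᵐ ω ∂P, ξ ω = 1 / 2 → ∃ y₀ y₁ : ℝ,
      Tendsto (fun t => Y0 lam ξ η θ t ω) (𝓝[>] halfTime) (𝓝 y₀) ∧
      Tendsto (fun t => Y1 lam ξ η θ t ω) (𝓝[>] halfTime) (𝓝 y₁) ∧
      y₀ < Y0 lam ξ η θ halfTime ω ∧ y₁ < Y1 lam ξ η θ halfTime ω ∧
      y₀ - Y0 lam ξ η θ halfTime ω =
        Y0 lam ξ η θ halfTime ω * (-lam / (lam + (1 - lam) * coefA (1 / 2))) ∧
      y₁ - Y1 lam ξ η θ halfTime ω =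
        Y1 lam ξ η θ halfTime ω *
          (-lam * (1 - coefA (1 / 2)) / (lam + (1 - lam) * coefA (1 / 2)))) := by
  obtain ⟨r, g, heta, hg⟩ := h.exists_isTiltedDensity hpos hmeas hmean hb
  refine ⟨?_, fun τ hτ => h.tendstoInMeasure_Z hb heta hg hτ,
    ae_of_all _ fun ω => ⟨isLadlagPath_dualY0, isLadlagPath_dualY1⟩, ?_⟩
  · filter_upwards [hg] with n hn using h.isConsistentPriceSystem hn (heta n)
  · filter_upwards [h.ae_half_lt_jumpTime] with ω hs hx
    simpa only [Y0, Y1, hx] using rightJump_dual ⟨h.lam_pos, h.lam_lt_one⟩ (e := η ω) hs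

theorem mainTheorem9 (ε : ℝ) (hε : ε ∈ Set.Ioo (0 : ℝ) (1 / 3)) :
    ∃ lam₀ ∈ Set.Ioo (0 : ℝ) 1, ∀ lam ∈ Set.Ioo (0 : ℝ) lam₀,
    ∀ (Ω : Type*) [MeasurableSpace Ω] (P : Measure Ω) [IsProbabilityMeasure P] [P.IsComplete]
      (ξ η θ : Ω → ℝ) (h : LadlagExample.IsModel P ε ξ η θ)
      (etaT : ℕ → Ω → ℝ), LadlagExample.IsTilting P η etaT →
      -- martingales and consistent price systems, for sufficiently large `n`
      (∀ᶠ n in atTop,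
        LadlagExample.IsCadlagMartingale (LadlagExample.Z0 P lam ξ η θ etaT n)
          (LadlagExample.marketFiltration P h) P ∧
        LadlagExample.IsCadlagMartingale (LadlagExample.Z1 P lam ξ η θ etaT n)
          (LadlagExample.marketFiltration P h) P ∧
        LadlagExample.IsConsistentPriceSystem P (LadlagExample.marketFiltration P h) lam
          (LadlagExample.askProcess ξ η θ) (LadlagExample.Z0 P lam ξ η θ etaT n)
          (LadlagExample.Z1 P lam ξ η θ etaT n)) ∧
      -- convergence in probability at all `[0,1]`-valued stopping times
      (∀ τ : Ω → unitInterval,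
        IsStoppingTime (LadlagExample.marketFiltration P h)
          (fun ω => (τ ω : WithTop unitInterval)) →
        TendstoInMeasure P
          (fun n ω => (LadlagExample.Z0 P lam ξ η θ etaT n (τ ω) ω,
            LadlagExample.Z1 P lam ξ η θ etaT n (τ ω) ω)) atTop
          (fun ω => (LadlagExample.Y0 lam ξ η θ (τ ω) ω,
            LadlagExample.Y1 lam ξ η θ (τ ω) ω))) ∧
      -- the limit is làdlàg, with a right jump at time `1/2` on `{ξ = 1/2}`
      (∀ᵐ ω ∂P, LadlagExample.IsLadlagPath (fun t => LadlagExample.Y0 lam ξ η θ t ω) ∧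
        LadlagExample.IsLadlagPath (fun t => LadlagExample.Y1 lam ξ η θ t ω)) ∧
      (∀ᵐ ω ∂P, ξ ω = 1 / 2 → ∃ y₀ y₁ : ℝ,
        Tendsto (fun t => LadlagExample.Y0 lam ξ η θ t ω) (𝓝[>] LadlagExample.halfTime)
          (𝓝 y₀) ∧
        Tendsto (fun t => LadlagExample.Y1 lam ξ η θ t ω) (𝓝[>] LadlagExample.halfTime)
          (𝓝 y₁) ∧
        y₀ < LadlagExample.Y0 lam ξ η θ LadlagExample.halfTime ω ∧
        y₁ < LadlagExample.Y1 lam ξ η θ LadlagExample.halfTime ω ∧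
        y₀ - LadlagExample.Y0 lam ξ η θ LadlagExample.halfTime ω =
          LadlagExample.Y0 lam ξ η θ LadlagExample.halfTime ω *
            (-lam / (lam + (1 - lam) * LadlagExample.coefA (1 / 2))) ∧
        y₁ - LadlagExample.Y1 lam ξ η θ LadlagExample.halfTime ω =
          LadlagExample.Y1 lam ξ η θ LadlagExample.halfTime ω *
            (-lam * (1 - LadlagExample.coefA (1 / 2)) /
              (lam + (1 - lam) * LadlagExample.coefA (1 / 2)))) := by
  refine ⟨LadlagExample.costBound ε, ?_, fun lam hlam Ω _ P _ _ ξ η θ h etaT htilt => ?_⟩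
  · unfold LadlagExample.costBound
    constructor <;> linarith [hε.1, hε.2]
  · have hcost : LadlagExample.IsCostlyModel P ε lam ξ η θ :=
      { toIsModel := h, eps_pos := hε.1, lam_pos := hlam.1, lam_lt_costBound := hlam.2 }
    obtain ⟨hcps, hconv, hpaths⟩ := mainTheorem9_general hcost htilt.pos
      htilt.measurable htilt.mean htilt.tendsto
    exact ⟨hcps, fun τ hτ => hconv τ (LadlagExample.measurable_of_isStoppingTime hτ), hpaths⟩
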